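/- Let $\beta=\frac{\sqrt{17}-3}{2}$, let $\kappa>0$, and let $h(s)=(s(1-s))^\beta$ for $s\in[0,1]$. Let $\mathcal W=\bigcup_{n\ge 0}\{0,1\}^n$ be the set of finite words over $\{0,1\}$, and let $\{(U_x,V_x):x\in\mathcal W\}$ be independent and identically distributed random vectors with density $2\cdot\mathbf 1_{\{0\le u\le v\le 1\}}$ on $\mathbb R^2$. For $0\le u<v\le1$ with $v-u<1$ and functions $f_0,f_1:[0,1]\to\mathbb R$, let $$G[u,v;f_0,f_1](s)=\begin{cases}(1-(v-u))^\beta f_0\big(\frac{s}{1-(v-u)}\big)& s<u,\\ (1-(v-u))^\beta f_0\big(\frac{u}{1-(v-u)}\big)+(v-u)^\beta f_1\big(\frac{s-u}{v-u}\big)& u\le s<v,\\ (1-(v-u))^\beta f_0\big(\frac{s-(v-u)}{1-(v-u)}\big)& s\ge v.\end{cases}$$ For $x\in\mathcal W$ put $Z_0^{(x)}=\kappa h$ and $Z_{n+1}^{(x)}=G[U_x,V_x;Z_n^{(x0)},Z_n^{(x1)}]$, and let $Z_n=Z_n^{(\emptyset)}$. Let $Z$ be the limit of $Z_n$ for uniform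 convergence on $[0,1]$, which exists almost surely and is almost surely a continuous excursion: $Z(0)=Z(1)=0$ and $Z(s)>0$ for all $s\in(0,1)$. Let $d_Z(x,y)=Z(x)+Z(y)-2\inf\{Z(s):x\wedge y\le s\le x\vee y\}$ for $x,y\in[0,1]$, let $\mathcal T_Z$ be the quotient of $[0,1]$ by the relation $d_Z(x,y)=0$, equipped with the metric $d_Z$, and let $\pi_Z:[0,1]\to\mathcal T_Z$ be the canonical projection. The mass measure of $\mathcal T_Z$ is the push-forward of Lebesgue measure on $[0,1]$ by $\pi_Z$. The degree of a point $p\in\mathcal T_Z$ is the number of connected components of $\mathcal T_Z\setminus\{p\}$, and $p$ is a leaf if its degree is one. Then, almost surely, $(\mathcal T_Z,d_Z)$ is a real tree (that is, for all $p,q\in\mathcal T_Z$ there is a unique isometry from $[0,d_Z(p,q)]$ into $\mathcal T_Z$ that sends $0$ to $p$ and $d_Z(p,q)$ to $q$, and every continuous injective path from $p$ to $q$ has the same range as this isometry), it is compact, it is binary (every point has degree at most three), and its mass measure is concentrated on the leaves (almost every point for the mass measure is a leaf). -/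

import Mathlib

open MeasureTheory ProbabilityTheory Filter Topology Set
open scoped unitInterval ENNReal

namespace Lamination

noncomputable section

/-! ## The random process -/

/-- The exponent `β = (√17 - 3) / 2`. -/
def beta : ℝ := (Real.sqrt 17 - 3) / 2

/-- The law on `ℝ × ℝ` with density `2 · 1{0 ≤ u ≤ v ≤ 1}` with respect to Lebesgue measure. -/
def chordLaw : Measure (ℝ × ℝ) :=
  (volume : Measure (ℝ × ℝ)).withDensity
    ({p : ℝ × ℝ | 0 ≤ p.1 ∧ p.1 ≤ p.2 ∧ p.2 ≤ 1}.indicator fun _ => (2 : ℝ≥0∞))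

/-- The function `h(s) = (s (1 - s))^β`; only its values on `[0, 1]` matter. -/
def hfun (s : ℝ) : ℝ := (s * (1 - s)) ^ beta

/-- The operator `G[u, v; f₀, f₁]`; only its values on `[0, 1]` matter. -/
def glue (p : ℝ × ℝ) (f₀ f₁ : ℝ → ℝ) (s : ℝ) : ℝ :=
  let u := p.1
  let v := p.2
  if s < u then
    (1 - (v - u)) ^ beta * f₀ (s / (1 - (v - u)))
  else if s < v then
    (1 - (v - u)) ^ beta * f₀ (u / (1 - (v - u))) + (v - u) ^ beta * f₁ ((s - u) / (v - u))
  else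
    (1 - (v - u)) ^ beta * f₀ ((s - (v - u)) / (1 - (v - u)))

/-- The process `Z_n^{(x)}` built from a family `w` of pairs indexed by the nodes `x` of the
infinite binary tree (finite words over `{0, 1}`, encoded as `false`, `true`):
`Z_0^{(x)} = κ h` and `Z_{n+1}^{(x)} = G[u_x, v_x; Z_n^{(x0)}, Z_n^{(x1)}]`. -/
def approx (κ : ℝ) (w : List Bool → ℝ × ℝ) : ℕ → List Bool → ℝ → ℝ
  | 0, _ => fun s => κ * hfun s
  | n + 1, x => glue (w x) (approx κ w n (x ++ [false])) (approx κ w n (x ++ [true]))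

/-- The continuous function `f` is the uniform limit on `[0, 1]` of `Z_n = Z_n^∅`. -/
def IsUniformLimit (κ : ℝ) (w : List Bool → ℝ × ℝ) (f : C(I, ℝ)) : Prop :=
  TendstoUniformly (fun (n : ℕ) (s : I) => approx κ w n [] (s : ℝ)) f atTop

open Classical in
/-- The process `Z`: the (unique) continuous uniform limit of `Z_n` where it exists, and `0`
otherwise. -/
def limitProcess (κ : ℝ) (w : List Bool → ℝ × ℝ) : C(I, ℝ) :=
  if h : ∃ f : C(I, ℝ), IsUniformLimit κ w f then h.choose else 0

/-! ## The tree coded by a continuous function on `[0, 1]` -/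

/-- `d_f(x, y) = f(x) + f(y) - 2 inf {f(s) : x ∧ y ≤ s ≤ x ∨ y}`. -/
def codedDist (f : C(I, ℝ)) (x y : I) : ℝ := f x + f y - 2 * sInf (f '' uIcc x y)

theorem bddBelow_image (f : C(I, ℝ)) (x y : I) : BddBelow (f '' uIcc x y) :=
  (isCompact_uIcc.image f.continuous).bddBelow

theorem codedDist_self (f : C(I, ℝ)) (x : I) : codedDist f x x = 0 := by
  simp only [codedDist, uIcc_self, image_singleton, csInf_singleton]
  ring

theorem codedDist_comm (f : C(I, ℝ)) (x y : I) : codedDist f x y = codedDist f y x := by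
  simp only [codedDist, uIcc_comm x y]
  ring

theorem codedDist_triangle (f : C(I, ℝ)) (x y z : I) :
    codedDist f x z ≤ codedDist f x y + codedDist f y z := by
  have h1 : sInf (f '' uIcc x y) ≤ f y :=
    csInf_le (bddBelow_image f x y) ⟨y, right_mem_uIcc, rfl⟩
  have h2 : sInf (f '' uIcc y z) ≤ f y :=
    csInf_le (bddBelow_image f y z) ⟨y, left_mem_uIcc, rfl⟩
  have h3 : min (sInf (f '' uIcc x y)) (sInf (f '' uIcc y z)) ≤ sInf (f '' uIcc x z) := by
    refine le_csInf ⟨f x, x, left_mem_uIcc, rfl⟩ ?_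
    rintro _ ⟨s, hs, rfl⟩
    rcases uIcc_subset_uIcc_union_uIcc hs with h | h
    · exact (min_le_left _ _).trans (csInf_le (bddBelow_image f x y) ⟨s, h, rfl⟩)
    · exact (min_le_right _ _).trans (csInf_le (bddBelow_image f y z) ⟨s, h, rfl⟩)
  simp only [codedDist]
  rcases min_le_iff.1 h3 with h | h <;> linarith

/-- The unit interval, to be equipped with the pseudo-metric `d_f`. -/
def CodedInterval (_f : C(I, ℝ)) : Type := I

instance (f : C(I, ℝ)) : PseudoMetricSpace (CodedInterval f) where
  dist x y := codedDist f x y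
  dist_self := codedDist_self f
  dist_comm := codedDist_comm f
  dist_triangle := codedDist_triangle f

/-- The metric space `(𝒯_f, d_f)`: the quotient of `[0, 1]` by `d_f(x, y) = 0`. -/
abbrev CodedTree (f : C(I, ℝ)) : Type := SeparationQuotient (CodedInterval f)

/-- The canonical projection `π_f : [0, 1] → 𝒯_f`. -/
def proj (f : C(I, ℝ)) (s : I) : CodedTree f :=
  SeparationQuotient.mk (show CodedInterval f from s)

instance (f : C(I, ℝ)) : MeasurableSpace (CodedTree f) := borel _

instance (f : C(I, ℝ)) : BorelSpace (CodedTree f) := ⟨rfl⟩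

theorem dist_proj (f : C(I, ℝ)) (s t : I) : dist (proj f s) (proj f t) = codedDist f s t := rfl

theorem continuous_proj (f : C(I, ℝ)) : Continuous (proj f) := by
  have hf : UniformContinuous f := CompactSpace.uniformContinuous_of_continuous f.continuous
  refine Metric.continuous_iff.2 fun t ε hε => ?_
  obtain ⟨δ, hδ, H⟩ := Metric.uniformContinuous_iff.1 hf (ε / 4) (by positivity)
  refine ⟨δ, hδ, fun s hs => ?_⟩
  rw [dist_proj]
  have key : ∀ r ∈ uIcc s t, f t - ε / 4 ≤ f r := by
    intro r hr
    have h1 : dist r t ≤ dist s t := by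
      have hr' : (r : ℝ) ∈ uIcc (s : ℝ) (t : ℝ) := by
        rcases mem_uIcc.1 hr with h | h
        · exact mem_uIcc.2 (Or.inl h)
        · exact mem_uIcc.2 (Or.inr h)
      exact Real.dist_right_le_of_mem_uIcc hr'
    have h2 := H (h1.trans_lt hs)
    rw [Real.dist_eq, abs_lt] at h2
    linarith
  have h3 : f t - ε / 4 ≤ sInf (f '' uIcc s t) := by
    refine le_csInf ⟨f s, s, left_mem_uIcc, rfl⟩ ?_
    rintro _ ⟨r, hr, rfl⟩
    exact key r hr
  have h4 := H hs
  rw [Real.dist_eq, abs_lt] at h4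
  simp only [codedDist]
  linarith

/-- The mass measure on `𝒯_f`: the push-forward of Lebesgue measure on `[0, 1]` by `π_f`. -/
def massMeasure (f : C(I, ℝ)) : Measure (CodedTree f) :=
  (volume : Measure I).map (proj f)

/-- The mass measure is a probability measure. -/
theorem massMeasure_isProbability (f : C(I, ℝ)) : IsProbabilityMeasure (massMeasure f) :=
  Measure.isProbabilityMeasure_map (continuous_proj f).measurable.aemeasurable

/-! ## Real trees -/

/-- `φ` is an isometry from `[0, d(x, y)]` into `X` that goes from `x` to `y`. -/
def IsGeodesic {X : Type*} [MetricSpace X] (x y : X) (φ : Icc (0 : ℝ) (dist x y) → X) : Prop :=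
  Isometry φ ∧ φ ⟨0, le_rfl, dist_nonneg⟩ = x ∧ φ ⟨dist x y, dist_nonneg, le_rfl⟩ = y

/-- A real tree (without the requirement of compactness): any two points are joined by a unique
geodesic, and its range is also the range of every injective path between these points. -/
def IsRealTree (X : Type*) [MetricSpace X] : Prop :=
  ∀ x y : X, ∃ φ : Icc (0 : ℝ) (dist x y) → X,
    IsGeodesic x y φ ∧ (∀ ψ, IsGeodesic x y ψ → ψ = φ) ∧
      ∀ q : I → X, Continuous q → Function.Injective q → q 0 = x → q 1 = y → range q = range φ

/-- The degree of `x`: the number (possibly infinite) of connected components of `X ∖ {x}`. -/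
def degree {X : Type*} [TopologicalSpace X] (x : X) : ℕ∞ :=
  ENat.card (ConnectedComponents ({x}ᶜ : Set X))

/-- A leaf is a point of degree one. -/
def IsLeaf {X : Type*} [TopologicalSpace X] (x : X) : Prop := degree x = 1

/-- A tree is binary when all its points have degree at most three. -/
def IsBinary (X : Type*) [TopologicalSpace X] : Prop := ∀ x : X, degree x ≤ 3

end

end Lamination

/-! The metric half is deterministic. For a continuous `f`, the tree is compact as a continuous
image of the unit interval. It is a real tree because minima over intervals satisfy the ultrametric
inequality `min_meet_le`. The segment from `s` to `t` goes down from `s` to the height of the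
minimum and then up to `t`. Any connected set that contains both ends contains every point of it
(`IsOnSegment.mem_of_isPreconnected`), which gives uniqueness of geodesics and of arcs. If `f` is an
excursion, the complement of a point is the image of the gaps between its preimages, and the two
extreme gaps meet at the root, since 0 and 1 are identified. So a point with at most three preimages
has degree at most three, and a point with one preimage is a leaf.

Convergence rests on `h` being a fixed point of the averaged gluing (`lintegral_glue_hfun`), which
is where β² + 3β = 2 enters. The increments are therefore centred, and by linearity they obey the
gluing recursion themselves. At a given point, their second moment contracts by E[l^(2β) +
(1-l)^(2β)] = 2/(2β+1) < 1, where l is the mass of the outer fragment. A bound for the supremum of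
the increments contracts in the same way, up to the value of the outer increment at one point that
is independent of it. Hence these bounds decay geometrically in L², are almost surely summable, and
the convergence is uniform.

The remaining properties come from one zero-one argument (`ae_not_of_reduces`). A uniform point
falls into one of the two fragments and is uniform there. The foot of the inner fragment is uniform
on the outer one, independently of the masses. Let p be the probability that a bad event occurs for
uniform points. Given the fragments that contain these points, the event either is impossible or
forces the same event inside one fragment, with the foot possibly standing for a point. Each case
thus contributes a conditional probability at most p. If one case of positive probability
contributes at most θp with θ < 1, then p = 0. This is applied to three events: a minimum that is
not positive (positivity of the limit), a point that is minimal on its way to another (leaves), and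
three points with equal pairwise minima (binarity). -/

namespace Lamination

/-! ## The tree coded by a continuous function -/

/-- The minimum of `f` between `x` and `y`. -/
noncomputable def meet (f : C(I, ℝ)) (x y : I) : ℝ := sInf (f '' uIcc x y)

section Meet

variable (f : C(I, ℝ))

theorem exists_meet (x y : I) : ∃ r ∈ uIcc x y, f r = meet f x y := by
  have := (isCompact_uIcc (a := x) (b := y)).image f.continuous
  obtain ⟨r, hr, h⟩ := this.sInf_mem ⟨f x, x, left_mem_uIcc, rfl⟩
  exact ⟨r, hr, h⟩

theorem meet_le {x y r : I} (hr : r ∈ uIcc x y) : meet f x y ≤ f r :=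
  csInf_le (bddBelow_image f x y) ⟨r, hr, rfl⟩

theorem meet_le_left (x y : I) : meet f x y ≤ f x := meet_le f left_mem_uIcc

theorem meet_le_right (x y : I) : meet f x y ≤ f y := meet_le f right_mem_uIcc

theorem le_meet {x y : I} {c : ℝ} (h : ∀ r ∈ uIcc x y, c ≤ f r) : c ≤ meet f x y := by
  obtain ⟨r, hr, e⟩ := exists_meet f x y
  exact e ▸ h r hr

theorem meet_comm (x y : I) : meet f x y = meet f y x := by rw [meet, uIcc_comm, meet]

theorem meet_self (x : I) : meet f x x = f x := by simp [meet]

theorem min_meet_le (x y z : I) : min (meet f x y) (meet f y z) ≤ meet f x z := by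
  refine le_meet f fun r hr => ?_
  rcases uIcc_subset_uIcc_union_uIcc hr with h | h
  · exact (min_le_left _ _).trans (meet_le f h)
  · exact (min_le_right _ _).trans (meet_le f h)

theorem dist_proj_eq (x y : I) : dist (proj f x) (proj f y) = f x + f y - 2 * meet f x y := rfl

variable {f}

theorem proj_eq_of_le {x y : I} (h : f x + f y - 2 * meet f x y ≤ 0) : proj f x = proj f y :=
  dist_le_zero.1 ((dist_proj_eq f x y).trans_le h)

theorem proj_eq_iff {x y : I} : proj f x = proj f y ↔ f x = meet f x y ∧ f y = meet f x y := by
  rw [← dist_eq_zero, dist_proj_eq]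
  have := meet_le_left f x y
  have := meet_le_right f x y
  constructor
  · intro h
    constructor <;> linarith
  · rintro ⟨h1, h2⟩
    linarith

theorem surjective_proj : Function.Surjective (proj f) := fun q =>
  SeparationQuotient.surjective_mk (X := CodedInterval f) q

variable (f) in
/-- The function coding a tree is a continuous function of the point of the tree. -/
theorem exists_height : ∃ H : CodedTree f → ℝ, Continuous H ∧ ∀ x, H (proj f x) = f x := by
  -- A lowest point `r` serves as root: the distance to it is the difference of heights, hence
  -- continuous on the tree.
  obtain ⟨r, -, hr⟩ := isCompact_univ.exists_isMinOn (univ_nonempty (α := I)) f.continuous.continuousOn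
  refine ⟨fun q => dist (proj f r) q + f r, (continuous_const.dist continuous_id).add continuous_const,
    fun x => ?_⟩
  have h1 : meet f r x = f r :=
    le_antisymm (meet_le_left f r x) (le_meet f fun y _ => hr (mem_univ y))
  change dist (proj f r) (proj f x) + f r = f x
  rw [dist_proj_eq, h1]
  ring

/-- Any level between `meet f s t` and `f s` is the height of an ancestor of `s`. -/
theorem exists_ancestor {s t : I} {a : ℝ} (h1 : meet f s t ≤ a) (h2 : a ≤ f s) :
    ∃ r, meet f s r = a ∧ f r = a := by
  have hK : IsCompact (uIcc s t ∩ {r | f r ≤ a}) :=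
    isCompact_uIcc.inter_right (isClosed_le f.continuous continuous_const)
  obtain ⟨m, hm, em⟩ := exists_meet f s t
  -- The ancestor is the point nearest to `s` among those between `s` and `t` at level at most `a`.
  -- Before it `f` stays above `a`, and the intermediate value theorem gives equality at it.
  obtain ⟨r, ⟨hr, hra⟩, hmin⟩ := hK.exists_isMinOn ⟨m, hm, em.trans_le h1⟩
    (f := fun r : I => |(r : ℝ) - s|) (by fun_prop)
  have key : ∀ y ∈ uIcc s r, f y ≤ a → y = r := by
    intro y hy hya
    have := hmin (a := y) ⟨uIcc_subset_uIcc left_mem_uIcc hr hy, hya⟩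
    simp only [mem_ofPred_eq] at this
    apply Subtype.ext
    rcases mem_uIcc.1 hy with ⟨h, h'⟩ | ⟨h, h'⟩
    · have e1 : (s : ℝ) ≤ y := h
      have e2 : (y : ℝ) ≤ r := h'
      rw [abs_of_nonneg (by linarith), abs_of_nonneg (by linarith)] at this
      linarith
    · have e1 : (r : ℝ) ≤ y := h
      have e2 : (y : ℝ) ≤ s := h'
      rw [abs_of_nonpos (by linarith), abs_of_nonpos (by linarith)] at this
      linarith
  have hfr : f r = a := by
    obtain ⟨y, hy, hya⟩ := intermediate_value_uIcc (a := s) (b := r) f.continuous.continuousOn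
      (mem_uIcc.2 (Or.inr ⟨hra, h2⟩))
    rw [← key y hy hya.le, hya]
  refine ⟨r, le_antisymm ((meet_le_right f s r).trans_eq hfr) (le_meet f fun y hy => ?_), hfr⟩
  by_contra! h
  have := key y hy h.le
  rw [this] at h
  linarith

/-- A point of height `f r` on the way from `s` down to its meet with `t` separates `s` and `t`. -/
theorem proj_mem_of_isPreconnected {s t r : I} (hr : meet f s r = f r) (hs : f r < f s)
    (ht : meet f s t ≤ f r) {S : Set (CodedTree f)} (hS : IsPreconnected S) (hsS : proj f s ∈ S)
    (htS : proj f t ∈ S) : proj f r ∈ S := by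
  by_contra hrS
  obtain ⟨H, hH, Hp⟩ := exists_height f
  -- `M` is the Gromov product seen from `s`: it is the height of the meet with `s`, but written
  -- with the metric, so it is visibly continuous.
  let M : CodedTree f → ℝ := fun q => (f s + H q - dist (proj f s) q) / 2
  have hM : Continuous M := by fun_prop
  have Mp : ∀ x, M (proj f x) = meet f s x := by
    intro x
    simp only [M, Hp, dist_proj_eq]
    ring
  -- The points branching off above `r` form an open set. Its only possible boundary point is the
  -- point of `r`, which `S` avoids, so `S` would stay in it, although it contains `t`.
  have hsub := hS.subset_of_closure_inter_subset (u := {q | f r < M q})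
    (isOpen_lt continuous_const hM) ⟨proj f s, hsS, by simpa [Mp, meet_self] using hs⟩ ?_
  · have := hsub htS
    rw [mem_ofPred_eq, Mp] at this
    linarith
  rintro q ⟨hq, hqS⟩
  obtain ⟨y, rfl⟩ := surjective_proj q
  have h1 := closure_lt_subset_le continuous_const hM hq
  simp only [mem_ofPred_eq, Mp] at h1 ⊢
  refine h1.lt_of_ne fun h2 => hrS ?_
  -- If `y` were higher than `r`, a close enough point `y'` of the open set would meet `y` above `f
  -- r`, and then `s` would meet `y` above `f r` too.
  have h3 : f y = f r := by
    have h4 := meet_le_right f s y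
    by_contra h5
    have h6 : f r < f y := lt_of_le_of_ne (by linarith) (Ne.symm h5)
    obtain ⟨q', hq', hd⟩ := Metric.mem_closure_iff.1 hq (f y - f r) (by linarith)
    obtain ⟨y', rfl⟩ := surjective_proj q'
    simp only [mem_ofPred_eq, Mp] at hq'
    have h7 := min_meet_le f s y' y
    rw [dist_proj_eq, meet_comm] at hd
    have h8 := meet_le_right f s y'
    rcases min_le_iff.1 h7 with h | h <;> linarith
  have h4 := min_meet_le f y s r
  rw [meet_comm f y s, ← h2, hr, min_self] at h4
  rwa [← proj_eq_of_le (x := y) (y := r) (by linarith)]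

/-- `r` codes the point at distance `x` from `s` on the segment from `s` to `t`. -/
def IsOnSegment (f : C(I, ℝ)) (s t : I) (x : ℝ) (r : I) : Prop :=
  meet f s t ≤ f r ∧ ((meet f s r = f r ∧ f r = f s - x) ∨
    (meet f t r = f r ∧ f r = x + 2 * meet f s t - f s))

theorem exists_isOnSegment (s t : I) {x : ℝ} (h0 : 0 ≤ x) (h1 : x ≤ f s + f t - 2 * meet f s t) :
    ∃ r, IsOnSegment f s t x r := by
  rcases le_total (meet f s t) (f s - x) with h | h
  · obtain ⟨r, hr, hr'⟩ := exists_ancestor h (by linarith)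
    exact ⟨r, by linarith, Or.inl ⟨by linarith, hr'⟩⟩
  · obtain ⟨r, hr, hr'⟩ := exists_ancestor (f := f) (s := t) (t := s)
      (a := x + 2 * meet f s t - f s) (by rw [meet_comm]; linarith) (by linarith)
    exact ⟨r, by linarith, Or.inr ⟨by linarith, hr'⟩⟩

/-- Ancestors of one point are totally ordered, so the lower of the two is their meet. -/
theorem meet_ancestors {s r r' : I} (h1 : meet f s r = f r) (h2 : meet f s r' = f r') :
    meet f r r' = min (f r) (f r') := by
  refine le_antisymm (le_min (meet_le_left f r r') (meet_le_right f r r')) ?_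
  have := min_meet_le f r s r'
  rwa [meet_comm f r s, h1, h2] at this

/-- Ancestors on the two different sides of a segment can only communicate through its lowest point;
both bounds are ultrametric inequalities. -/
theorem meet_cross {s t r r' : I} (h1 : meet f s r = f r) (h2 : meet f t r' = f r')
    (h3 : meet f s t ≤ f r) (h4 : meet f s t ≤ f r') : meet f r r' = meet f s t := by
  apply le_antisymm
  · by_contra! h
    have a1 := min_meet_le f s r r'
    have a2 := min_meet_le f s r' t
    have a3 := meet_le_left f r r'
    have a4 := meet_le_right f r r'
    rw [meet_comm f r' t, h2] at a2
    rw [h1] at a1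
    have a5 : meet f s t < meet f s r' := lt_of_lt_of_le (lt_min (by linarith) h) a1
    have a6 := lt_min a5 (h.trans_le a4)
    linarith
  · have a1 := min_meet_le f r s r'
    have a2 := min_meet_le f s t r'
    rw [h2, min_eq_left h4] at a2
    rw [meet_comm f r s, h1] at a1
    exact (le_min h3 a2).trans a1

theorem IsOnSegment.dist_eq {s t r r' : I} {x x' : ℝ} (h : IsOnSegment f s t x r)
    (h' : IsOnSegment f s t x' r') (hx : x ≤ x') : dist (proj f r) (proj f r') = x' - x := by
  rw [dist_proj_eq]
  obtain ⟨h0, ⟨h1, h2⟩ | ⟨h1, h2⟩⟩ := h <;> obtain ⟨h0', ⟨h1', h2'⟩ | ⟨h1', h2'⟩⟩ := h'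
  · rw [meet_ancestors h1 h1', min_eq_right (by linarith)]
    linarith
  · rw [meet_cross h1 h1' h0 h0']
    linarith
  · rw [meet_comm, meet_cross h1' h1 h0' h0]
    linarith
  · rw [meet_ancestors h1 h1', min_eq_left (by linarith)]
    linarith

theorem IsOnSegment.left (s t : I) : IsOnSegment f s t 0 s :=
  ⟨meet_le_left f s t, Or.inl ⟨meet_self f s, by ring⟩⟩

theorem IsOnSegment.right (s t : I) : IsOnSegment f s t (f s + f t - 2 * meet f s t) t :=
  ⟨meet_le_right f s t, Or.inr ⟨meet_self f t, by ring⟩⟩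

theorem IsOnSegment.mem_of_isPreconnected {s t r : I} {x : ℝ} (h : IsOnSegment f s t x r)
    {S : Set (CodedTree f)} (hS : IsPreconnected S) (hsS : proj f s ∈ S) (htS : proj f t ∈ S) :
    proj f r ∈ S := by
  have aux : ∀ {s t : I}, meet f s r = f r → meet f s t ≤ f r → proj f s ∈ S → proj f t ∈ S →
      proj f r ∈ S := by
    intro s t h1 h2 hs ht
    have h3 := meet_le_left f s r
    rcases h3.lt_or_eq with h4 | h4
    · exact proj_mem_of_isPreconnected h1 (by linarith) h2 hS hs ht
    · rwa [← proj_eq_of_le (x := s) (y := r) (by linarith)]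
  obtain ⟨h0, ⟨h1, -⟩ | ⟨h1, -⟩⟩ := h
  · exact aux h1 h0 hsS htS
  · exact aux h1 (by rwa [meet_comm]) htS hsS

theorem isRealTree_codedTree (f : C(I, ℝ)) : IsRealTree (CodedTree f) := by
  intro x y
  obtain ⟨s, rfl⟩ := surjective_proj x
  obtain ⟨t, rfl⟩ := surjective_proj y
  have hex : ∀ a : Icc (0 : ℝ) (dist (proj f s) (proj f t)), ∃ r, IsOnSegment f s t a r :=
    fun a => exists_isOnSegment s t a.2.1 a.2.2
  choose r hr using hex
  let φ : Icc (0 : ℝ) (dist (proj f s) (proj f t)) → CodedTree f := fun a => proj f (r a)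
  have hiso : Isometry φ := by
    refine Isometry.of_dist_eq fun a b => ?_
    rw [Subtype.dist_eq, Real.dist_eq]
    rcases le_total (a : ℝ) b with h | h
    · rw [(hr a).dist_eq (hr b) h, abs_of_nonpos (by linarith)]
      ring
    · rw [dist_comm, (hr b).dist_eq (hr a) h, abs_of_nonneg (by linarith)]
  have hleft : φ ⟨0, le_rfl, dist_nonneg⟩ = proj f s := by
    rw [← dist_eq_zero, dist_comm, (IsOnSegment.left s t).dist_eq (hr _) le_rfl]
    simp
  have hright : φ ⟨dist (proj f s) (proj f t), dist_nonneg, le_rfl⟩ = proj f t := by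
    rw [← dist_eq_zero, (hr _).dist_eq (IsOnSegment.right s t) le_rfl]
    simp [dist_proj_eq]
  have hmem : ∀ {S : Set (CodedTree f)}, IsPreconnected S → proj f s ∈ S → proj f t ∈ S →
      range φ ⊆ S := by
    rintro S hS h1 h2 _ ⟨a, rfl⟩
    exact (hr a).mem_of_isPreconnected hS h1 h2
  have hpc : PreconnectedSpace (Icc (0 : ℝ) (dist (proj f s) (proj f t))) :=
    Subtype.preconnectedSpace isPreconnected_Icc
  refine ⟨φ, ⟨hiso, hleft, hright⟩, ?_, ?_⟩
  · rintro ψ ⟨h1, h2, h3⟩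
    funext a
    -- The range of `ψ` is connected, so it contains the point of `φ` at parameter `a`. Comparing
    -- the distances to the origin shows that `ψ` reaches it at the same parameter.
    obtain ⟨b, hb⟩ := hmem (isPreconnected_range h1.continuous) ⟨_, h2⟩ ⟨_, h3⟩ ⟨a, rfl⟩
    have e1 := (hiso.dist_eq a ⟨0, le_rfl, dist_nonneg⟩).symm.trans
      ((congrArg₂ dist hb (h2.trans hleft.symm)).symm.trans (h1.dist_eq b ⟨0, le_rfl, dist_nonneg⟩))
    rw [Subtype.dist_eq, Subtype.dist_eq, Real.dist_eq,
      Real.dist_eq, sub_zero, sub_zero, abs_of_nonneg a.2.1, abs_of_nonneg b.2.1] at e1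
    rw [← hb, Subtype.ext e1]
  · intro q hq hinj h0 h1
    refine Subset.antisymm ?_ (hmem (isPreconnected_range hq) ⟨0, h0⟩ ⟨1, h1⟩)
    have hsub := hmem (isPreconnected_range hq) ⟨0, h0⟩ ⟨1, h1⟩
    -- An injective path is a closed map, so the preimage of the segment is connected. It contains
    -- both ends of the unit interval, hence everything: the path never leaves the segment.
    have hpre := (isPreconnected_range hiso.continuous).preimage_of_isClosedMap hinj
      hq.isClosedMap hsub
    rintro _ ⟨i, rfl⟩
    refine hpre.Icc_subset (a := 0) (b := 1) ?_ ?_ ⟨i.2.1, i.2.2⟩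
    · rw [mem_preimage, h0]
      exact ⟨_, hleft⟩
    · rw [mem_preimage, h1]
      exact ⟨_, hright⟩

theorem compactSpace_codedTree (f : C(I, ℝ)) : CompactSpace (CodedTree f) := by
  rw [← isCompact_univ_iff, ← (surjective_proj (f := f)).range_eq]
  exact isCompact_range (continuous_proj f)

end Meet

/-! ## Degrees -/

/-- A space covered by `n` preconnected sets has at most `n` connected components. -/
theorem card_connectedComponents_le {X : Type*} [TopologicalSpace X] {n : ℕ} (S : Fin n → Set X)
    (hS : ∀ i, IsPreconnected (S i)) (hcov : ∀ x, ∃ i, x ∈ S i) :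
    ENat.card (ConnectedComponents X) ≤ n := by
  have hrep : ∀ c : ConnectedComponents X, ∃ i, ∃ x ∈ S i, (x : ConnectedComponents X) = c := by
    intro c
    obtain ⟨x, rfl⟩ := ConnectedComponents.surjective_coe c
    obtain ⟨i, hi⟩ := hcov x
    exact ⟨i, x, hi, rfl⟩
  choose i x hx hc using hrep
  have hinj : Function.Injective i := by
    intro c c' h
    rw [← hc c, ← hc c', ConnectedComponents.coe_eq_coe']
    exact (hS (i c')).subset_connectedComponent (hx c') (h ▸ hx c)
  simpa using ENat.card_le_card_of_injective hinj

/-- The degree of a point is bounded by the number of connected sets needed to cover its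
complement. -/
theorem degree_le {X : Type*} [TopologicalSpace X] {n : ℕ} (p : X) (S : Fin n → Set X)
    (hS : ∀ i, IsPreconnected (S i)) (hcov : ({p}ᶜ : Set X) = ⋃ i, S i) : degree p ≤ n := by
  refine card_connectedComponents_le (fun i => ((↑) : ({p}ᶜ : Set X) → X) ⁻¹' S i) (fun i => ?_) ?_
  · rw [Topology.IsInducing.subtypeVal.isPreconnected_image.symm, Subtype.image_preimage_coe,
      inter_eq_right.2 (hcov ▸ subset_iUnion S i)]
    exact hS i
  · rintro ⟨x, hx⟩
    rw [hcov] at hx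
    simpa using hx

/-! ### Components of the complement of a point in the tree of an excursion -/

section Excursion

variable {f : C(I, ℝ)}

/-- The left and right arms each reach the root, because the two ends of the interval code the same
point. -/
theorem isPreconnected_outer (h0 : f 0 = 0) (h1 : f 1 = 0) (hnn : ∀ s, 0 ≤ f s) (a c : I) :
    IsPreconnected (proj f '' Iio a ∪ proj f '' Ioi c) := by
  have e : proj f 0 = proj f 1 := by
    refine proj_eq_of_le ?_
    have : 0 ≤ meet f 0 1 := le_meet f fun r _ => hnn r
    linarith
  have ha : IsPreconnected (proj f '' Iio a) := isPreconnected_Iio.image _ (continuous_proj f).continuousOn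
  have hc : IsPreconnected (proj f '' Ioi c) := isPreconnected_Ioi.image _ (continuous_proj f).continuousOn
  rcases (Iio a).eq_empty_or_nonempty with h | ⟨x, hx⟩
  · simpa [h] using hc
  rcases (Ioi c).eq_empty_or_nonempty with h | ⟨y, hy⟩
  · simpa [h] using ha
  exact ha.union (proj f 0) ⟨0, lt_of_le_of_lt x.2.1 hx, rfl⟩
    (e ▸ ⟨1, lt_of_lt_of_le hy y.2.2, rfl⟩) hc

theorem compl_proj_eq {a b c : I} (hab : a ≤ b) (hbc : b ≤ c)
    (hE : {s | proj f s = proj f b} = {a, b, c}) :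
    ({proj f b}ᶜ : Set (CodedTree f)) =
      (proj f '' Iio a ∪ proj f '' Ioi c) ∪ (proj f '' Ioo a b ∪ proj f '' Ioo b c) := by
  have hE' : ∀ s, proj f s = proj f b ↔ s = a ∨ s = b ∨ s = c := fun s =>
    (Set.ext_iff.1 hE s).trans (by simp)
  rw [← image_union, ← image_union, ← image_union]
  ext q
  constructor
  · intro hq
    obtain ⟨s, rfl⟩ := surjective_proj q
    refine ⟨s, ?_, rfl⟩
    have h := (hE' s).not.1 hq
    push Not at h
    obtain ⟨h1, h2, h3⟩ := h
    simp only [mem_union, mem_Iio, mem_Ioi, mem_Ioo]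
    rcases lt_or_gt_of_ne h1 with h | h
    · exact Or.inl (Or.inl h)
    rcases lt_or_gt_of_ne h3 with h' | h'
    · rcases lt_or_gt_of_ne h2 with h'' | h''
      · exact Or.inr (Or.inl ⟨h, h''⟩)
      · exact Or.inr (Or.inr ⟨h'', h'⟩)
    · exact Or.inl (Or.inr h')
  · rintro ⟨s, hs, rfl⟩
    rw [mem_compl_singleton_iff, Ne, hE']
    simp only [mem_union, mem_Iio, mem_Ioi, mem_Ioo] at hs
    rintro (rfl | rfl | rfl)
    · rcases hs with (h | h) | (h | h)
      · exact h.false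
      · exact (hab.trans hbc).not_gt h
      · exact h.1.false
      · exact hab.not_gt h.1
    · rcases hs with (h | h) | (h | h)
      · exact hab.not_gt h
      · exact hbc.not_gt h
      · exact h.2.false
      · exact h.1.false
    · rcases hs with (h | h) | (h | h)
      · exact (hab.trans hbc).not_gt h
      · exact h.false
      · exact hbc.not_gt h.2
      · exact h.2.false

/-- Three preimages leave four gaps, but the two extreme gaps have a connected union. Coincidences
among `a`, `b`, `c` only make some gaps empty. -/
theorem degree_le_three (h0 : f 0 = 0) (h1 : f 1 = 0) (hnn : ∀ s, 0 ≤ f s) {a b c : I}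
    (hab : a ≤ b) (hbc : b ≤ c) (hE : {s | proj f s = proj f b} = {a, b, c}) :
    degree (proj f b) ≤ 3 := by
  refine degree_le (n := 3) _ ![proj f '' Iio a ∪ proj f '' Ioi c, proj f '' Ioo a b,
    proj f '' Ioo b c] ?_ ?_
  · have hi : ∀ x y : I, IsPreconnected (proj f '' Ioo x y) := fun x y =>
      isPreconnected_Ioo.image _ (continuous_proj f).continuousOn
    intro i
    fin_cases i
    · exact isPreconnected_outer h0 h1 hnn a c
    · exact hi a b
    · exact hi b c
  · rw [compl_proj_eq hab hbc hE]
    ext q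
    simp [Fin.exists_fin_succ, or_assoc]

theorem isLeaf_proj (h0 : f 0 = 0) (h1 : f 1 = 0) (hpos : ∀ s, 0 < s → s < 1 → 0 < f s) {b : I}
    (hE : ∀ s, proj f s = proj f b → s = b) : IsLeaf (proj f b) := by
  have hnn : ∀ s, 0 ≤ f s := by
    intro s
    rcases eq_or_lt_of_le (show 0 ≤ s from s.2.1) with h | h
    · rw [← h, h0]
    rcases eq_or_lt_of_le (show s ≤ 1 from s.2.2) with h' | h'
    · rw [h', h1]
    exact (hpos s h h').le
  have hE' : {s | proj f s = proj f b} = {b, b, b} := by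
    ext s
    simpa using ⟨hE s, fun h => h ▸ rfl⟩
  have hco := compl_proj_eq le_rfl le_rfl hE'
  apply le_antisymm
  · refine degree_le (n := 1) _ ![proj f '' Iio b ∪ proj f '' Ioi b] ?_ ?_
    · intro i
      fin_cases i
      exact isPreconnected_outer h0 h1 hnn b b
    · rw [hco]
      ext q
      simp
  -- A lower bound on the degree needs a nonempty complement. One end of the interval differs from
  -- `b`, so by uniqueness of the preimage it codes another point.
  · have hne : ∃ q, q ≠ proj f b := by
      by_cases h : b = 0
      · exact ⟨proj f 1, fun h' => by simpa [h] using hE 1 h'⟩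
      · exact ⟨proj f 0, fun h' => h (hE 0 h').symm⟩
    obtain ⟨q, hq⟩ := hne
    rw [degree, ENat.one_le_card_iff_nonempty]
    exact ⟨((⟨q, hq⟩ : ({proj f b}ᶜ : Set (CodedTree f))) : ConnectedComponents _)⟩

end Excursion

/-! ## Changes of variables -/

theorem lintegral_eq_affine {c : ℝ} (hc : 0 < c) (d : ℝ) {k : ℝ → ℝ≥0∞} (hk : Measurable k) :
    ∫⁻ u, k u = ENNReal.ofReal c * ∫⁻ s, k (c * s + d) := by
  rw [← lintegral_add_right_eq_self k d]
  conv_lhs => rw [← Real.smul_map_volume_mul_left hc.ne', lintegral_smul_measure,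
    lintegral_map (by fun_prop) (by fun_prop), abs_of_pos hc, smul_eq_mul]

theorem setLIntegral_Ioo_eq_affine {c : ℝ} (hc : 0 < c) (d a b : ℝ) {k : ℝ → ℝ≥0∞}
    (hk : Measurable k) :
    ∫⁻ u in Ioo (c * a + d) (c * b + d), k u =
      ENNReal.ofReal c * ∫⁻ s in Ioo a b, k (c * s + d) := by
  rw [← lintegral_indicator measurableSet_Ioo, ← lintegral_indicator measurableSet_Ioo,
    lintegral_eq_affine hc d (hk.indicator measurableSet_Ioo)]
  congr 1
  refine lintegral_congr fun s => ?_
  have : c * s + d ∈ Ioo (c * a + d) (c * b + d) ↔ s ∈ Ioo a b := by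
    simp [hc]
  by_cases h : s ∈ Ioo a b
  · rw [indicator_of_mem (this.2 h), indicator_of_mem h]
  · rw [indicator_of_notMem (this.not.2 h), indicator_of_notMem h]

theorem setLIntegral_Ioo_split {a b c : ℝ} (hab : a ≤ b) (hbc : b ≤ c) (k : ℝ → ℝ≥0∞) :
    ∫⁻ u in Ioo a c, k u = (∫⁻ u in Ioo a b, k u) + ∫⁻ u in Ioo b c, k u := by
  rw [setLIntegral_congr Ioo_ae_eq_Ioc, setLIntegral_congr Ioo_ae_eq_Ioc,
    setLIntegral_congr (Ioo_ae_eq_Ioc (a := b)), ← lintegral_union measurableSet_Ioc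
      (Ioc_disjoint_Ioc_of_le le_rfl), Ioc_union_Ioc_eq_Ioc hab hbc]

/-- The parameters `l`, the mass of the outer fragment, and `x`, the relative position of the foot
in it, are independent under the chord law: `l` has density 2l and `x` is uniform. All later
conditioning on a chord uses these coordinates. -/
theorem lintegral_chordLaw {F : ℝ × ℝ → ℝ≥0∞} (hF : Measurable F) :
    ∫⁻ p, F p ∂chordLaw = ∫⁻ l in Ioo (0 : ℝ) 1, ENNReal.ofReal (2 * l) *
      ∫⁻ x in Ioo (0 : ℝ) 1, F (x * l, x * l + 1 - l) := by
  set T : Set (ℝ × ℝ) := {p | 0 ≤ p.1 ∧ p.1 ≤ p.2 ∧ p.2 ≤ 1} with hT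
  have hTm : MeasurableSet T := by
    refine (measurableSet_le measurable_const measurable_fst).inter
      ((measurableSet_le measurable_fst measurable_snd).inter
      (measurableSet_le measurable_snd measurable_const))
  set k : ℝ × ℝ → ℝ≥0∞ := T.indicator fun p => 2 * F p with hk
  have hkm : Measurable k := (hF.const_mul 2).indicator hTm
  have e1 : ∫⁻ p, F p ∂chordLaw = ∫⁻ p, k p := by
    rw [chordLaw, lintegral_withDensity_eq_lintegral_mul _ (measurable_const.indicator hTm) hF]
    refine lintegral_congr fun p => ?_
    simp only [Pi.mul_apply, hk, indicator]
    split_ifs <;> simp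
  rw [e1, Measure.volume_eq_prod, lintegral_prod _ hkm.aemeasurable]
  -- First substitution, v = u + 1 - l at fixed u. The second one, u = l x at fixed l, produces the
  -- Jacobian l.
  have e2 : ∀ u : ℝ, ∫⁻ v, k (u, v) = ∫⁻ l, k (u, u + 1 - l) := fun u =>
    (lintegral_sub_left_eq_self (fun v => k (u, v)) (u + 1)).symm
  simp_rw [e2]
  rw [lintegral_lintegral_swap (by
    apply Measurable.aemeasurable
    exact hkm.comp (by fun_prop))]
  rw [← lintegral_indicator measurableSet_Ioo]
  have hae : ∀ᵐ l : ℝ, l ≠ 0 ∧ l ≠ 1 := by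
    filter_upwards [compl_mem_ae_iff.2 (measure_singleton (0 : ℝ)),
      compl_mem_ae_iff.2 (measure_singleton (1 : ℝ))] with l h0 h1 using ⟨h0, h1⟩
  refine lintegral_congr_ae ?_
  filter_upwards [hae] with l ⟨hl0, hl1⟩
  by_cases hl : l ∈ Ioo (0 : ℝ) 1
  · rw [indicator_of_mem hl, lintegral_eq_affine hl.1 0 (k := fun u => k (u, u + 1 - l))
      (hkm.comp (by fun_prop)), mul_comm (2 : ℝ), ENNReal.ofReal_mul hl.1.le, mul_assoc]
    congr 1
    rw [← lintegral_const_mul (f := fun x => F (x * l, x * l + 1 - l)) _ (hF.comp (by fun_prop)),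
      setLIntegral_congr Ioo_ae_eq_Icc,
      ← lintegral_indicator measurableSet_Icc]
    refine lintegral_congr fun x => ?_
    have : (l * x + 0, l * x + 0 + 1 - l) ∈ T ↔ x ∈ Icc (0 : ℝ) 1 := by
      simp only [hT, mem_ofPred_eq, mem_Icc]
      constructor
      · rintro ⟨h1, h2, h3⟩
        constructor <;> nlinarith [hl.1]
      · rintro ⟨h1, h2⟩
        refine ⟨?_, ?_, ?_⟩ <;> nlinarith [hl.1, hl.2]
    by_cases hx : x ∈ Icc (0 : ℝ) 1
    · simp only [hk, indicator_of_mem (this.2 hx), indicator_of_mem hx]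
      simp [mul_comm]
    · simp only [hk, indicator_of_notMem (this.not.2 hx), indicator_of_notMem hx]
  · rw [indicator_of_notMem hl]
    refine (lintegral_congr fun u => indicator_of_notMem ?_ _).trans lintegral_zero
    rintro ⟨h1, h2, h3⟩
    simp only at h1 h2 h3
    apply hl
    constructor
    · exact lt_of_le_of_ne (by linarith) hl0.symm
    · exact lt_of_le_of_ne (by linarith) hl1

theorem setLIntegral_Ioo_ofReal_rpow {a : ℝ} (ha : -1 < a) {b : ℝ} (hb : 0 ≤ b) :
    ∫⁻ l in Ioo (0 : ℝ) b, ENNReal.ofReal (l ^ a) = ENNReal.ofReal (b ^ (a + 1) / (a + 1)) := by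
  have hi : IntervalIntegrable (fun l : ℝ => l ^ a) volume 0 b :=
    intervalIntegral.intervalIntegrable_rpow' ha
  rw [setLIntegral_congr Ioo_ae_eq_Ioc, ← ofReal_integral_eq_lintegral_ofReal
    ((intervalIntegrable_iff_integrableOn_Ioc_of_le hb).1 hi)
    ((ae_restrict_mem measurableSet_Ioc).mono fun l hl => Real.rpow_nonneg hl.1.le _),
    ← intervalIntegral.integral_of_le hb, integral_rpow (Or.inl ha),
    Real.zero_rpow (by linarith), sub_zero]

theorem lintegral_two_mul_Ioo : ∫⁻ l in Ioo (0 : ℝ) 1, ENNReal.ofReal (2 * l) = 1 := by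
  have := setLIntegral_Ioo_ofReal_rpow (a := 1) (by norm_num) (zero_le_one' ℝ)
  simp only [Real.rpow_one, Real.one_rpow] at this
  simp only [ENNReal.ofReal_mul (zero_le_two (α := ℝ))]
  rw [lintegral_const_mul _ (by fun_prop), this, ← ENNReal.ofReal_mul (by norm_num)]
  norm_num

instance isProbabilityMeasure_chordLaw : IsProbabilityMeasure chordLaw := by
  refine ⟨?_⟩
  have := lintegral_chordLaw (F := fun _ => 1) measurable_const
  rwa [lintegral_one, lintegral_one, Measure.restrict_apply_univ, Real.volume_Ioo, sub_zero,
    ENNReal.ofReal_one, lintegral_mul_const _ (by fun_prop), lintegral_two_mul_Ioo, one_mul] at this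

/-- The set of non-degenerate chords. -/
def chords : Set (ℝ × ℝ) := {p | 0 < p.1 ∧ p.1 < p.2 ∧ p.2 < 1}

theorem measurableSet_chords : MeasurableSet chords :=
  (measurableSet_lt measurable_const measurable_fst).inter
    ((measurableSet_lt measurable_fst measurable_snd).inter
    (measurableSet_lt measurable_snd measurable_const))

theorem chord_mem {l x : ℝ} (hl : l ∈ Ioo (0 : ℝ) 1) (hx : x ∈ Ioo (0 : ℝ) 1) :
    (x * l, x * l + 1 - l) ∈ chords := by
  obtain ⟨h1, h2⟩ := hl
  obtain ⟨h3, h4⟩ := hx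
  refine ⟨by positivity, ?_, ?_⟩ <;> simp only <;> nlinarith

theorem ae_mem_chords : ∀ᵐ p ∂chordLaw, p ∈ chords := by
  have h := lintegral_chordLaw (F := chordsᶜ.indicator 1)
    (measurable_one.indicator measurableSet_chords.compl)
  rw [lintegral_indicator_one measurableSet_chords.compl] at h
  rw [ae_iff]
  refine h.trans ?_
  refine (setLIntegral_congr_fun measurableSet_Ioo (g := fun _ => 0) fun l hl => ?_).trans
    lintegral_zero
  simp only
  rw [setLIntegral_congr_fun measurableSet_Ioo (g := fun _ => 0) fun x hx =>
    indicator_of_notMem (notMem_compl_iff.2 (chord_mem hl hx)) _]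
  simp

/-- The two families of affine maps that describe the inverse of a gluing: a uniform point of the
unit interval is either a uniform point of the outer fragment or one of the inner fragment. -/
noncomputable def outer (l x s : ℝ) : ℝ := if s < x then l * s else l * s + (1 - l)

/-- The parametrization of the inner fragment. -/
noncomputable def inner (l x s : ℝ) : ℝ := x * l + (1 - l) * s

theorem measurable_outer : Measurable fun q : ℝ × ℝ × ℝ => outer q.1 q.2.1 q.2.2 := by
  unfold outer
  exact Measurable.ite (measurableSet_lt (by fun_prop) (by fun_prop)) (by fun_prop) (by fun_prop)

theorem measurable_inner : Measurable fun q : ℝ × ℝ × ℝ => inner q.1 q.2.1 q.2.2 := by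
  unfold inner
  fun_prop

/-- The outer fragment consists of the two sides of the chord pushed together. So a uniform point is
uniform in the outer fragment with probability `l`, and uniform in the inner one otherwise. -/
theorem lintegral_split {l x : ℝ} (hl : l ∈ Ioo (0 : ℝ) 1) (hx : x ∈ Ioo (0 : ℝ) 1)
    {k : ℝ → ℝ≥0∞} (hk : Measurable k) :
    ∫⁻ s in Ioo (0 : ℝ) 1, k s = ENNReal.ofReal l * (∫⁻ s in Ioo (0 : ℝ) 1, k (outer l x s)) +
      ENNReal.ofReal (1 - l) * ∫⁻ s in Ioo (0 : ℝ) 1, k (inner l x s) := by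
  obtain ⟨h1, h2, h3⟩ := chord_mem hl hx
  simp only at h1 h2 h3
  rw [setLIntegral_Ioo_split h1.le (h2.trans h3).le, setLIntegral_Ioo_split h2.le h3.le,
    setLIntegral_Ioo_split hx.1.le hx.2.le, mul_add]
  have e1 := setLIntegral_Ioo_eq_affine hl.1 0 0 x hk
  have e2 := setLIntegral_Ioo_eq_affine hl.1 (1 - l) x 1 hk
  have e3 := setLIntegral_Ioo_eq_affine (sub_pos.2 hl.2) (x * l) 0 1 hk
  have e5 : ∫⁻ s in Ioo (0 : ℝ) x, k (outer l x s) = ∫⁻ s in Ioo (0 : ℝ) x, k (l * s + 0) :=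
    setLIntegral_congr_fun measurableSet_Ioo
      (fun s hs => by simp only [outer, if_pos hs.2, add_zero])
  have e6 : ∫⁻ s in Ioo x 1, k (outer l x s) = ∫⁻ s in Ioo x 1, k (l * s + (1 - l)) :=
    setLIntegral_congr_fun measurableSet_Ioo
      (fun s hs => by simp only [outer, if_neg hs.1.not_gt])
  rw [e5, e6, ← e1, ← e2]
  have e4 : ∫⁻ s in Ioo (0 : ℝ) 1, k (inner l x s) =
      ∫⁻ s in Ioo (0 : ℝ) 1, k ((1 - l) * s + x * l) := by
    simp only [inner, add_comm]
  rw [e4, ← e3]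
  have a1 : l * 0 + 0 = (0 : ℝ) := by ring
  have a2 : l * x + 0 = x * l := by ring
  have a3 : (1 - l) * 0 + x * l = x * l := by ring
  have a4 : (1 - l) * 1 + x * l = x * l + 1 - l := by ring
  have a5 : l * x + (1 - l) = x * l + 1 - l := by ring
  have a6 : l * 1 + (1 - l) = 1 := by ring
  rw [a1, a2, a3, a4, a5, a6]
  ring

/-! ## The law of the family of chords -/

/-- Families of chords indexed by words. -/
abbrev Chords : Type := List Bool → ℝ × ℝ

/-- The law of an independent family of chords. -/
noncomputable def treeLaw : Measure Chords := Measure.infinitePi fun _ => chordLaw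

instance : IsProbabilityMeasure treeLaw := by
  unfold treeLaw
  infer_instance

/-- The family with root chord `p` and with subfamilies `w₀` and `w₁` below the root. -/
def join (p : ℝ × ℝ) (w₀ w₁ : Chords) : Chords
  | [] => p
  | false :: y => w₀ y
  | true :: y => w₁ y

theorem measurable_join : Measurable fun q : (ℝ × ℝ) × Chords × Chords => join q.1 q.2.1 q.2.2 := by
  refine measurable_pi_iff.2 fun x => ?_
  rcases x with _ | ⟨_ | _, y⟩ <;> simp only [join] <;> fun_prop

/-- A word is empty, or begins with one of two letters, so a product over words factors into the
root and two copies of itself. The infinite product is determined by finite cylinders, on which this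
is checked. -/
theorem map_join : (chordLaw.prod (treeLaw.prod treeLaw)).map
    (fun q => join q.1 q.2.1 q.2.2) = treeLaw := by
  classical
  refine Measure.eq_infinitePi (fun _ : List Bool => chordLaw) fun s t ht => ?_
  -- Trivial constraints outside `s` have mass one. They allow `s` to be enlarged to the root
  -- together with both one-letter extensions of the same set of tails `A`.
  let t' : List Bool → Set (ℝ × ℝ) := fun i => if i ∈ s then t i else univ
  have ht' : ∀ i, MeasurableSet (t' i) := fun i => by
    by_cases h : i ∈ s <;> simp [t', h, ht i]
  let A : Finset (List Bool) := s.image List.tail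
  let cf : List Bool ↪ List Bool := ⟨List.cons false, List.cons_injective⟩
  let ct : List Bool ↪ List Bool := ⟨List.cons true, List.cons_injective⟩
  have hdisj : Disjoint (A.map cf) (A.map ct) := by
    refine Finset.disjoint_left.2 fun x hx hx' => ?_
    obtain ⟨y, -, rfl⟩ := Finset.mem_map.1 hx
    obtain ⟨z, -, hz⟩ := Finset.mem_map.1 hx'
    simp [cf, ct] at hz
  have hnil : ([] : List Bool) ∉ (A.map cf).disjUnion (A.map ct) hdisj := by
    simp [cf, ct]
  have hsub : s ⊆ Finset.cons [] ((A.map cf).disjUnion (A.map ct) hdisj) hnil := by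
    intro x hx
    rcases x with _ | ⟨_ | _, y⟩
    · simp
    · simp only [Finset.mem_cons, Finset.mem_disjUnion, Finset.mem_map]
      exact Or.inr (Or.inl ⟨y, Finset.mem_image.2 ⟨_, hx, rfl⟩, rfl⟩)
    · simp only [Finset.mem_cons, Finset.mem_disjUnion, Finset.mem_map]
      exact Or.inr (Or.inr ⟨y, Finset.mem_image.2 ⟨_, hx, rfl⟩, rfl⟩)
  have e1 : ∏ i ∈ s, chordLaw (t i) = chordLaw (t' []) *
      ((∏ i ∈ A, chordLaw (t' (false :: i))) * ∏ i ∈ A, chordLaw (t' (true :: i))) := by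
    rw [Finset.prod_congr rfl (g := fun i => chordLaw (t' i)) fun i hi => by simp [t', hi],
      Finset.prod_subset hsub fun i _ hi => by simp [t', hi], Finset.prod_cons,
      Finset.prod_disjUnion, Finset.prod_map, Finset.prod_map]
    rfl
  have e2 : (fun q : (ℝ × ℝ) × Chords × Chords => join q.1 q.2.1 q.2.2) ⁻¹' (Set.pi s t) =
      t' [] ×ˢ ((Set.pi A fun i => t' (false :: i)) ×ˢ (Set.pi A fun i => t' (true :: i))) := by
    ext ⟨p, w0, w1⟩
    simp only [mem_preimage, Set.mem_pi, Finset.mem_coe, mem_prod]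
    constructor
    · intro h
      have h' : ∀ i, join p w0 w1 i ∈ t' i := fun i => by
        by_cases hi : i ∈ s
        · simpa [t', hi] using h i hi
        · simp [t', hi]
      exact ⟨h' [], fun i _ => h' (false :: i), fun i _ => h' (true :: i)⟩
    · rintro ⟨h1, h2, h3⟩ i hi
      have : join p w0 w1 i ∈ t' i := by
        rcases i with _ | ⟨_ | _, y⟩
        · exact h1
        · exact h2 y (Finset.mem_image.2 ⟨_, hi, rfl⟩)
        · exact h3 y (Finset.mem_image.2 ⟨_, hi, rfl⟩)
      simpa [t', hi] using this
  rw [Measure.map_apply measurable_join (MeasurableSet.pi s.countable_toSet fun i _ => ht i), e2,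
    Measure.prod_prod, Measure.prod_prod, e1, treeLaw,
    Measure.infinitePi_pi (fun _ : List Bool => chordLaw) (s := A) (t := fun i => t' (false :: i))
      (fun i _ => ht' _),
    Measure.infinitePi_pi (fun _ : List Bool => chordLaw) (s := A) (t := fun i => t' (true :: i))
      (fun i _ => ht' _)]

theorem lintegral_treeLaw {F : Chords → ℝ≥0∞} (hF : Measurable F) :
    ∫⁻ w, F w ∂treeLaw =
      ∫⁻ p, ∫⁻ w₀, ∫⁻ w₁, F (join p w₀ w₁) ∂treeLaw ∂treeLaw ∂chordLaw := by
  have hm : Measurable fun q : (ℝ × ℝ) × Chords × Chords => F (join q.1 q.2.1 q.2.2) :=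
    hF.comp measurable_join
  conv_lhs => rw [← map_join, lintegral_map hF measurable_join, lintegral_prod _ hm.aemeasurable]
  refine lintegral_congr fun p => lintegral_prod _ (Measurable.aemeasurable ?_)
  exact hm.comp (by fun_prop)

theorem ae_treeLaw_forall_mem_chords : ∀ᵐ w ∂treeLaw, ∀ x, w x ∈ chords := by
  rw [ae_all_iff]
  intro x
  have h := measurePreserving_eval_infinitePi (fun _ : List Bool => chordLaw) x
  exact h.quasiMeasurePreserving.ae ae_mem_chords

/-! ## The function `h` is a fixed point of the mean gluing -/

/-- Equivalently (β + 1)(β + 2) = 4, the form needed in `intervalIntegral_identity`. -/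
theorem beta_sq : beta ^ 2 + 3 * beta = 2 := by
  have h : Real.sqrt 17 ^ 2 = 17 := Real.sq_sqrt (by norm_num)
  unfold beta
  nlinarith

/-- This is exactly the condition under which the second moments contract: 2 / (2β + 1) < 1. -/
theorem half_lt_beta : 1 / 2 < beta := by
  have h : (4 : ℝ) < Real.sqrt 17 := Real.lt_sqrt_of_sq_lt (by norm_num)
  unfold beta
  linarith

theorem beta_pos : 0 < beta := by linarith [half_lt_beta]

theorem hfun_nonneg {s : ℝ} (h0 : 0 ≤ s) (h1 : s ≤ 1) : 0 ≤ hfun s :=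
  Real.rpow_nonneg (mul_nonneg h0 (by linarith)) _

theorem hfun_symm (s : ℝ) : hfun (1 - s) = hfun s := by
  unfold hfun
  ring_nf

theorem hfun_zero : hfun 0 = 0 := by simp [hfun, beta_pos.ne']

theorem hfun_one : hfun 1 = 0 := by simp [hfun, beta_pos.ne']

theorem continuous_hfun : Continuous hfun := by
  unfold hfun
  exact Continuous.rpow_const (by fun_prop) fun _ => Or.inr beta_pos.le

theorem hfun_le_one {s : ℝ} (h0 : 0 ≤ s) (h1 : s ≤ 1) : hfun s ≤ 1 :=
  Real.rpow_le_one (mul_nonneg h0 (by linarith)) (by nlinarith) beta_pos.le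

theorem measurable_glue {α : Type*} [MeasurableSpace α] {p : α → ℝ × ℝ} {f₀ f₁ : α → ℝ → ℝ}
    {s : α → ℝ} (hp : Measurable p) (h₀ : Measurable (Function.uncurry f₀))
    (h₁ : Measurable (Function.uncurry f₁)) (hs : Measurable s) :
    Measurable fun a => glue (p a) (f₀ a) (f₁ a) (s a) := by
  have k₀ : ∀ {t : α → ℝ}, Measurable t → Measurable fun a => f₀ a (t a) := fun ht =>
    h₀.comp (measurable_id.prodMk ht)
  have k₁ : ∀ {t : α → ℝ}, Measurable t → Measurable fun a => f₁ a (t a) := fun ht =>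
    h₁.comp (measurable_id.prodMk ht)
  unfold glue
  refine Measurable.ite (measurableSet_lt hs hp.fst) ?_
    (Measurable.ite (measurableSet_lt hs hp.snd) ?_ ?_)
  · exact Measurable.mul (by fun_prop) (k₀ (by fun_prop))
  · exact (Measurable.mul (by fun_prop) (k₀ (by fun_prop))).add
      (Measurable.mul (by fun_prop) (k₁ (by fun_prop)))
  · exact Measurable.mul (by fun_prop) (k₀ (by fun_prop))

/-- The substitution y = s / l brings both integrals to the same variable. Since 4 / (β + 2) = β +
1, the total integrand is s^β times the derivative in l of l² (1 - s/l)^(β+1), a function that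
vanishes at l = s. -/
theorem intervalIntegral_identity {s : ℝ} (hs : s ∈ Ioo (0 : ℝ) 1) :
    (∫ l in s..1, 2 * s ^ beta * (l * (1 - s / l) ^ (beta + 1))) +
      (∫ y in s..1, 4 / (beta + 2) * s ^ (beta + 2) * (y⁻¹ ^ 2 * (1 - y) ^ beta)) =
      (1 - s) * hfun s := by
  obtain ⟨h0, h1⟩ := hs
  have hb := beta_pos
  have hu : uIcc s 1 = Icc s 1 := uIcc_of_le h1.le
  have hpos : ∀ l ∈ uIcc s 1, 0 < l := fun l hl => h0.trans_le (hu ▸ hl).1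
  have hc : ∀ a : ℝ, 0 ≤ a → ContinuousOn (fun l => (1 - s / l) ^ a) (uIcc s 1) := by
    intro a ha
    refine ContinuousOn.rpow_const ?_ fun _ _ => Or.inr ha
    exact continuousOn_const.sub (continuousOn_const.div continuousOn_id fun l hl => (hpos l hl).ne')
  have e1 : ∫ y in s..1, (y⁻¹ ^ 2 * (1 - y) ^ beta) = ∫ l in s..1, s⁻¹ * (1 - s / l) ^ beta := by
    have := intervalIntegral.integral_comp_mul_deriv' (a := s) (b := 1) (f := fun l => s / l)
      (f' := fun l => -s / l ^ 2) (g := fun y => y⁻¹ ^ 2 * (1 - y) ^ beta) (fun l hl => ?_) ?_ ?_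
    · simp only [div_self h0.ne', div_one] at this
      rw [intervalIntegral.integral_symm, ← this, ← intervalIntegral.integral_neg]
      refine intervalIntegral.integral_congr fun l hl => ?_
      have := hpos l hl
      simp only [Function.comp]
      field_simp
    · have := hpos l hl
      simpa [div_eq_mul_inv, neg_mul] using (hasDerivAt_inv this.ne').const_mul s
    · exact continuousOn_const.div (by fun_prop) fun l hl => pow_ne_zero _ (hpos l hl).ne'
    · refine ContinuousOn.mul (ContinuousOn.pow (continuousOn_inv₀.mono ?_) 2) ?_
      · rintro _ ⟨l, hl, rfl⟩
        exact (div_pos h0 (hpos l hl)).ne'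
      · exact (Continuous.rpow_const (by fun_prop) fun _ => Or.inr hb.le).continuousOn
  have e2 : ∫ l in s..1, (2 * (l * (1 - s / l) ^ (beta + 1)) + (beta + 1) * s * (1 - s / l) ^ beta)
      = (1 - s) ^ (beta + 1) := by
    rw [intervalIntegral.integral_eq_sub_of_hasDerivAt
      (f := fun l => l ^ 2 * (1 - s / l) ^ (beta + 1))]
    · simp [div_self h0.ne', Real.zero_rpow (by linarith : beta + 1 ≠ 0)]
    · intro l hl
      have hl0 := hpos l hl
      have d1 : HasDerivAt (fun l => 1 - s / l) (s / l ^ 2) l := by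
        simpa [div_eq_mul_inv, neg_mul] using ((hasDerivAt_inv hl0.ne').const_mul s).const_sub 1
      have d2 := (hasDerivAt_pow 2 l).mul (d1.rpow_const (p := beta + 1) (Or.inr (by linarith)))
      refine d2.congr_deriv ?_
      have : beta + 1 - 1 = beta := by ring
      rw [this]
      field_simp
      simp
      ring
    · refine ContinuousOn.intervalIntegrable ?_
      exact (continuousOn_const.mul (continuousOn_id.mul (hc _ (by linarith)))).add
        (continuousOn_const.mul (hc _ hb.le))
  rw [intervalIntegral.integral_add] at e2
  rotate_left
  · exact (continuousOn_const.mul (continuousOn_id.mul (hc _ (by linarith)))).intervalIntegrable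
  · exact (continuousOn_const.mul (hc _ hb.le)).intervalIntegrable
  rw [intervalIntegral.integral_const_mul] at e2 ⊢
  rw [intervalIntegral.integral_const_mul] at e2 ⊢
  rw [e1, intervalIntegral.integral_const_mul]
  have e3 : 4 / (beta + 2) = beta + 1 := by
    rw [div_eq_iff (by linarith)]
    linarith [beta_sq]
  have e4 : (1 - s) * hfun s = s ^ beta * (1 - s) ^ (beta + 1) := by
    rw [hfun, Real.mul_rpow h0.le (by linarith), Real.rpow_add_one (by linarith)]
    ring
  have e5 : s ^ (beta + 2) = s ^ beta * s ^ 2 := by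
    rw [Real.rpow_add h0]
    norm_num
  rw [e3, e4, ← e2, e5]
  field_simp

theorem setLIntegral_Ioo_eq_ofReal {a b : ℝ} (hab : a ≤ b) {g : ℝ → ℝ}
    (hg : IntervalIntegrable g volume a b) (hnn : ∀ x ∈ Ioo a b, 0 ≤ g x) :
    ∫⁻ x in Ioo a b, ENNReal.ofReal (g x) = ENNReal.ofReal (∫ x in a..b, g x) := by
  rw [intervalIntegral.integral_of_le hab, ← integral_Ioc_eq_integral_Ioo.symm,
    ofReal_integral_eq_lintegral_ofReal
      (((intervalIntegrable_iff_integrableOn_Ioc_of_le hab).1 hg).mono_set Ioo_subset_Ioc_self)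
      ((ae_restrict_mem measurableSet_Ioo).mono hnn)]

theorem lintegral_reflect {k : ℝ → ℝ≥0∞} (a b : ℝ) :
    ∫⁻ x in Ioo a b, k x = ∫⁻ x in Ioo (1 - b) (1 - a), k (1 - x) := by
  rw [← lintegral_indicator measurableSet_Ioo, ← lintegral_indicator measurableSet_Ioo,
    ← lintegral_sub_left_eq_self _ 1]
  refine lintegral_congr fun x => ?_
  simp only [indicator]
  congr 1
  simp only [mem_Ioo, eq_iff_iff]
  constructor <;> rintro ⟨h1, h2⟩ <;> constructor <;> linarith

/-- The contribution of the outer fragment left of the chord. -/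
noncomputable def leftPart (s : ℝ) : ℝ≥0∞ := ∫⁻ l in Ioo (0 : ℝ) 1, ENNReal.ofReal (2 * l) *
  (ENNReal.ofReal (1 - s / l) * ENNReal.ofReal (l ^ beta * hfun (s / l)))

/-- The contribution of one of the two fragments to points separated from the root. -/
noncomputable def innerPart (s : ℝ) : ℝ≥0∞ := ∫⁻ l in Ioo (0 : ℝ) 1, ENNReal.ofReal (2 * l) *
  ∫⁻ x in Ioo (0 : ℝ) 1, {x | x * l < s ∧ (1 - x) * l < 1 - s}.indicator
    (fun x => ENNReal.ofReal (l ^ beta * hfun x)) x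

/-- The part of `innerPart s` that comes from feet on one side of `s`, once the mass of the fragment
has been integrated out. -/
noncomputable def innerHalf (s : ℝ) : ℝ≥0∞ :=
  ∫⁻ y in Ioo s 1, ENNReal.ofReal (2 / (beta + 2) * s ^ (beta + 2) * (y⁻¹ ^ 2 * (1 - y) ^ beta))

/-- The four contributions to the averaged gluing are regrouped into this sum and its mirror image
under s ↦ 1 - s. The factors 1 - s and s then add up to one. -/
theorem leftPart_add_innerHalf {s : ℝ} (hs : s ∈ Ioo (0 : ℝ) 1) :
    leftPart s + (innerHalf s + innerHalf s) = ENNReal.ofReal ((1 - s) * hfun s) := by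
  obtain ⟨h0, h1⟩ := hs
  have hb := beta_pos
  have hu : uIcc s 1 = Icc s 1 := uIcc_of_le h1.le
  have hpos : ∀ l ∈ uIcc s 1, 0 < l := fun l hl => h0.trans_le (hu ▸ hl).1
  have e1 : leftPart s =
      ∫⁻ l in Ioo s 1, ENNReal.ofReal (2 * s ^ beta * (l * (1 - s / l) ^ (beta + 1))) := by
    rw [leftPart, setLIntegral_Ioo_split h0.le h1.le,
      setLIntegral_congr_fun measurableSet_Ioo (g := fun _ => 0) (fun l hl => ?_), lintegral_zero,
      zero_add]
    · refine setLIntegral_congr_fun measurableSet_Ioo fun l hl => ?_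
      have hl0 : 0 < l := h0.trans hl.1
      have hsl : 0 < 1 - s / l := by
        rw [sub_pos, div_lt_one hl0]
        exact hl.1
      rw [← ENNReal.ofReal_mul hsl.le, ← ENNReal.ofReal_mul (by linarith)]
      congr 1
      rw [hfun, Real.mul_rpow (div_pos h0 hl0).le hsl.le, Real.div_rpow h0.le hl0.le,
        Real.rpow_add_one hsl.ne']
      have : l ^ beta ≠ 0 := (Real.rpow_pos_of_pos hl0 _).ne'
      field_simp
    · simp only
      rw [ENNReal.ofReal_of_nonpos (p := 1 - s / l), zero_mul, mul_zero]
      rw [sub_nonpos, one_le_div hl.1]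
      exact hl.2.le
  have i1 : IntervalIntegrable (fun l => 2 * s ^ beta * (l * (1 - s / l) ^ (beta + 1))) volume s 1 := by
    refine ContinuousOn.intervalIntegrable (continuousOn_const.mul (continuousOn_id.mul ?_))
    refine ContinuousOn.rpow_const ?_ fun _ _ => Or.inr (by linarith)
    exact continuousOn_const.sub (continuousOn_const.div continuousOn_id fun l hl => (hpos l hl).ne')
  have i2 : ∀ c : ℝ, IntervalIntegrable
      (fun y => c * s ^ (beta + 2) * (y⁻¹ ^ 2 * (1 - y) ^ beta)) volume s 1 := by
    intro c
    refine ContinuousOn.intervalIntegrable (continuousOn_const.mul (ContinuousOn.mul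
      (ContinuousOn.pow (continuousOn_inv₀.mono fun l hl => (hpos l hl).ne') 2) ?_))
    exact (Continuous.rpow_const (by fun_prop) fun _ => Or.inr hb.le).continuousOn
  have n1 : ∀ l ∈ Ioo s 1, 0 ≤ 2 * s ^ beta * (l * (1 - s / l) ^ (beta + 1)) := by
    intro l hl
    have hl0 : 0 < l := h0.trans hl.1
    have hsl : 0 < 1 - s / l := by
      rw [sub_pos, div_lt_one hl0]
      exact hl.1
    positivity
  have n2 : ∀ c : ℝ, 0 ≤ c → ∀ y ∈ Ioo s 1,
      0 ≤ c * s ^ (beta + 2) * (y⁻¹ ^ 2 * (1 - y) ^ beta) := by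
    intro c hc y hy
    have : 0 < 1 - y := by linarith [hy.2]
    positivity
  have e2 : innerHalf s + innerHalf s = ∫⁻ y in Ioo s 1,
      ENNReal.ofReal (4 / (beta + 2) * s ^ (beta + 2) * (y⁻¹ ^ 2 * (1 - y) ^ beta)) := by
    rw [innerHalf, ← lintegral_add_left (by fun_prop)]
    refine setLIntegral_congr_fun measurableSet_Ioo fun y hy => ?_
    have := n2 (2 / (beta + 2)) (by positivity) y hy
    rw [← ENNReal.ofReal_add this this]
    congr 1
    ring
  rw [e1, e2, setLIntegral_Ioo_eq_ofReal h1.le i1 n1,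
    setLIntegral_Ioo_eq_ofReal h1.le (i2 _) (n2 _ (by positivity)), ← ENNReal.ofReal_add,
    intervalIntegral_identity ⟨h0, h1⟩]
  · exact intervalIntegral.integral_nonneg_of_ae_restrict h1.le (by
      rw [← restrict_Ioo_eq_restrict_Icc]
      exact (ae_restrict_mem measurableSet_Ioo).mono n1)
  · exact intervalIntegral.integral_nonneg_of_ae_restrict h1.le (by
      rw [← restrict_Ioo_eq_restrict_Icc]
      exact (ae_restrict_mem measurableSet_Ioo).mono (n2 _ (by positivity)))

/-- For a fixed foot `x`, the two constraints say that `l` is below the smaller of s/x and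
(1-s)/(1-x). The first is the smaller if x > s and the second if x < s; reflection exchanges the two
cases. -/
theorem innerPart_eq {s : ℝ} (hs : s ∈ Ioo (0 : ℝ) 1) :
    innerPart s = innerHalf s + innerHalf (1 - s) := by
  have hb := beta_pos
  have hm : Measurable fun q : ℝ × ℝ => {q : ℝ × ℝ | q.2 * q.1 < s ∧ (1 - q.2) * q.1 < 1 - s}.indicator
      (fun q => ENNReal.ofReal (2 * q.1) * ENNReal.ofReal (q.1 ^ beta * hfun q.2)) q := by
    refine Measurable.indicator ?_ ?_
    · have := continuous_hfun.measurable
      fun_prop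
    · exact (measurableSet_lt (f := fun q : ℝ × ℝ => q.2 * q.1) (by fun_prop) measurable_const).inter
        (measurableSet_lt (f := fun q : ℝ × ℝ => (1 - q.2) * q.1) (by fun_prop) measurable_const)
  have e1 : innerPart s = ∫⁻ x in Ioo (0 : ℝ) 1, ∫⁻ l in Ioo (0 : ℝ) 1,
      {q : ℝ × ℝ | q.2 * q.1 < s ∧ (1 - q.2) * q.1 < 1 - s}.indicator
      (fun q => ENNReal.ofReal (2 * q.1) * ENNReal.ofReal (q.1 ^ beta * hfun q.2)) (l, x) := by
    rw [← lintegral_lintegral_swap (f := fun l x => {q : ℝ × ℝ | q.2 * q.1 < s ∧ (1 - q.2) * q.1 < 1 - s}.indicator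
      (fun q => ENNReal.ofReal (2 * q.1) * ENNReal.ofReal (q.1 ^ beta * hfun q.2)) (l, x)) hm.aemeasurable, innerPart]
    refine lintegral_congr fun l => ?_
    rw [← lintegral_const_mul' _ _ ENNReal.ofReal_ne_top]
    refine lintegral_congr fun x => ?_
    simp only [indicator, mem_ofPred_eq]
    split_ifs <;> simp
  -- With `m` the effective upper bound for `l`, this is the integral of 2 l^(β+1) over (0, m).
  have key : ∀ (x m : ℝ), 0 ≤ hfun x → 0 < m → m ≤ 1 →
      (∀ l ∈ Ioo (0 : ℝ) 1, (x * l < s ∧ (1 - x) * l < 1 - s) ↔ l < m) →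
      ∫⁻ l in Ioo (0 : ℝ) 1, {q : ℝ × ℝ | q.2 * q.1 < s ∧ (1 - q.2) * q.1 < 1 - s}.indicator
      (fun q => ENNReal.ofReal (2 * q.1) * ENNReal.ofReal (q.1 ^ beta * hfun q.2)) (l, x) =
      ENNReal.ofReal (2 / (beta + 2) * hfun x * m ^ (beta + 2)) := by
    intro x m hx hm0 hm1 hiff
    rw [setLIntegral_Ioo_split hm0.le hm1,
      setLIntegral_congr_fun measurableSet_Ioo
        (g := fun l => ENNReal.ofReal (2 * hfun x) * ENNReal.ofReal (l ^ (beta + 1))) (fun l hl => ?_),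
      setLIntegral_congr_fun (measurableSet_Ioo (a := m)) (g := fun _ => 0) (fun l hl => ?_),
      lintegral_zero, add_zero, lintegral_const_mul _ (by fun_prop),
      setLIntegral_Ioo_ofReal_rpow (by linarith) hm0.le, ← ENNReal.ofReal_mul (by positivity)]
    · congr 1
      have : beta + 1 + 1 = beta + 2 := by ring
      rw [this]
      field_simp
    · refine indicator_of_notMem ?_ _
      exact fun h => ((hiff l ⟨hm0.trans hl.1, hl.2⟩).1 h).not_gt hl.1
    · have hmem : (l, x) ∈ {q : ℝ × ℝ | q.2 * q.1 < s ∧ (1 - q.2) * q.1 < 1 - s} :=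
        (hiff l ⟨hl.1, hl.2.trans_le hm1⟩).2 hl.2
      simp only
      rw [indicator_of_mem hmem, ← ENNReal.ofReal_mul (by linarith [hl.1]),
        ← ENNReal.ofReal_mul (by positivity)]
      congr 1
      rw [Real.rpow_add_one hl.1.ne']
      ring
  obtain ⟨h0, h1⟩ := hs
  have half : ∀ {t x : ℝ}, 0 < t → t < x → x < 1 →
      2 / (beta + 2) * hfun x * (t / x) ^ (beta + 2) =
      2 / (beta + 2) * t ^ (beta + 2) * (x⁻¹ ^ 2 * (1 - x) ^ beta) := by
    intro t x ht htx hx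
    have hx0 : 0 < x := ht.trans htx
    rw [hfun, Real.mul_rpow hx0.le (by linarith), Real.div_rpow ht.le hx0.le, Real.rpow_add hx0 beta 2]
    have : x ^ beta ≠ 0 := (Real.rpow_pos_of_pos hx0 _).ne'
    rw [Real.rpow_two]
    field_simp
  rw [e1, setLIntegral_Ioo_split h0.le h1.le, add_comm]
  congr 1
  · refine setLIntegral_congr_fun measurableSet_Ioo fun x hx => ?_
    have hx0 : 0 < x := h0.trans hx.1
    rw [key x (s / x) (hfun_nonneg hx0.le hx.2.le) (by positivity)
      ((div_le_one hx0).2 hx.1.le), half h0 hx.1 hx.2]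
    intro l hl
    rw [lt_div_iff₀ hx0, mul_comm l x]
    refine and_iff_left_of_imp fun _ => ?_
    have := hx.1; have := hx.2; have := hl.1; have := hl.2
    nlinarith
  · rw [innerHalf, lintegral_reflect, sub_zero]
    refine setLIntegral_congr_fun measurableSet_Ioo fun x hx => ?_
    have hx0 : 0 < x := by linarith [hx.1]
    rw [key (1 - x) ((1 - s) / x) (hfun_nonneg (by linarith [hx.2]) (by linarith))
      (div_pos (by linarith) hx0) ((div_le_one hx0).2 hx.1.le), hfun_symm,
      half (by linarith) hx.1 hx.2]
    intro l hl
    rw [lt_div_iff₀ hx0, mul_comm l x, sub_sub_cancel]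
    refine and_iff_right_of_imp fun _ => ?_
    have := hx.1; have := hx.2; have := hl.1; have := hl.2
    nlinarith

theorem glue_chord {l x : ℝ} (f₀ f₁ : ℝ → ℝ) (s : ℝ) : glue (x * l, x * l + 1 - l) f₀ f₁ s =
    if s < x * l then l ^ beta * f₀ (s / l)
    else if s < x * l + 1 - l then
      l ^ beta * f₀ (x * l / l) + (1 - l) ^ beta * f₁ ((s - x * l) / (1 - l))
    else l ^ beta * f₀ ((s - (1 - l)) / l) := by
  have e1 : x * l + 1 - l - x * l = 1 - l := by ring
  have e2 : 1 - (1 - l) = l := by ring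
  simp only [glue, e1, e2]

/-- The contribution of the inner fragment to points inside it. -/
theorem lintegral_inner_fragment {l s : ℝ} (hl : l ∈ Ioo (0 : ℝ) 1) (hs : s ∈ Ioo (0 : ℝ) 1) :
    ENNReal.ofReal (2 * l) * ∫⁻ x in Ioo (0 : ℝ) 1, {x | x * l < s ∧ s < x * l + 1 - l}.indicator
      (fun x => ENNReal.ofReal ((1 - l) ^ beta * hfun ((s - x * l) / (1 - l)))) x =
    ENNReal.ofReal (2 * (1 - l)) * ∫⁻ y in Ioo (0 : ℝ) 1,
      {y | y * (1 - l) < s ∧ (1 - y) * (1 - l) < 1 - s}.indicator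
      (fun y => ENNReal.ofReal ((1 - l) ^ beta * hfun y)) y := by
  obtain ⟨h0, h1⟩ := hl
  obtain ⟨hs0, hs1⟩ := hs
  have h2 : 0 < 1 - l := sub_pos.2 h1
  have hh := continuous_hfun.measurable
  -- The common integrand is written in u = x l, the left end of the chord. Scaling by `l` gives the
  -- left side. Writing s - u = (1 - l) y, with `y` the relative position of `s` in the inner
  -- fragment, gives the right side.
  set k : ℝ → ℝ≥0∞ := (Ioo 0 l ∩ {u | u < s ∧ s < u + 1 - l}).indicator
    (fun u => ENNReal.ofReal ((1 - l) ^ beta * hfun ((s - u) / (1 - l)))) with hk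
  have hkm : Measurable k := by
    refine Measurable.indicator (by fun_prop) (measurableSet_Ioo.inter ?_)
    exact (measurableSet_lt measurable_id measurable_const).inter
      (measurableSet_lt (g := fun u : ℝ => u + 1 - l) measurable_const (by fun_prop))
  rw [ENNReal.ofReal_mul zero_le_two, ENNReal.ofReal_mul zero_le_two, mul_assoc, mul_assoc]
  congr 1
  have e1 := lintegral_eq_affine h0 0 hkm
  have e2 := lintegral_eq_affine h2 0 (k := fun u => k (s - u)) (hkm.comp (by fun_prop))
  rw [lintegral_sub_left_eq_self k s, e1] at e2
  rw [← lintegral_indicator measurableSet_Ioo, ← lintegral_indicator measurableSet_Ioo]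
  convert e2 using 3
  · funext x
    simp only [hk, indicator, mem_inter_iff, mem_Ioo, mem_ofPred_eq, add_zero, mul_comm x l]
    by_cases hx : 0 < x ∧ x < 1
    · rw [if_pos hx]
      congr 1
      simp only [eq_iff_iff]
      refine (and_iff_right ⟨mul_pos h0 hx.1, ?_⟩).symm
      nlinarith
    · rw [if_neg hx, if_neg]
      rintro ⟨⟨a1, a2⟩, -⟩
      exact hx ⟨pos_of_mul_pos_right a1 h0.le, by nlinarith⟩
  · funext y
    simp only [hk, indicator, mem_inter_iff, mem_Ioo, mem_ofPred_eq, add_zero, sub_sub_cancel]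
    rw [mul_div_cancel_left₀ _ h2.ne']
    by_cases hy : 0 < y ∧ y < 1
    · rw [if_pos hy]
      congr 1
      simp only [eq_iff_iff]
      constructor
      · rintro ⟨a1, a2⟩
        refine ⟨⟨by nlinarith, by nlinarith⟩, by nlinarith, by nlinarith⟩
      · rintro ⟨⟨a1, a2⟩, a3, a4⟩
        constructor <;> nlinarith
    · rw [if_neg hy, if_neg]
      rintro ⟨-, a1, a2⟩
      exact hy ⟨by nlinarith, by nlinarith⟩

theorem lintegral_left_fragment {l s : ℝ} (hl : l ∈ Ioo (0 : ℝ) 1) (hs : 0 < s) (c : ℝ≥0∞) :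
    ∫⁻ x in Ioo (0 : ℝ) 1, {x | s < x * l}.indicator (fun _ => c) x =
      ENNReal.ofReal (1 - s / l) * c := by
  have hm : MeasurableSet {x : ℝ | s < x * l} := measurableSet_lt measurable_const (by fun_prop)
  rw [lintegral_indicator_const hm, mul_comm, Measure.restrict_apply hm]
  have : {x : ℝ | s < x * l} ∩ Ioo 0 1 = Ioo (s / l) 1 := by
    ext x
    simp only [mem_inter_iff, mem_ofPred_eq, mem_Ioo, div_lt_iff₀ hl.1]
    refine ⟨fun h => ⟨h.1, h.2.2⟩, fun h => ⟨h.1, ?_, h.2⟩⟩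
    exact pos_of_mul_pos_left (hs.trans h.1) hl.1.le
  rw [this, Real.volume_Ioo]

/-- A chord has `s` on its left, on its right, or inside. The first two cases are mirror images. In
the third, the value at the foot and the inner value have the same mean, by exchanging `l` and 1 -
l. The four terms are then summed by `leftPart_add_innerHalf`. -/
theorem lintegral_glue_hfun {s : ℝ} (hs : s ∈ Ioo (0 : ℝ) 1) :
    ∫⁻ p, ENNReal.ofReal (glue p hfun hfun s) ∂chordLaw = ENNReal.ofReal (hfun s) := by
  have hh := continuous_hfun.measurable
  have hs' : 1 - s ∈ Ioo (0 : ℝ) 1 := ⟨by linarith [hs.2], by linarith [hs.1]⟩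
  have hb := beta_pos
  have hg : Measurable fun p => ENNReal.ofReal (glue p hfun hfun s) :=
    (measurable_glue (f₀ := fun _ => hfun) (f₁ := fun _ => hfun) measurable_id
      (hh.comp measurable_snd) (hh.comp measurable_snd)
      measurable_const).ennreal_ofReal
  rw [lintegral_chordLaw hg]
  have key : ∀ l ∈ Ioo (0 : ℝ) 1, ENNReal.ofReal (2 * l) *
      ∫⁻ x in Ioo (0 : ℝ) 1, ENNReal.ofReal (glue (x * l, x * l + 1 - l) hfun hfun s) =
      ENNReal.ofReal (2 * l) * (ENNReal.ofReal (1 - s / l) * ENNReal.ofReal (l ^ beta * hfun (s / l))) +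
      (ENNReal.ofReal (2 * l) *
        (ENNReal.ofReal (1 - (1 - s) / l) * ENNReal.ofReal (l ^ beta * hfun ((1 - s) / l))) +
      (ENNReal.ofReal (2 * l) * (∫⁻ x in Ioo (0 : ℝ) 1, {x | x * l < s ∧ (1 - x) * l < 1 - s}.indicator
        (fun x => ENNReal.ofReal (l ^ beta * hfun x)) x) +
      ENNReal.ofReal (2 * (1 - l)) * ∫⁻ y in Ioo (0 : ℝ) 1,
        {y | y * (1 - l) < s ∧ (1 - y) * (1 - l) < 1 - s}.indicator
        (fun y => ENNReal.ofReal ((1 - l) ^ beta * hfun y)) y)) := by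
    intro l hl
    have hl0 := hl.1
    have hl1 : 0 < 1 - l := sub_pos.2 hl.2
    rw [← lintegral_inner_fragment hl hs, ← lintegral_left_fragment hl hs.1,
      ← lintegral_left_fragment hl hs'.1, lintegral_reflect (k := indicator {x | 1 - s < x * l} _),
      sub_self, sub_zero, ← mul_add, ← mul_add, ← mul_add]
    have m1 : MeasurableSet {x : ℝ | x * l < s ∧ (1 - x) * l < 1 - s} :=
      (measurableSet_lt (f := fun x : ℝ => x * l) (by fun_prop) measurable_const).inter
        (measurableSet_lt (f := fun x : ℝ => (1 - x) * l) (by fun_prop) measurable_const)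
    have m2 : MeasurableSet {x : ℝ | s < x * l} := measurableSet_lt measurable_const (by fun_prop)
    have m3 : MeasurableSet {x : ℝ | 1 - s < x * l} :=
      measurableSet_lt measurable_const (by fun_prop)
    have m4 : Measurable fun x : ℝ => {x | 1 - s < x * l}.indicator
        (fun _ => ENNReal.ofReal (l ^ beta * hfun ((1 - s) / l))) (1 - x) :=
      (measurable_const.indicator m3).comp (by fun_prop)
    rw [← lintegral_add_left (Measurable.indicator (by fun_prop) m1),
      ← lintegral_add_left m4, ← lintegral_add_left (measurable_const.indicator m2)]
    congr 1
    -- For these two feet `s` is an endpoint of the chord, where the strict and non-strict cases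
    -- disagree.
    have hae : ∀ᵐ x : ℝ, x ≠ s / l ∧ x ≠ (s - (1 - l)) / l := by
      filter_upwards [compl_mem_ae_iff.2 (measure_singleton (s / l)),
        compl_mem_ae_iff.2 (measure_singleton ((s - (1 - l)) / l))] with l h0 h1 using ⟨h0, h1⟩
    refine lintegral_congr_ae ?_
    filter_upwards [ae_restrict_of_ae hae, ae_restrict_mem measurableSet_Ioo] with x ⟨hx1, hx2⟩ hx
    rw [Ne, eq_div_iff hl0.ne'] at hx1 hx2
    rw [glue_chord, mul_div_cancel_right₀ _ hl0.ne']
    have e1 : hfun ((s - (1 - l)) / l) = hfun ((1 - s) / l) := by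
      rw [← hfun_symm]
      congr 1
      field_simp
      ring
    simp only [indicator, mem_ofPred_eq]
    rcases lt_or_gt_of_ne hx1 with h | h
    · have c1 : ¬ s < x * l := h.not_gt
      rw [if_neg c1, if_neg c1, zero_add]
      by_cases h' : s < x * l + 1 - l
      · rw [if_pos h', if_neg (by nlinarith), if_pos ⟨h, by nlinarith⟩, if_pos ⟨h, h'⟩, zero_add,
          ENNReal.ofReal_add]
        · have := hfun_nonneg hx.1.le hx.2.le
          positivity
        · have := hfun_nonneg (s := (s - x * l) / (1 - l)) (div_nonneg (by linarith) hl1.le)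
            ((div_le_one hl1).2 (by linarith))
          positivity
      · have h'' : x * l + 1 - l < s := lt_of_le_of_ne (by linarith) fun h3 => hx2 (by linarith)
        rw [if_neg h', if_pos (by nlinarith), if_neg (fun c => by nlinarith [c.2]),
          if_neg (fun c => h' c.2), add_zero, add_zero, e1]
    · rw [if_pos h, if_pos h, if_neg (by nlinarith), if_neg (fun c => by linarith [c.1]),
        if_neg (fun c => by linarith [c.1]), add_zero, add_zero, add_zero]
  have mL : ∀ t : ℝ, Measurable fun l : ℝ => ENNReal.ofReal (2 * l) *
      (ENNReal.ofReal (1 - t / l) * ENNReal.ofReal (l ^ beta * hfun (t / l))) := fun t => by fun_prop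
  have mI : Measurable fun l : ℝ => ENNReal.ofReal (2 * l) *
      ∫⁻ x in Ioo (0 : ℝ) 1, {x | x * l < s ∧ (1 - x) * l < 1 - s}.indicator
        (fun x => ENNReal.ofReal (l ^ beta * hfun x)) x := by
    refine Measurable.mul (by fun_prop) (Measurable.lintegral_prod_right' (f := fun q : ℝ × ℝ =>
      {x | x * q.1 < s ∧ (1 - x) * q.1 < 1 - s}.indicator
        (fun x => ENNReal.ofReal (q.1 ^ beta * hfun x)) q.2) ?_)
    simp only [indicator, mem_ofPred_eq]
    refine Measurable.ite ?_ (by fun_prop) measurable_const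
    exact (measurableSet_lt (f := fun q : ℝ × ℝ => q.2 * q.1) (by fun_prop) measurable_const).inter
        (measurableSet_lt (f := fun q : ℝ × ℝ => (1 - q.2) * q.1) (by fun_prop) measurable_const)
  rw [setLIntegral_congr_fun measurableSet_Ioo key, lintegral_add_left (mL s),
    lintegral_add_left (mL (1 - s)), lintegral_add_left mI]
  have e2 := lintegral_reflect (k := fun l => ENNReal.ofReal (2 * l) *
      ∫⁻ x in Ioo (0 : ℝ) 1, {x | x * l < s ∧ (1 - x) * l < 1 - s}.indicator
        (fun x => ENNReal.ofReal (l ^ beta * hfun x)) x) 0 1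
  rw [sub_self, sub_zero] at e2
  rw [← e2]
  change leftPart s + (leftPart (1 - s) + (innerPart s + innerPart s)) = _
  rw [innerPart_eq hs]
  have e3 := leftPart_add_innerHalf hs
  have e4 := leftPart_add_innerHalf hs'
  have e5 : leftPart s + (leftPart (1 - s) + (innerHalf s + innerHalf (1 - s) +
      (innerHalf s + innerHalf (1 - s)))) = (leftPart s + (innerHalf s + innerHalf s)) +
      (leftPart (1 - s) + (innerHalf (1 - s) + innerHalf (1 - s))) := by ring
  have := hfun_nonneg hs.1.le hs.2.le
  rw [e5, e3, e4, hfun_symm, sub_sub_cancel, ← ENNReal.ofReal_add]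
  · congr 1
    ring
  · exact mul_nonneg hs'.1.le this
  · exact mul_nonneg hs.1.le this

/-! ## The approximations and their increments -/

/-- The subfamily of chords below a child of the root. -/
def sub (c : Bool) (w : Chords) : Chords := fun y => w (c :: y)

theorem measurable_sub (c : Bool) : Measurable (sub c) :=
  measurable_pi_iff.2 fun y => measurable_pi_apply (c :: y)

/-- Shifting the family of chords replaces moving down the tree, so that every recursion can be
stated at the root. -/
theorem approx_cons (κ : ℝ) (w : Chords) (c : Bool) (n : ℕ) (x : List Bool) :
    approx κ w n (c :: x) = approx κ (sub c w) n x := by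
  induction n generalizing x with
  | zero => rfl
  | succ n ih => simp only [approx, List.cons_append, ih, sub]

/-- The `n`-th approximation at the root. -/
noncomputable def level (κ : ℝ) (n : ℕ) (w : Chords) (s : ℝ) : ℝ := approx κ w n [] s

theorem level_zero (κ : ℝ) (w : Chords) : level κ 0 w = fun s => κ * hfun s := rfl

theorem level_succ (κ : ℝ) (n : ℕ) (w : Chords) :
    level κ (n + 1) w = glue (w []) (level κ n (sub false w)) (level κ n (sub true w)) := by
  funext s
  simp only [level, approx, List.nil_append, approx_cons]
  rfl

theorem measurable_level (κ : ℝ) (n : ℕ) : Measurable fun q : Chords × ℝ => level κ n q.1 q.2 := by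
  induction n with
  | zero => exact (continuous_hfun.measurable.comp measurable_snd).const_mul κ
  | succ n ih =>
    simp only [level_succ]
    have h : ∀ c, Measurable (Function.uncurry fun (q : Chords × ℝ) (t : ℝ) =>
        level κ n (sub c q.1) t) := fun c =>
      ih.comp (((measurable_sub c).comp (measurable_fst.comp measurable_fst)).prodMk measurable_snd)
    exact measurable_glue (by fun_prop) (h false) (h true) measurable_snd

/-- The increment between consecutive approximations. -/
noncomputable def incr (κ : ℝ) (n : ℕ) (w : Chords) (s : ℝ) : ℝ :=
  level κ (n + 1) w s - level κ n w s

theorem measurable_incr (κ : ℝ) (n : ℕ) : Measurable fun q : Chords × ℝ => incr κ n q.1 q.2 :=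
  (measurable_level κ (n + 1)).sub (measurable_level κ n)

theorem measurable_incr_left (κ : ℝ) (n : ℕ) (s : ℝ) : Measurable fun w => incr κ n w s :=
  (measurable_incr κ n).comp (measurable_id.prodMk measurable_const)

/-- The gluing is linear in the pair of functions. -/
theorem incr_succ (κ : ℝ) (n : ℕ) (w : Chords) :
    incr κ (n + 1) w = glue (w []) (incr κ n (sub false w)) (incr κ n (sub true w)) := by
  funext s
  rw [incr, level_succ κ (n + 1), level_succ κ n w]
  simp only [glue, incr]
  split_ifs <;> ring

theorem level_eq_sum (κ : ℝ) (n : ℕ) (w : Chords) (s : ℝ) :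
    level κ n w s = κ * hfun s + ∑ k ∈ Finset.range n, incr κ k w s := by
  simp only [incr, Finset.sum_range_sub (fun k => level κ k w s), level_zero]
  ring

/-- The mass of the outer fragment. -/
noncomputable def rest (p : ℝ × ℝ) : ℝ := 1 - (p.2 - p.1)

theorem measurable_rest : Measurable rest := by unfold rest; fun_prop

theorem rest_mem {p : ℝ × ℝ} (hp : p ∈ chords) : rest p ∈ Ioo (0 : ℝ) 1 := by
  obtain ⟨h1, h2, h3⟩ := hp
  constructor <;> unfold rest <;> linarith

theorem weights {p : ℝ × ℝ} (hp : p ∈ chords) :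
    0 ≤ rest p ^ beta ∧ rest p ^ beta ≤ 1 ∧ 0 ≤ (1 - rest p) ^ beta ∧ (1 - rest p) ^ beta ≤ 1 := by
  have hr := rest_mem hp
  exact ⟨Real.rpow_nonneg hr.1.le beta, Real.rpow_le_one hr.1.le hr.2.le beta_pos.le,
    Real.rpow_nonneg (sub_nonneg.2 hr.2.le) beta,
    Real.rpow_le_one (sub_nonneg.2 hr.2.le) (by linarith [hr.1]) beta_pos.le⟩

theorem foot_mem {p : ℝ × ℝ} (hp : p ∈ chords) : p.1 / rest p ∈ Ioo (0 : ℝ) 1 := by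
  have h := rest_mem hp
  obtain ⟨h1, h2, h3⟩ := hp
  refine ⟨div_pos h1 h.1, (div_lt_one h.1).2 ?_⟩
  unfold rest
  linarith

/-- The value of a glued function is a value on the outer fragment, to which a value on the inner
fragment is added for points inside it. -/
theorem glue_cases {p : ℝ × ℝ} (hp : p ∈ chords) {s : ℝ} (hs : s ∈ Icc (0 : ℝ) 1) :
    (∃ x ∈ Icc (0 : ℝ) 1, ∀ f g, glue p f g s = rest p ^ beta * f x) ∨
    ∃ y ∈ Icc (0 : ℝ) 1, ∀ f g,
      glue p f g s = rest p ^ beta * f (p.1 / rest p) + (1 - rest p) ^ beta * g y := by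
  have hr := rest_mem hp
  obtain ⟨h1, h2, h3⟩ := hp
  by_cases hu : s < p.1
  · refine Or.inl ⟨s / rest p, ⟨div_nonneg hs.1 hr.1.le, (div_le_one hr.1).2 ?_⟩, fun f g => ?_⟩
    · unfold rest
      linarith
    · simp only [glue, if_pos hu, rest]
  · by_cases hv : s < p.2
    · refine Or.inr ⟨(s - p.1) / (p.2 - p.1), ⟨div_nonneg (by linarith) (by linarith),
        (div_le_one (by linarith)).2 (by linarith)⟩, fun f g => ?_⟩
      simp only [glue, if_neg hu, if_pos hv, rest, sub_sub_cancel]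
    · refine Or.inl ⟨(s - (p.2 - p.1)) / rest p, ⟨div_nonneg (by linarith) hr.1.le,
        (div_le_one hr.1).2 ?_⟩, fun f g => ?_⟩
      · unfold rest
        linarith [hs.2]
      · simp only [glue, if_neg hu, if_neg hv, rest]

/-- The vanishing of `g` at 0 and 1 is what makes the pieces match at the two ends of the chord. -/
theorem continuous_glue {p : ℝ × ℝ} (hp : p ∈ chords) {f g : ℝ → ℝ} (hf : Continuous f)
    (hg : Continuous g) (h0 : g 0 = 0) (h1 : g 1 = 0) : Continuous (glue p f g) := by
  have hb := beta_pos
  have hr := rest_mem hp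
  obtain ⟨hp1, hp2, hp3⟩ := hp
  have hd : p.2 - p.1 ≠ 0 := by linarith
  unfold glue
  simp only [← not_le, ite_not]
  refine Continuous.if_le (Continuous.if_le ?_ ?_ continuous_const continuous_id ?_) ?_
    continuous_const continuous_id ?_
  · fun_prop
  · fun_prop
  · rintro s rfl
    rw [div_self hd, h1, mul_zero, add_zero, sub_sub_cancel]
  · fun_prop
  · rintro s rfl
    rw [if_neg hp2.not_ge, sub_self, zero_div, h0, mul_zero, add_zero]

theorem glue_zero {p : ℝ × ℝ} (hp : p ∈ chords) (f g : ℝ → ℝ) (h : f 0 = 0) : glue p f g 0 = 0 := by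
  simp [glue, if_pos hp.1, h]

theorem glue_one {p : ℝ × ℝ} (hp : p ∈ chords) (f g : ℝ → ℝ) (h : f 1 = 0) : glue p f g 1 = 0 := by
  have hr := rest_mem hp
  obtain ⟨h1, h2, h3⟩ := hp
  have : 1 - (p.2 - p.1) ≠ 0 := hr.1.ne'
  simp [glue, if_neg h3.not_gt, if_neg (h2.trans h3).not_gt, div_self this, h]

theorem glue_nonneg {p : ℝ × ℝ} (hp : p ∈ chords) {f g : ℝ → ℝ} (hf : ∀ s ∈ Icc (0 : ℝ) 1, 0 ≤ f s)
    (hg : ∀ s ∈ Icc (0 : ℝ) 1, 0 ≤ g s) {s : ℝ} (hs : s ∈ Icc (0 : ℝ) 1) : 0 ≤ glue p f g s := by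
  obtain ⟨a, -, b, -⟩ := weights hp
  rcases glue_cases hp hs with ⟨x, hx, h⟩ | ⟨y, hy, h⟩
  · rw [h]
    exact mul_nonneg a (hf x hx)
  · rw [h]
    exact add_nonneg (mul_nonneg a (hf _ (Ioo_subset_Icc_self (foot_mem hp))))
      (mul_nonneg b (hg y hy))

/-- All chords of the family are non-degenerate. -/
def Good (w : Chords) : Prop := ∀ x, w x ∈ chords

theorem Good.sub {w : Chords} (hw : Good w) (c : Bool) : Good (sub c w) := fun x => hw (c :: x)

theorem level_excursion {κ : ℝ} (hκ : 0 ≤ κ) {w : Chords} (hw : Good w) (n : ℕ) :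
    Continuous (level κ n w) ∧ level κ n w 0 = 0 ∧ level κ n w 1 = 0 ∧
      ∀ s ∈ Icc (0 : ℝ) 1, 0 ≤ level κ n w s := by
  induction n generalizing w with
  | zero =>
    refine ⟨continuous_const.mul continuous_hfun, ?_, ?_, fun s hs => ?_⟩
    · simp [level_zero, hfun_zero]
    · simp [level_zero, hfun_one]
    · exact mul_nonneg hκ (hfun_nonneg hs.1 hs.2)
  | succ n ih =>
    obtain ⟨a1, a2, a3, a4⟩ := ih (hw.sub false)
    obtain ⟨b1, b2, b3, b4⟩ := ih (hw.sub true)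
    rw [level_succ]
    exact ⟨continuous_glue (hw []) a1 b1 b2 b3, glue_zero (hw []) _ _ a2, glue_one (hw []) _ _ a3,
      fun s hs => glue_nonneg (hw []) a4 b4 hs⟩

/-- A bound for the supremum of the increments, defined along the recursion. -/
noncomputable def dom (κ : ℝ) : ℕ → Chords → ℝ
  | 0, _ => 3 * κ
  | n + 1, w => max (rest (w []) ^ beta * dom κ n (sub false w))
      (rest (w []) ^ beta * |incr κ n (sub false w) ((w []).1 / rest (w []))| +
        (1 - rest (w [])) ^ beta * dom κ n (sub true w))

theorem measurable_dom (κ : ℝ) (n : ℕ) : Measurable (dom κ n) := by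
  induction n with
  | zero => exact measurable_const
  | succ n ih =>
    have hr := measurable_rest
    have h0 := measurable_sub false
    have h1 := measurable_sub true
    have hi : Measurable fun w : Chords => incr κ n (sub false w) ((w []).1 / rest (w [])) :=
      (measurable_incr κ n).comp (h0.prodMk (by fun_prop))
    refine Measurable.max (Measurable.mul (by fun_prop) (ih.comp h0))
      (Measurable.add (Measurable.mul (by fun_prop) ?_) (Measurable.mul (by fun_prop) (ih.comp h1)))
    exact measurable_norm.comp hi

/-- The pointwise bound follows the recursion fragment by fragment. The deterministic growth bound
is crude, and serves only for integrability. -/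
theorem abs_incr_le {κ : ℝ} (hκ : 0 ≤ κ) {w : Chords} (hw : Good w) (n : ℕ) :
    (∀ s ∈ Icc (0 : ℝ) 1, |incr κ n w s| ≤ dom κ n w) ∧ dom κ n w ≤ 3 * κ * 2 ^ n := by
  induction n generalizing w with
  | zero =>
    obtain ⟨a0, a1, b0, b1⟩ := weights (hw [])
    refine ⟨fun s hs => ?_, by simp [dom]⟩
    have hh : ∀ t ∈ Icc (0 : ℝ) 1, 0 ≤ κ * hfun t ∧ κ * hfun t ≤ κ := fun t ht =>
      ⟨mul_nonneg hκ (hfun_nonneg ht.1 ht.2), mul_le_of_le_one_right hκ (hfun_le_one ht.1 ht.2)⟩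
    have h1 := hh s hs
    -- A glued function lies between 0 and 2κ and `κ * hfun` between 0 and κ, so 3κ leaves room.
    rw [incr, level_succ]
    simp only [level_zero, dom]
    rcases glue_cases (hw []) hs with ⟨x, hx, h⟩ | ⟨y, hy, h⟩
    · rw [h, abs_le]
      have h2 := hh x hx
      constructor <;> nlinarith
    · rw [h, abs_le]
      have h2 := hh y hy
      have h3 := hh _ (Ioo_subset_Icc_self (foot_mem (hw [])))
      constructor <;> nlinarith
  | succ n ih =>
    obtain ⟨a0, a1, b0, b1⟩ := weights (hw [])
    obtain ⟨c1, c2⟩ := ih (hw.sub false)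
    obtain ⟨d1, d2⟩ := ih (hw.sub true)
    have hf := c1 _ (Ioo_subset_Icc_self (foot_mem (hw [])))
    have c0 := (abs_nonneg _).trans hf
    have d0 := (abs_nonneg _).trans (d1 0 (by simp))
    constructor
    · intro s hs
      rw [incr_succ, dom]
      rcases glue_cases (hw []) hs with ⟨x, hx, h⟩ | ⟨y, hy, h⟩
      · rw [h, abs_mul, abs_of_nonneg a0]
        exact le_max_of_le_left (mul_le_mul_of_nonneg_left (c1 x hx) a0)
      · rw [h]
        refine le_max_of_le_right ((abs_add_le _ _).trans ?_)
        rw [abs_mul, abs_mul, abs_of_nonneg a0, abs_of_nonneg b0]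
        gcongr
        exact d1 y hy
    · rw [dom, pow_succ]
      refine max_le ?_ ?_ <;> nlinarith [mul_le_of_le_one_left c0 a1, mul_le_of_le_one_left d0 b1,
        mul_le_of_le_one_left (abs_nonneg (incr κ n (sub false w) ((w []).1 / rest (w [])))) a1]

/-! ## Moments of the increments -/

theorem ae_good : ∀ᵐ w ∂treeLaw, Good w := ae_treeLaw_forall_mem_chords

theorem incr_join (κ : ℝ) (n : ℕ) (p : ℝ × ℝ) (w₀ w₁ : Chords) :
    incr κ (n + 1) (join p w₀ w₁) = glue p (incr κ n w₀) (incr κ n w₁) := incr_succ κ n _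

theorem level_join (κ : ℝ) (n : ℕ) (p : ℝ × ℝ) (w₀ w₁ : Chords) :
    level κ (n + 1) (join p w₀ w₁) = glue p (level κ n w₀) (level κ n w₁) := level_succ κ n _

theorem glue_const_mul (κ : ℝ) (p : ℝ × ℝ) (f g : ℝ → ℝ) (s : ℝ) :
    glue p (fun t => κ * f t) (fun t => κ * g t) s = κ * glue p f g s := by
  simp only [glue]
  split_ifs <;> ring

theorem incr_zero_join (κ : ℝ) (p : ℝ × ℝ) (w₀ w₁ : Chords) (s : ℝ) :
    incr κ 0 (join p w₀ w₁) s = κ * glue p hfun hfun s - κ * hfun s := by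
  rw [incr, level_join, level_zero, level_zero, level_zero, glue_const_mul]

theorem integral_treeLaw {F : Chords → ℝ} (hF : Integrable F treeLaw) :
    ∫ w, F w ∂treeLaw = ∫ p, ∫ q : Chords × Chords, F (join p q.1 q.2) ∂(treeLaw.prod treeLaw)
      ∂chordLaw := by
  have hF' : Integrable F ((chordLaw.prod (treeLaw.prod treeLaw)).map
    (fun q => join q.1 q.2.1 q.2.2)) := by rwa [map_join]
  conv_lhs => rw [← map_join, integral_map measurable_join.aemeasurable hF'.1]
  exact integral_prod _ (hF'.comp_measurable measurable_join)

theorem integrable_incr {κ : ℝ} (hκ : 0 ≤ κ) (n : ℕ) {s : ℝ} (hs : s ∈ Icc (0 : ℝ) 1) :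
    Integrable (fun w => incr κ n w s) treeLaw := by
  refine Integrable.of_bound (measurable_incr_left κ n s).aestronglyMeasurable (3 * κ * 2 ^ n) ?_
  filter_upwards [ae_good] with w hw
  obtain ⟨h1, h2⟩ := abs_incr_le hκ hw n
  exact (h1 s hs).trans h2

theorem integral_glue_hfun {s : ℝ} (hs : s ∈ Icc (0 : ℝ) 1) :
    ∫ p, glue p hfun hfun s ∂chordLaw = hfun s := by
  rcases eq_or_lt_of_le hs.1 with rfl | h0
  · rw [hfun_zero]
    refine integral_eq_zero_of_ae ?_
    filter_upwards [ae_mem_chords] with p hp using glue_zero hp _ _ hfun_zero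
  rcases eq_or_lt_of_le hs.2 with rfl | h1
  · rw [hfun_one]
    refine integral_eq_zero_of_ae ?_
    filter_upwards [ae_mem_chords] with p hp using glue_one hp _ _ hfun_one
  have hh := continuous_hfun.measurable
  have hnn : ∀ t ∈ Icc (0 : ℝ) 1, 0 ≤ hfun t := fun t ht => hfun_nonneg ht.1 ht.2
  rw [integral_eq_lintegral_of_nonneg_ae, lintegral_glue_hfun ⟨h0, h1⟩,
    ENNReal.toReal_ofReal (hnn s hs)]
  · filter_upwards [ae_mem_chords] with p hp using glue_nonneg hp hnn hnn hs
  · exact (measurable_glue (f₀ := fun _ => hfun) (f₁ := fun _ => hfun) measurable_id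
      (hh.comp measurable_snd) (hh.comp measurable_snd) measurable_const).aestronglyMeasurable

theorem integrable_glue_hfun {s : ℝ} (hs : s ∈ Icc (0 : ℝ) 1) :
    Integrable (fun p => glue p hfun hfun s) chordLaw := by
  have hh := continuous_hfun.measurable
  refine Integrable.of_bound (measurable_glue (f₀ := fun _ => hfun) (f₁ := fun _ => hfun)
    measurable_id (hh.comp measurable_snd) (hh.comp measurable_snd)
    measurable_const).aestronglyMeasurable 2 ?_
  filter_upwards [ae_mem_chords] with p hp
  obtain ⟨a0, a1, b0, b1⟩ := weights hp
  have hnn : ∀ t ∈ Icc (0 : ℝ) 1, 0 ≤ hfun t ∧ hfun t ≤ 1 := fun t ht =>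
    ⟨hfun_nonneg ht.1 ht.2, hfun_le_one ht.1 ht.2⟩
  rw [Real.norm_eq_abs, abs_le]
  rcases glue_cases hp hs with ⟨x, hx, h⟩ | ⟨y, hy, h⟩
  · rw [h]
    have := hnn x hx
    constructor <;> nlinarith
  · rw [h]
    have := hnn y hy
    have := hnn _ (Ioo_subset_Icc_self (foot_mem hp))
    constructor <;> nlinarith

/-- The first increment is centred because `h` is a fixed point of the mean gluing. Later ones are,
given the root chord, linear combinations of centred increments. -/
theorem integral_incr {κ : ℝ} (hκ : 0 ≤ κ) (n : ℕ) {s : ℝ} (hs : s ∈ Icc (0 : ℝ) 1) :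
    ∫ w, incr κ n w s ∂treeLaw = 0 := by
  induction n generalizing s with
  | zero =>
    rw [integral_treeLaw (integrable_incr hκ 0 hs)]
    simp only [incr_zero_join, integral_const, probReal_univ, one_smul]
    rw [integral_sub ((integrable_glue_hfun hs).const_mul κ) (integrable_const _),
      integral_const_mul, integral_glue_hfun hs]
    simp
  | succ n ih =>
    rw [integral_treeLaw (integrable_incr hκ _ hs)]
    refine integral_eq_zero_of_ae ?_
    filter_upwards [ae_mem_chords] with p hp
    have h0 : ∀ x ∈ Icc (0 : ℝ) 1,
        ∫ q : Chords × Chords, incr κ n q.1 x ∂(treeLaw.prod treeLaw) = 0 := fun x hx => by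
      rw [integral_fun_fst (fun w => incr κ n w x), ih hx, smul_zero]
    have h1 : ∀ x ∈ Icc (0 : ℝ) 1,
        ∫ q : Chords × Chords, incr κ n q.2 x ∂(treeLaw.prod treeLaw) = 0 := fun x hx => by
      rw [integral_fun_snd (fun w => incr κ n w x), ih hx, smul_zero]
    simp only [incr_join]
    rcases glue_cases hp hs with ⟨x, hx, h⟩ | ⟨y, hy, h⟩
    · simp only [h]
      rw [integral_const_mul, h0 x hx, mul_zero]
      rfl
    · simp only [h]
      have hf := Ioo_subset_Icc_self (foot_mem hp)
      rw [integral_add (((integrable_incr hκ n hf).comp_fst treeLaw).const_mul _)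
        (((integrable_incr hκ n hy).comp_snd treeLaw).const_mul _), integral_const_mul,
        integral_const_mul, h0 _ hf, h1 y hy, mul_zero, mul_zero, add_zero]
      rfl

/-- The contraction factor of second moments. -/
noncomputable def ratio : ℝ := 2 / (2 * beta + 1)

theorem ratio_pos : 0 < ratio := by
  have := beta_pos
  unfold ratio
  positivity

theorem ratio_lt_one : ratio < 1 := by
  have := half_lt_beta
  unfold ratio
  rw [div_lt_one] <;> linarith

/-- Reflecting the second term in `l` turns the density 2l into 2(1 - l). The densities add up to 2,
which leaves 2 ∫ l^(2β) dl. -/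
theorem lintegral_weights :
    ∫⁻ p, (ENNReal.ofReal ((rest p ^ beta) ^ 2) + ENNReal.ofReal (((1 - rest p) ^ beta) ^ 2))
      ∂chordLaw = ENNReal.ofReal ratio := by
  have hr := measurable_rest
  have hb := beta_pos
  rw [lintegral_chordLaw (by fun_prop)]
  have e : ∀ l x : ℝ, rest (x * l, x * l + 1 - l) = l := fun l x => by
    simp only [rest]
    ring
  simp only [e, lintegral_const, Measure.restrict_apply_univ, Real.volume_Ioo, sub_zero,
    ENNReal.ofReal_one, mul_one, mul_add]
  have er := lintegral_reflect
    (k := fun l => ENNReal.ofReal (2 * l) * ENNReal.ofReal (((1 - l) ^ beta) ^ 2)) 0 1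
  simp only [sub_self, sub_zero, sub_sub_cancel] at er
  rw [lintegral_add_left (by fun_prop), er, ← lintegral_add_left (by fun_prop)]
  have e2 : ∀ l ∈ Ioo (0 : ℝ) 1, ENNReal.ofReal (2 * l) * ENNReal.ofReal ((l ^ beta) ^ 2) +
      ENNReal.ofReal (2 * (1 - l)) * ENNReal.ofReal ((l ^ beta) ^ 2) =
      ENNReal.ofReal 2 * ENNReal.ofReal (l ^ (2 * beta)) := by
    intro l hl
    have hl1 : 0 < 1 - l := by linarith [hl.2]
    have hl0 := hl.1
    rw [← add_mul, ← ENNReal.ofReal_add (by positivity) (by positivity), mul_comm 2 beta,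
      Real.rpow_mul hl.1.le, Real.rpow_two]
    congr 2
    ring
  rw [setLIntegral_congr_fun measurableSet_Ioo e2, lintegral_const_mul _ (by fun_prop),
    setLIntegral_Ioo_ofReal_rpow (by linarith) zero_le_one, ← ENNReal.ofReal_mul zero_le_two,
    Real.one_rpow, ratio]
  congr 1
  ring

/-- The cross term vanishes because `Y` is centred. Used with `c` the frozen outer contribution and
`Y` the inner increment, it makes variances add. -/
theorem lintegral_sq_add {Y : Chords → ℝ} (hY : Integrable Y treeLaw)
    (hY2 : Integrable (fun w => Y w ^ 2) treeLaw) (h0 : ∫ w, Y w ∂treeLaw = 0) (b c : ℝ) :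
    ∫⁻ w, ENNReal.ofReal ((c + b * Y w) ^ 2) ∂treeLaw =
      ENNReal.ofReal (c ^ 2) + ENNReal.ofReal (b ^ 2) * ∫⁻ w, ENNReal.ofReal (Y w ^ 2) ∂treeLaw := by
  have e : ∀ w, (c + b * Y w) ^ 2 = c ^ 2 + (2 * c * b * Y w + b ^ 2 * Y w ^ 2) := fun w => by ring
  have i1 : Integrable (fun w => 2 * c * b * Y w) treeLaw := hY.const_mul _
  have i2 : Integrable (fun w => b ^ 2 * Y w ^ 2) treeLaw := hY2.const_mul _
  have i3 : Integrable (fun w => (c + b * Y w) ^ 2) treeLaw := by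
    simp only [e]
    exact (integrable_const _).add (i1.add i2)
  rw [← ofReal_integral_eq_lintegral_ofReal i3 (ae_of_all _ fun w => sq_nonneg _),
    ← ofReal_integral_eq_lintegral_ofReal hY2 (ae_of_all _ fun w => sq_nonneg _),
    ← ENNReal.ofReal_mul (sq_nonneg _), ← ENNReal.ofReal_add (sq_nonneg _)
      (mul_nonneg (sq_nonneg _) (integral_nonneg fun w => sq_nonneg _))]
  congr 1
  simp only [e]
  have i4 : Integrable (fun w => 2 * c * b * Y w + b ^ 2 * Y w ^ 2) treeLaw := i1.add i2
  rw [integral_add (integrable_const _) i4, integral_add i1 i2, integral_const_mul,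
    integral_const_mul, h0]
  simp

/-- Given the root chord, the increment is a weighted outer increment, plus possibly an independent
centred weighted inner one. In all cases its second moment is at most the sum of the squared weights
times the previous bound. -/
theorem lintegral_incr_sq_le {κ : ℝ} (hκ : 0 ≤ κ) (n : ℕ) {s : ℝ} (hs : s ∈ Icc (0 : ℝ) 1) :
    ∫⁻ w, ENNReal.ofReal (incr κ n w s ^ 2) ∂treeLaw ≤
      ENNReal.ofReal ((3 * κ) ^ 2) * ENNReal.ofReal ratio ^ n := by
  induction n generalizing s with
  | zero =>
    rw [pow_zero, mul_one]
    calc _ ≤ ∫⁻ w, ENNReal.ofReal ((3 * κ) ^ 2) ∂treeLaw := by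
          refine lintegral_mono_ae ?_
          filter_upwards [ae_good] with w hw
          refine ENNReal.ofReal_le_ofReal (sq_le_sq' ?_ ?_)
          · have := (abs_le.1 ((abs_incr_le hκ hw 0).1 s hs)).1
            simpa [dom] using this
          · exact (abs_le.1 ((abs_incr_le hκ hw 0).1 s hs)).2
      _ = _ := by simp
  | succ n ih =>
    have hm := measurable_incr_left κ n
    rw [lintegral_treeLaw (F := fun w => ENNReal.ofReal (incr κ (n + 1) w s ^ 2))
      ((measurable_incr_left κ (n + 1) s).pow_const 2).ennreal_ofReal]
    set K := ENNReal.ofReal ((3 * κ) ^ 2) * ENNReal.ofReal ratio ^ n with hK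
    calc _ ≤ ∫⁻ p, (ENNReal.ofReal ((rest p ^ beta) ^ 2) +
          ENNReal.ofReal (((1 - rest p) ^ beta) ^ 2)) * K ∂chordLaw := by
          refine lintegral_mono_ae ?_
          filter_upwards [ae_mem_chords] with p hp
          simp only [incr_join]
          rcases glue_cases hp hs with ⟨x, hx, h⟩ | ⟨y, hy, h⟩
          · simp only [h, lintegral_const, measure_univ, mul_one, mul_pow,
              ENNReal.ofReal_mul (sq_nonneg (rest p ^ beta))]
            rw [lintegral_const_mul _ ((hm x).pow_const 2).ennreal_ofReal, add_mul]
            exact le_add_right (by gcongr; exact ih hx)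
          · have hf := Ioo_subset_Icc_self (foot_mem hp)
            simp only [h]
            have i2 : Integrable (fun w => incr κ n w y ^ 2) treeLaw := by
              refine Integrable.of_bound ((hm y).pow_const 2).aestronglyMeasurable
                ((3 * κ * 2 ^ n) ^ 2) ?_
              filter_upwards [ae_good] with w hw
              obtain ⟨h1, h2⟩ := abs_incr_le hκ hw n
              rw [Real.norm_eq_abs, abs_pow]
              exact pow_le_pow_left₀ (abs_nonneg _) ((h1 y hy).trans h2) 2
            simp only [lintegral_sq_add (integrable_incr hκ n hy) i2 (integral_incr hκ n hy),
              mul_pow, ENNReal.ofReal_mul (sq_nonneg (rest p ^ beta))]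
            rw [lintegral_add_right _ measurable_const,
              lintegral_const_mul _ ((hm _).pow_const 2).ennreal_ofReal, lintegral_const,
              measure_univ, mul_one, add_mul]
            gcongr
            · exact ih hf
            · exact ih hy
      _ = _ := by
          have hr := measurable_rest
          rw [lintegral_mul_const _ (by fun_prop), lintegral_weights, hK, pow_succ]
          ring

/-- In the recursion for `dom` the supremum of the outer fragment enters either alone or through its
value at the foot only. That value has a second moment of order `ratio ^ n`, so the recursion is a
contraction with a geometrically small source term. -/
theorem exists_lintegral_dom_sq_le {κ : ℝ} (hκ : 0 ≤ κ) : ∃ M r : ℝ, 0 ≤ M ∧ 0 < r ∧ r < 1 ∧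
    ∀ n, ∫⁻ w, ENNReal.ofReal (dom κ n w ^ 2) ∂treeLaw ≤ ENNReal.ofReal (M * r ^ n) := by
  have q0 := ratio_pos
  have q1 := ratio_lt_one
  -- Chosen so that the contraction factor, inflated by 1 + ε, becomes (1 + ratio)/2, still below
  -- one.
  set ε : ℝ := (1 - ratio) / (2 * ratio) with hε
  have ε0 : 0 < ε := div_pos (by linarith) (by linarith)
  have hεq : (1 + ε) * ratio = (1 + ratio) / 2 := by
    rw [hε]
    field_simp
    ring
  set A : ℝ := (1 + ε⁻¹) * (3 * κ) ^ 2 with hA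
  have A0 : 0 ≤ A := by positivity
  -- The rate (3 + ratio)/4 exceeds (1 + ratio)/2 by (1 - ratio)/4, so `M` must absorb the source
  -- `A` into this gap (`hM1`) and dominate the initial value.
  set M : ℝ := (3 * κ) ^ 2 + A / ((1 - ratio) / 4) with hM
  have hM1 : A ≤ M * ((1 - ratio) / 4) := by
    rw [hM, add_mul, div_mul_cancel₀ _ (by linarith)]
    nlinarith [sq_nonneg (3 * κ)]
  have M0 : 0 ≤ M := by
    have : 0 < (1 - ratio) / 4 := by linarith
    positivity
  refine ⟨M, (3 + ratio) / 4, M0, by linarith, by linarith, fun n => ?_⟩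
  induction n with
  | zero =>
    simp only [dom, lintegral_const, measure_univ, mul_one, pow_zero]
    refine ENNReal.ofReal_le_ofReal ?_
    have : 0 < (1 - ratio) / 4 := by linarith
    rw [hM]
    have := div_nonneg A0 this.le
    linarith
  | succ n ih =>
    have hd := measurable_dom κ n
    have hr := measurable_rest
    rw [lintegral_treeLaw ((measurable_dom κ (n + 1)).pow_const 2).ennreal_ofReal]
    set y := ∫⁻ w, ENNReal.ofReal (dom κ n w ^ 2) ∂treeLaw with hy
    have key : ∀ᵐ p ∂chordLaw, ∫⁻ w₀, ∫⁻ w₁, ENNReal.ofReal (dom κ (n + 1) (join p w₀ w₁) ^ 2)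
        ∂treeLaw ∂treeLaw ≤ ENNReal.ofReal (1 + ε) * ((ENNReal.ofReal ((rest p ^ beta) ^ 2) +
          ENNReal.ofReal (((1 - rest p) ^ beta) ^ 2)) * y) + ENNReal.ofReal (A * ratio ^ n) := by
      filter_upwards [ae_mem_chords] with p hp
      obtain ⟨a0, a1, b0, b1⟩ := weights hp
      have hf := Ioo_subset_Icc_self (foot_mem hp)
      have pt : ∀ w₀ w₁, ENNReal.ofReal (dom κ (n + 1) (join p w₀ w₁) ^ 2) ≤
          (ENNReal.ofReal (1 + ε) * ENNReal.ofReal ((rest p ^ beta) ^ 2) *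
            ENNReal.ofReal (dom κ n w₀ ^ 2) +
          ENNReal.ofReal (1 + ε⁻¹) * ENNReal.ofReal (incr κ n w₀ (p.1 / rest p) ^ 2)) +
          ENNReal.ofReal (1 + ε) * ENNReal.ofReal (((1 - rest p) ^ beta) ^ 2) *
            ENNReal.ofReal (dom κ n w₁ ^ 2) := by
        intro w₀ w₁
        rw [← ENNReal.ofReal_mul (by positivity), ← ENNReal.ofReal_mul (by positivity),
          ← ENNReal.ofReal_mul (by positivity), ← ENNReal.ofReal_mul (by positivity),
          ← ENNReal.ofReal_mul (by positivity), ← ENNReal.ofReal_add (by positivity) (by positivity),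
          ← ENNReal.ofReal_add (by positivity) (by positivity)]
        refine ENNReal.ofReal_le_ofReal ?_
        change max (rest p ^ beta * dom κ n w₀) (rest p ^ beta * |incr κ n w₀ (p.1 / rest p)| +
          (1 - rest p) ^ beta * dom κ n w₁) ^ 2 ≤ _
        have e1 : 0 ≤ ε * (rest p ^ beta) ^ 2 * dom κ n w₀ ^ 2 := by positivity
        have e2 : 0 ≤ (1 + ε⁻¹) * incr κ n w₀ (p.1 / rest p) ^ 2 := by positivity
        have e3 : 0 ≤ (1 + ε) * ((1 - rest p) ^ beta) ^ 2 * dom κ n w₁ ^ 2 := by positivity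
        have e4 : 0 ≤ (1 + ε) * (rest p ^ beta) ^ 2 * dom κ n w₀ ^ 2 := by positivity
        rcases max_cases (rest p ^ beta * dom κ n w₀) (rest p ^ beta * |incr κ n w₀ (p.1 / rest p)| +
          (1 - rest p) ^ beta * dom κ n w₁) with ⟨h, -⟩ | ⟨h, -⟩
        · rw [h]
          nlinarith
        · rw [h]
          set X := rest p ^ beta * |incr κ n w₀ (p.1 / rest p)| with hX
          set Y := (1 - rest p) ^ beta * dom κ n w₁ with hY
          -- Weighted Young inequality: the large constant 1 + ε⁻¹ falls on the foot term, which is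
          -- already small.
          have f1 : (X + Y) ^ 2 ≤ (1 + ε⁻¹) * X ^ 2 + (1 + ε) * Y ^ 2 := by
            have : (1 + ε⁻¹) * X ^ 2 + (1 + ε) * Y ^ 2 - (X + Y) ^ 2 = ε⁻¹ * (X - ε * Y) ^ 2 := by
              field_simp
              ring
            have : 0 ≤ ε⁻¹ * (X - ε * Y) ^ 2 := by positivity
            linarith
          have f2 : X ^ 2 ≤ incr κ n w₀ (p.1 / rest p) ^ 2 := by
            rw [hX, mul_pow, sq_abs]
            exact mul_le_of_le_one_left (sq_nonneg _) (pow_le_one₀ a0 a1)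
          have f3 := mul_le_mul_of_nonneg_left f2 (by positivity : 0 ≤ 1 + ε⁻¹)
          have f4 : (1 + ε) * Y ^ 2 = (1 + ε) * ((1 - rest p) ^ beta) ^ 2 * dom κ n w₁ ^ 2 := by
            rw [hY]
            ring
          linarith
      have hi := ((measurable_incr_left κ n (p.1 / rest p)).pow_const 2).ennreal_ofReal
      calc _ ≤ _ := lintegral_mono fun w₀ => lintegral_mono fun w₁ => pt w₀ w₁
        _ = (ENNReal.ofReal (1 + ε) * ENNReal.ofReal ((rest p ^ beta) ^ 2) * y +
            ENNReal.ofReal (1 + ε⁻¹) *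
              ∫⁻ w, ENNReal.ofReal (incr κ n w (p.1 / rest p) ^ 2) ∂treeLaw) +
            ENNReal.ofReal (1 + ε) * ENNReal.ofReal (((1 - rest p) ^ beta) ^ 2) * y := by
          simp only [lintegral_add_left measurable_const, lintegral_const, measure_univ, mul_one]
          rw [lintegral_add_right _ measurable_const, lintegral_add_left (by fun_prop),
            lintegral_const_mul _ (by fun_prop), lintegral_const_mul _ hi,
            lintegral_const_mul _ (by fun_prop), lintegral_const, measure_univ, mul_one]
        _ ≤ (ENNReal.ofReal (1 + ε) * ENNReal.ofReal ((rest p ^ beta) ^ 2) * y +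
            ENNReal.ofReal (1 + ε⁻¹) * (ENNReal.ofReal ((3 * κ) ^ 2) * ENNReal.ofReal ratio ^ n)) +
            ENNReal.ofReal (1 + ε) * ENNReal.ofReal (((1 - rest p) ^ beta) ^ 2) * y := by
          gcongr
          exact lintegral_incr_sq_le hκ n hf
        _ = _ := by
          rw [hA, mul_assoc (1 + ε⁻¹), ENNReal.ofReal_mul (p := 1 + ε⁻¹) (by positivity),
            ENNReal.ofReal_mul (p := (3 * κ) ^ 2) (by positivity), ENNReal.ofReal_pow q0.le]
          ring
    calc _ ≤ _ := lintegral_mono_ae key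
      _ = ENNReal.ofReal (1 + ε) * (ENNReal.ofReal ratio * y) + ENNReal.ofReal (A * ratio ^ n) := by
        rw [lintegral_add_right _ measurable_const, lintegral_const_mul _ (by fun_prop),
          lintegral_mul_const _ (by fun_prop), lintegral_weights]
        simp
      _ ≤ ENNReal.ofReal (1 + ε) * (ENNReal.ofReal ratio * ENNReal.ofReal (M * ((3 + ratio) / 4) ^ n))
          + ENNReal.ofReal (A * ratio ^ n) := by gcongr
      _ = ENNReal.ofReal ((1 + ratio) / 2 * (M * ((3 + ratio) / 4) ^ n) + A * ratio ^ n) := by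
        rw [← ENNReal.ofReal_mul q0.le, ← ENNReal.ofReal_mul (by positivity),
          ← ENNReal.ofReal_add (by positivity) (by positivity), ← hεq, mul_assoc (1 + ε)]
      _ ≤ _ := by
        refine ENNReal.ofReal_le_ofReal ?_
        have h1 : ratio ^ n ≤ ((3 + ratio) / 4) ^ n := pow_le_pow_left₀ q0.le (by linarith) n
        have h2 : A * ratio ^ n ≤ M * ((1 - ratio) / 4) * ((3 + ratio) / 4) ^ n :=
          mul_le_mul hM1 h1 (by positivity) (A0.trans hM1)
        rw [pow_succ]
        linarith

/-- The bounds for the increments are summable, with integrable sum. -/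
theorem lintegral_tsum_dom_ne_top {κ : ℝ} (hκ : 0 ≤ κ) :
    ∫⁻ w, ∑' n, ENNReal.ofReal (dom κ n w) ∂treeLaw ≠ ⊤ := by
  obtain ⟨M, r, M0, r0, r1, h⟩ := exists_lintegral_dom_sq_le hκ
  set θ := Real.sqrt r with hθ
  have θ0 : 0 < θ := Real.sqrt_pos.2 r0
  have θ1 : θ < 1 := by
    rw [hθ, Real.sqrt_lt' one_pos]
    simpa using r1
  have hr : r = θ ^ 2 := (Real.sq_sqrt r0.le).symm
  have hd := measurable_dom κ
  rw [lintegral_tsum fun n => (hd n).ennreal_ofReal.aemeasurable]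
  have hn : ∀ n, ∫⁻ w, ENNReal.ofReal (dom κ n w) ∂treeLaw ≤ ENNReal.ofReal ((1 + M) * θ ^ n) := by
    intro n
    have hp : 0 < θ ^ n := pow_pos θ0 n
    -- From second to first moments: d ≤ θⁿ + θ⁻ⁿ d² for all real d. With θ = √r both terms are of
    -- order θⁿ after integration.
    calc _ ≤ ∫⁻ w, (ENNReal.ofReal (θ ^ n) +
          ENNReal.ofReal (θ ^ n)⁻¹ * ENNReal.ofReal (dom κ n w ^ 2)) ∂treeLaw := by
          refine lintegral_mono fun w => ?_
          rw [← ENNReal.ofReal_mul (by positivity), ← ENNReal.ofReal_add hp.le (by positivity)]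
          refine ENNReal.ofReal_le_ofReal ?_
          have e : θ ^ n + (θ ^ n)⁻¹ * dom κ n w ^ 2 - dom κ n w =
              (θ ^ n)⁻¹ * ((dom κ n w - θ ^ n / 2) ^ 2 + 3 / 4 * (θ ^ n) ^ 2) := by
            field_simp
            ring
          have : 0 ≤ (θ ^ n)⁻¹ * ((dom κ n w - θ ^ n / 2) ^ 2 + 3 / 4 * (θ ^ n) ^ 2) := by positivity
          linarith
      _ ≤ ENNReal.ofReal (θ ^ n) + ENNReal.ofReal (θ ^ n)⁻¹ * ENNReal.ofReal (M * r ^ n) := by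
          rw [lintegral_add_left measurable_const,
            lintegral_const_mul _ ((hd n).pow_const 2).ennreal_ofReal, lintegral_const,
            measure_univ, mul_one]
          gcongr
          exact h n
      _ = _ := by
          rw [← ENNReal.ofReal_mul (by positivity), ← ENNReal.ofReal_add hp.le (by positivity), hr]
          congr 1
          rw [← pow_mul, mul_comm 2 n, pow_mul]
          field_simp
  refine ne_top_of_le_ne_top ?_ (ENNReal.tsum_le_tsum hn)
  exact ((summable_geometric_of_lt_one θ0.le θ1).mul_left (1 + M)).tsum_ofReal_ne_top

/-! ## The limit -/

/-- The pointwise upper limit of the approximations. -/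
noncomputable def lim (κ : ℝ) (w : Chords) (s : ℝ) : ℝ := limsup (fun n => level κ n w s) atTop

theorem measurable_lim (κ : ℝ) : Measurable fun q : Chords × ℝ => lim κ q.1 q.2 :=
  Measurable.limsup fun n => measurable_level κ n

/-- A nonnegative continuous function on `[0, 1]` that vanishes at both ends. -/
structure IsExcursion (f : ℝ → ℝ) : Prop where
  continuousOn : ContinuousOn f (Icc 0 1)
  zero : f 0 = 0
  one : f 1 = 0
  nonneg : ∀ s ∈ Icc (0 : ℝ) 1, 0 ≤ f s

/-- The approximations converge uniformly to an excursion. -/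
def Nice (κ : ℝ) (w : Chords) : Prop :=
  Good w ∧ IsExcursion (lim κ w) ∧
    TendstoUniformlyOn (fun n => level κ n w) (lim κ w) atTop (Icc 0 1)

theorem ae_summable_dom {κ : ℝ} (hκ : 0 ≤ κ) :
    ∀ᵐ w ∂treeLaw, Good w ∧ Summable fun n => dom κ n w := by
  have h := ae_lt_top' (Measurable.tsum
    fun n => (measurable_dom κ n).ennreal_ofReal).aemeasurable (lintegral_tsum_dom_ne_top hκ)
  filter_upwards [h, ae_good] with w hw hg
  have hnn : ∀ n, 0 ≤ dom κ n w := fun n =>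
    (abs_nonneg _).trans ((abs_incr_le hκ hg n).1 0 (by simp))
  refine ⟨hg, ?_⟩
  have := ENNReal.summable_toReal hw.ne
  simpa [ENNReal.toReal_ofReal (hnn _)] using this

/-- The Weierstrass test applied to the increments; the excursion properties pass to the uniform
limit. -/
theorem nice_of_summable {κ : ℝ} (hκ : 0 ≤ κ) {w : Chords} (hg : Good w)
    (hs : Summable fun n => dom κ n w) : Nice κ w := by
  have h1 := tendstoUniformlyOn_tsum_nat (f := fun n s => incr κ n w s) (s := Icc (0 : ℝ) 1) hs
    fun n s hs => (abs_incr_le hκ hg n).1 s hs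
  have h2 : TendstoUniformlyOn (fun n => level κ n w)
      (fun s => κ * hfun s + ∑' n, incr κ n w s) atTop (Icc 0 1) := by
    rw [Metric.tendstoUniformlyOn_iff] at h1 ⊢
    intro ε hε
    filter_upwards [h1 ε hε] with n hn s hs
    rw [level_eq_sum, dist_add_left]
    exact hn s hs
  have hlim : EqOn (fun s => κ * hfun s + ∑' n, incr κ n w s) (lim κ w) (Icc 0 1) := fun s hs =>
    ((h2.tendsto_at hs).limsup_eq).symm
  have h3 := h2.congr_right hlim
  have hl := fun n => level_excursion hκ hg n
  refine ⟨hg, ⟨h3.continuousOn (Frequently.of_forall fun n => (hl n).1.continuousOn), ?_, ?_, ?_⟩, h3⟩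
  · refine tendsto_nhds_unique (h3.tendsto_at (by simp)) ?_
    simp [(hl _).2.1]
  · refine tendsto_nhds_unique (h3.tendsto_at (by simp)) ?_
    simp [(hl _).2.2.1]
  · exact fun s hs => ge_of_tendsto' (h3.tendsto_at hs) fun n => (hl n).2.2.2 s hs

theorem ae_nice {κ : ℝ} (hκ : 0 ≤ κ) : ∀ᵐ w ∂treeLaw, Nice κ w := by
  filter_upwards [ae_summable_dom hκ] with w ⟨h1, h2⟩ using nice_of_summable hκ h1 h2

theorem lim_join {κ : ℝ} {p : ℝ × ℝ} (hp : p ∈ chords) {w₀ w₁ : Chords} (h₀ : Nice κ w₀)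
    (h₁ : Nice κ w₁) {s : ℝ} (hs : s ∈ Icc (0 : ℝ) 1) :
    lim κ (join p w₀ w₁) s = glue p (lim κ w₀) (lim κ w₁) s := by
  refine Tendsto.limsup_eq ((tendsto_add_atTop_iff_nat 1).1 ?_)
  simp only [level_join]
  rcases glue_cases hp hs with ⟨x, hx, h⟩ | ⟨y, hy, h⟩
  · simp only [h]
    exact (h₀.2.2.tendsto_at hx).const_mul _
  · simp only [h]
    exact ((h₀.2.2.tendsto_at (Ioo_subset_Icc_self (foot_mem hp))).const_mul _).add
      ((h₁.2.2.tendsto_at hy).const_mul _)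

/-- The mean of the approximations at `s` is constantly κ h(s). By dominated convergence, with the
sum of the `dom` as bound, it is also the mean of the limit, and it is positive. -/
theorem not_ae_lim_nonpos {κ : ℝ} (hκ : 0 < κ) {s : ℝ} (hs : s ∈ Ioo (0 : ℝ) 1) :
    ¬ ∀ᵐ w ∂treeLaw, lim κ w s ≤ 0 := by
  intro h0
  have hs' := Ioo_subset_Icc_self hs
  have hd := measurable_dom κ
  have hb : Measurable fun w => ∑' n, ENNReal.ofReal (dom κ n w) :=
    Measurable.tsum fun n => (hd n).ennreal_ofReal
  have hint : Integrable (fun w => κ * hfun s + (∑' n, ENNReal.ofReal (dom κ n w)).toReal)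
      treeLaw :=
    (integrable_const _).add (integrable_toReal_of_lintegral_ne_top hb.aemeasurable
      (lintegral_tsum_dom_ne_top hκ.le))
  have hi : ∀ n, ∫ w, level κ n w s ∂treeLaw = κ * hfun s := by
    intro n
    simp only [level_eq_sum]
    rw [integral_add (integrable_const _)
      (integrable_finsetSum _ fun k _ => integrable_incr hκ.le k hs'),
      integral_finsetSum _ fun k _ => integrable_incr hκ.le k hs']
    simp [integral_incr hκ.le _ hs']
  have hconv := tendsto_integral_of_dominated_convergence (μ := treeLaw)
    (F := fun n w => level κ n w s) (f := fun w => lim κ w s) _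
    (fun n => ((measurable_level κ n).comp
      (measurable_id.prodMk measurable_const)).aestronglyMeasurable) hint ?_ ?_
  · simp only [hi] at hconv
    have h1 := tendsto_nhds_unique hconv tendsto_const_nhds
    have h2 := integral_nonpos_of_ae h0
    have h3 : 0 < hfun s := Real.rpow_pos_of_pos (mul_pos hs.1 (by linarith [hs.2])) _
    rw [h1] at h2
    exact h2.not_gt (mul_pos hκ h3)
  · intro n
    filter_upwards [ae_summable_dom hκ.le] with w ⟨hg, hw⟩
    have hnn : ∀ n, 0 ≤ dom κ n w := fun n =>
      (abs_nonneg _).trans ((abs_incr_le hκ.le hg n).1 0 (by simp))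
    rw [← ENNReal.ofReal_tsum_of_nonneg hnn hw, ENNReal.toReal_ofReal (tsum_nonneg hnn),
      level_eq_sum]
    refine (norm_add_le _ _).trans (add_le_add (le_of_eq ?_) ((norm_sum_le _ _).trans ?_))
    · exact Real.norm_of_nonneg (mul_nonneg hκ.le (hfun_nonneg hs'.1 hs'.2))
    · exact (Finset.sum_le_sum fun k _ => (abs_incr_le hκ.le hg k).1 s hs').trans
        (hw.sum_le_tsum _ fun k _ => hnn k)
  · filter_upwards [ae_nice hκ.le] with w hw using hw.2.2.tendsto_at hs'

/-! ## Minima of functions on the unit interval -/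

/-- The infimum of `f` between `s` and `t`, written as a countable infimum. -/
noncomputable def rmeet (f : ℝ → ℝ) (s t : ℝ) : ℝ :=
  ⨅ q : ℚ, f (s + max 0 (min (q : ℝ) 1) * (t - s))

theorem measurable_rmeet {α : Type*} [MeasurableSpace α] {f : α → ℝ → ℝ} {s t : α → ℝ}
    (hf : Measurable (Function.uncurry f)) (hs : Measurable s) (ht : Measurable t) :
    Measurable fun a => rmeet (f a) (s a) (t a) :=
  Measurable.iInf fun q => hf.comp (measurable_id.prodMk (by fun_prop))

section Rmeet

variable {f : ℝ → ℝ} {s t : ℝ}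

theorem uIcc_subset_unit (hs : s ∈ Icc (0 : ℝ) 1) (ht : t ∈ Icc (0 : ℝ) 1) :
    uIcc s t ⊆ Icc 0 1 := (convex_Icc (0 : ℝ) 1).ordConnected.uIcc_subset hs ht

/-- For continuous `f`, rational parameters are dense in the segment, so the countable infimum is
the attained minimum. The countable form is what makes `rmeet` jointly measurable. -/
theorem rmeet_spec (hf : ContinuousOn f (Icc 0 1)) (hs : s ∈ Icc (0 : ℝ) 1)
    (ht : t ∈ Icc (0 : ℝ) 1) :
    (∃ r ∈ uIcc s t, f r = rmeet f s t) ∧ ∀ r ∈ uIcc s t, rmeet f s t ≤ f r := by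
  have hsub := uIcc_subset_unit hs ht
  have hseg : ∀ x : ℝ, s + max 0 (min x 1) * (t - s) ∈ uIcc s t := by
    intro x
    have h0 : 0 ≤ max 0 (min x 1) := le_max_left _ _
    have h1 : max 0 (min x 1) ≤ 1 := max_le zero_le_one (min_le_right _ _)
    rw [mem_uIcc]
    rcases le_total s t with h | h
    · left
      constructor <;> nlinarith
    · right
      constructor <;> nlinarith
  have hG : Continuous fun x : ℝ => f (s + max 0 (min x 1) * (t - s)) :=
    hf.comp_continuous (by fun_prop) fun x => hsub (hseg x)
  obtain ⟨r, hr, hmin⟩ := isCompact_uIcc.exists_isMinOn (nonempty_uIcc (a := s) (b := t))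
    (hf.mono hsub)
  have hbdd : BddBelow (range fun q : ℚ => f (s + max 0 (min (q : ℝ) 1) * (t - s))) := by
    refine ⟨f r, ?_⟩
    rintro _ ⟨q, rfl⟩
    exact hmin (hseg q)
  have hle : ∀ x : ℝ, rmeet f s t ≤ f (s + max 0 (min x 1) * (t - s)) := by
    intro x
    have hc : IsClosed {x : ℝ | rmeet f s t ≤ f (s + max 0 (min x 1) * (t - s))} :=
      isClosed_le continuous_const hG
    have hd : Dense (range ((↑) : ℚ → ℝ)) := Rat.denseRange_cast
    have : closure (range ((↑) : ℚ → ℝ)) ⊆ _ := hc.closure_subset_iff.2 (by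
      rintro _ ⟨q, rfl⟩
      exact ciInf_le hbdd q)
    exact this (hd x)
  have hle' : ∀ y ∈ uIcc s t, rmeet f s t ≤ f y := by
    intro y hy
    rw [← segment_eq_uIcc, segment_eq_image'] at hy
    obtain ⟨x, ⟨hx0, hx1⟩, rfl⟩ := hy
    have := hle x
    rwa [min_eq_left hx1, max_eq_right hx0] at this
  refine ⟨⟨r, hr, le_antisymm (le_ciInf fun q => hmin (hseg q)) (hle' r hr)⟩, hle'⟩

theorem rmeet_eq (hf : ContinuousOn f (Icc 0 1)) (hs : s ∈ Icc (0 : ℝ) 1)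
    (ht : t ∈ Icc (0 : ℝ) 1) {c : ℝ} (h1 : ∃ r ∈ uIcc s t, f r = c) (h2 : ∀ r ∈ uIcc s t, c ≤ f r) :
    rmeet f s t = c := by
  obtain ⟨⟨r, hr, e⟩, h⟩ := rmeet_spec hf hs ht
  obtain ⟨r', hr', e'⟩ := h1
  exact le_antisymm (e' ▸ h r' hr') (e ▸ h2 r hr)

theorem rmeet_comm (hf : ContinuousOn f (Icc 0 1)) (hs : s ∈ Icc (0 : ℝ) 1)
    (ht : t ∈ Icc (0 : ℝ) 1) : rmeet f s t = rmeet f t s := by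
  obtain ⟨h1, h2⟩ := rmeet_spec hf ht hs
  rw [uIcc_comm] at h1 h2
  exact rmeet_eq hf hs ht h1 h2

end Rmeet

/-! ### Minima of a glued excursion -/

section GlueMeet

variable {l x : ℝ} {f₀ f₁ F : ℝ → ℝ}

/-- The position in the outer fragment. -/
noncomputable def base (l x r : ℝ) : ℝ :=
  if r < x * l then r / l else if r < x * l + 1 - l then x else (r - (1 - l)) / l

theorem monotone_base (hl : l ∈ Ioo (0 : ℝ) 1) : Monotone (base l x) := by
  obtain ⟨h0, h1⟩ := hl
  intro r r' h
  unfold base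
  split_ifs
  · gcongr
  · exact ((div_lt_iff₀ h0).2 (by assumption)).le
  · rw [div_le_div_iff_of_pos_right h0]
    linarith
  · linarith
  · exact le_rfl
  · rw [le_div_iff₀ h0]
    linarith
  · linarith
  · linarith
  · gcongr

theorem monotone_outer (hl : l ∈ Ioo (0 : ℝ) 1) : Monotone (outer l x) := by
  obtain ⟨h0, h1⟩ := hl
  intro s s' h
  unfold outer
  split_ifs <;> nlinarith

theorem base_outer (hl : l ∈ Ioo (0 : ℝ) 1) (s : ℝ) : base l x (outer l x s) = s := by
  obtain ⟨h0, h1⟩ := hl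
  unfold base outer
  by_cases h : s < x
  · rw [if_pos h, if_pos (by nlinarith), mul_div_cancel_left₀ _ h0.ne']
  · rw [if_neg h, if_neg (by nlinarith), if_neg (by nlinarith), add_sub_cancel_right,
      mul_div_cancel_left₀ _ h0.ne']

theorem base_inner (hl : l ∈ Ioo (0 : ℝ) 1) {s : ℝ} (hs : s ∈ Icc (0 : ℝ) 1) :
    base l x (inner l x s) = x := by
  obtain ⟨h0, h1⟩ := hl
  obtain ⟨h2, h3⟩ := hs
  unfold base inner
  rw [if_neg (by nlinarith)]
  split_ifs
  · rfl
  · have : s = 1 := by nlinarith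
    rw [this]
    field_simp
    ring

theorem outer_mem (hl : l ∈ Ioo (0 : ℝ) 1) {s : ℝ} (hs : s ∈ Icc (0 : ℝ) 1) :
    outer l x s ∈ Icc (0 : ℝ) 1 := by
  obtain ⟨h0, h1⟩ := hl
  obtain ⟨h2, h3⟩ := hs
  unfold outer
  split_ifs <;> constructor <;> nlinarith

theorem inner_mem (hl : l ∈ Ioo (0 : ℝ) 1) (hx : x ∈ Ioo (0 : ℝ) 1) {s : ℝ}
    (hs : s ∈ Icc (0 : ℝ) 1) : inner l x s ∈ Icc (0 : ℝ) 1 := by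
  obtain ⟨h0, h1⟩ := hl
  obtain ⟨h2, h3⟩ := hs
  obtain ⟨h4, h5⟩ := hx
  unfold inner
  constructor <;> nlinarith

theorem glue_outer (hl : l ∈ Ioo (0 : ℝ) 1) (s : ℝ) :
    glue (x * l, x * l + 1 - l) f₀ f₁ (outer l x s) = l ^ beta * f₀ s := by
  obtain ⟨h0, h1⟩ := hl
  rw [glue_chord, outer]
  by_cases h : s < x
  · rw [if_pos h, if_pos (by nlinarith), mul_div_cancel_left₀ _ h0.ne']
  · rw [if_neg h, if_neg (by nlinarith), if_neg (by nlinarith), add_sub_cancel_right,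
      mul_div_cancel_left₀ _ h0.ne']

theorem glue_inner (hl : l ∈ Ioo (0 : ℝ) 1) (h₁ : f₁ 1 = 0) {s : ℝ} (hs : s ∈ Icc (0 : ℝ) 1) :
    glue (x * l, x * l + 1 - l) f₀ f₁ (inner l x s) = l ^ beta * f₀ x + (1 - l) ^ beta * f₁ s := by
  obtain ⟨h0, h1⟩ := hl
  obtain ⟨h2, h3⟩ := hs
  have h4 : 1 - l ≠ 0 := by linarith
  rw [glue_chord, inner, if_neg (by nlinarith)]
  split_ifs
  · rw [mul_div_cancel_right₀ _ h0.ne', add_sub_cancel_left, mul_div_cancel_left₀ _ h4]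
  · have : s = 1 := by nlinarith
    rw [this, h₁, mul_zero, add_zero]
    congr 2
    field_simp
    ring

/-- `F` is the excursion obtained by gluing `f₁` to `f₀` at the point `x`, with an outer fragment
of mass `l`. -/
structure IsGlued (l x : ℝ) (f₀ f₁ F : ℝ → ℝ) : Prop where
  hl : l ∈ Ioo (0 : ℝ) 1
  hx : x ∈ Ioo (0 : ℝ) 1
  h₀ : IsExcursion f₀
  h₁ : IsExcursion f₁
  cont : ContinuousOn F (Icc 0 1)
  eq : ∀ s ∈ Icc (0 : ℝ) 1, F s = glue (x * l, x * l + 1 - l) f₀ f₁ s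

namespace IsGlued

theorem outer_eq (h : IsGlued l x f₀ f₁ F) {s : ℝ} (hs : s ∈ Icc (0 : ℝ) 1) :
    F (outer l x s) = l ^ beta * f₀ s := by
  rw [h.eq _ (outer_mem h.hl hs), glue_outer h.hl]

theorem inner_eq (h : IsGlued l x f₀ f₁ F) {s : ℝ} (hs : s ∈ Icc (0 : ℝ) 1) :
    F (inner l x s) = l ^ beta * f₀ x + (1 - l) ^ beta * f₁ s := by
  rw [h.eq _ (inner_mem h.hl h.hx hs), glue_inner h.hl h.h₁.one hs]

/-- Inside the chord the nonnegative inner excursion is added to the value at the foot; elsewhere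
there is equality. -/
theorem base_le (h : IsGlued l x f₀ f₁ F) {r : ℝ} (hr : r ∈ Icc (0 : ℝ) 1) :
    l ^ beta * f₀ (base l x r) ≤ F r := by
  have h2 : 0 < 1 - l := sub_pos.2 h.hl.2
  rw [h.eq r hr, glue_chord, base]
  split_ifs with a b
  · exact le_rfl
  · rw [mul_div_cancel_right₀ _ h.hl.1.ne']
    refine le_add_of_nonneg_right (mul_nonneg (Real.rpow_nonneg h2.le _) (h.h₁.nonneg _ ⟨?_, ?_⟩))
    · exact div_nonneg (by linarith) h2.le
    · rw [div_le_one h2]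
      linarith
  · exact le_rfl

theorem weight_pos (h : IsGlued l x f₀ f₁ F) : 0 < l ^ beta := Real.rpow_pos_of_pos h.hl.1 _

theorem weight_pos' (h : IsGlued l x f₀ f₁ F) : 0 < (1 - l) ^ beta :=
  Real.rpow_pos_of_pos (sub_pos.2 h.hl.2) _

theorem le_of_mem (h : IsGlued l x f₀ f₁ F) {a b r : ℝ} (ha : a ∈ Icc (0 : ℝ) 1)
    (hb : b ∈ Icc (0 : ℝ) 1) (ha' : base l x a ∈ Icc (0 : ℝ) 1) (hb' : base l x b ∈ Icc (0 : ℝ) 1)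
    (hr : r ∈ uIcc a b) : l ^ beta * rmeet f₀ (base l x a) (base l x b) ≤ F r :=
  (mul_le_mul_of_nonneg_left ((rmeet_spec h.h₀.continuousOn ha' hb').2 _
    ((monotone_base h.hl).mapsTo_uIcc hr)) h.weight_pos.le).trans
    (h.base_le (uIcc_subset_unit ha hb hr))

/-- Lower bound by projecting the interval monotonically to the outer fragment with `base`; upper
bound by lifting a minimizer with `outer`. The inserted inner fragment never lowers the minimum. -/
theorem rmeet_outer_outer (h : IsGlued l x f₀ f₁ F) {s t : ℝ} (hs : s ∈ Icc (0 : ℝ) 1)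
    (ht : t ∈ Icc (0 : ℝ) 1) :
    rmeet F (outer l x s) (outer l x t) = l ^ beta * rmeet f₀ s t := by
  have hos := outer_mem (x := x) h.hl hs
  have hot := outer_mem (x := x) h.hl ht
  refine rmeet_eq h.cont hos hot ?_ fun r hr => ?_
  · obtain ⟨r, hr, e⟩ := (rmeet_spec h.h₀.continuousOn hs ht).1
    refine ⟨outer l x r, (monotone_outer h.hl).mapsTo_uIcc hr, ?_⟩
    rw [h.outer_eq (uIcc_subset_unit hs ht hr), e]
  · have := h.le_of_mem hos hot (by rwa [base_outer h.hl]) (by rwa [base_outer h.hl]) hr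
    rwa [base_outer h.hl, base_outer h.hl] at this

/-- Seen from outside, the whole inner fragment sits at the foot `x`, so the inner point counts as
the foot. -/
theorem rmeet_outer_inner (h : IsGlued l x f₀ f₁ F) {s t : ℝ} (hs : s ∈ Icc (0 : ℝ) 1)
    (ht : t ∈ Icc (0 : ℝ) 1) :
    rmeet F (outer l x s) (inner l x t) = l ^ beta * rmeet f₀ s x := by
  have hx' := Ioo_subset_Icc_self h.hx
  have hos := outer_mem (x := x) h.hl hs
  have hit := inner_mem h.hl h.hx ht
  refine rmeet_eq h.cont hos hit ?_ fun r hr => ?_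
  · obtain ⟨r, hr, e⟩ := (rmeet_spec h.h₀.continuousOn hs hx').1
    -- `outer` sends `x` to the right end of the chord, which lies beyond the inner point when
    -- coming from the left. In that case the left end `inner l x 0`, of the same height, is used
    -- instead.
    by_cases hrx : r = x ∧ s < x
    · obtain ⟨rfl, hsr⟩ := hrx
      refine ⟨inner l r 0, mem_uIcc.2 (Or.inl ⟨?_, ?_⟩), ?_⟩
      · rw [outer, if_pos hsr, inner]
        nlinarith [h.hl.1]
      · unfold inner
        nlinarith [h.hl.2, ht.1]
      · rw [h.inner_eq (by simp), h.h₁.zero, e]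
        ring
    · refine ⟨outer l x r, ?_, by rw [h.outer_eq (uIcc_subset_unit hs hx' hr), e]⟩
      have hl0 := h.hl.1
      have hl1 := h.hl.2
      have ht0 := ht.1
      have ht1 := ht.2
      by_cases hsx : s < x
      · rw [uIcc_of_le hsx.le] at hr
        have hr' : r < x := lt_of_le_of_ne hr.2 fun h' => hrx ⟨h', hsx⟩
        refine mem_uIcc.2 (Or.inl ⟨(monotone_outer h.hl) hr.1, ?_⟩)
        rw [outer, if_pos hr', inner]
        nlinarith
      · rw [uIcc_of_ge (not_lt.1 hsx)] at hr
        refine mem_uIcc.2 (Or.inr ⟨?_, (monotone_outer h.hl) hr.2⟩)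
        rw [outer, if_neg hr.1.not_gt, inner]
        nlinarith [hr.1]
  · have := h.le_of_mem hos hit (by rwa [base_outer h.hl]) (by rwa [base_inner h.hl ht]) hr
    rwa [base_outer h.hl, base_inner h.hl ht] at this

theorem rmeet_inner_outer (h : IsGlued l x f₀ f₁ F) {s t : ℝ} (hs : s ∈ Icc (0 : ℝ) 1)
    (ht : t ∈ Icc (0 : ℝ) 1) :
    rmeet F (inner l x s) (outer l x t) = l ^ beta * rmeet f₀ x t := by
  rw [rmeet_comm h.cont (inner_mem h.hl h.hx hs) (outer_mem h.hl ht), h.rmeet_outer_inner ht hs,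
    rmeet_comm h.h₀.continuousOn ht (Ioo_subset_Icc_self h.hx)]

theorem rmeet_inner_inner (h : IsGlued l x f₀ f₁ F) {s t : ℝ} (hs : s ∈ Icc (0 : ℝ) 1)
    (ht : t ∈ Icc (0 : ℝ) 1) :
    rmeet F (inner l x s) (inner l x t) = l ^ beta * f₀ x + (1 - l) ^ beta * rmeet f₁ s t := by
  have hl1 : 0 < 1 - l := sub_pos.2 h.hl.2
  have himg : inner l x '' uIcc s t = uIcc (inner l x s) (inner l x t) := by
    have e : inner l x = (fun y => x * l + y) ∘ fun y => (1 - l) * y := rfl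
    rw [e, image_comp, image_const_mul_uIcc, image_const_add_uIcc]
    rfl
  obtain ⟨⟨r, hr, e⟩, hle⟩ := rmeet_spec h.h₁.continuousOn hs ht
  refine rmeet_eq h.cont (inner_mem h.hl h.hx hs) (inner_mem h.hl h.hx ht) ?_ ?_
  · refine ⟨inner l x r, himg ▸ mem_image_of_mem _ hr, ?_⟩
    rw [h.inner_eq (uIcc_subset_unit hs ht hr), e]
  · rw [← himg]
    rintro _ ⟨y, hy, rfl⟩
    rw [h.inner_eq (uIcc_subset_unit hs ht hy)]
    have := h.weight_pos'
    gcongr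
    exact hle y hy

end IsGlued

end GlueMeet

/-- Uniform convergence of the two halves passes through the gluing because the weights are at most
one. This gives continuity for every pair of nice families, without excluding a further null set. -/
theorem continuousOn_lim_join {κ : ℝ} (hκ : 0 ≤ κ) {p : ℝ × ℝ} (hp : p ∈ chords) {w₀ w₁ : Chords}
    (h₀ : Nice κ w₀) (h₁ : Nice κ w₁) : ContinuousOn (lim κ (join p w₀ w₁)) (Icc 0 1) := by
  have hg : Good (join p w₀ w₁) := by
    rintro (_ | ⟨_ | _, y⟩)
    · exact hp
    · exact h₀.1 y
    · exact h₁.1 y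
  have hu : TendstoUniformlyOn (fun n => level κ (n + 1) (join p w₀ w₁))
      (lim κ (join p w₀ w₁)) atTop (Icc 0 1) := by
    have u₀ := Metric.tendstoUniformlyOn_iff.1 h₀.2.2
    have u₁ := Metric.tendstoUniformlyOn_iff.1 h₁.2.2
    rw [Metric.tendstoUniformlyOn_iff]
    intro ε hε
    filter_upwards [u₀ (ε / 2) (by positivity), u₁ (ε / 2) (by positivity)] with n hn₀ hn₁ s hs
    obtain ⟨a0, a1, b0, b1⟩ := weights hp
    simp only [Real.dist_eq, abs_lt] at hn₀ hn₁
    rw [lim_join hp h₀ h₁ hs, level_join, Real.dist_eq, abs_lt]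
    rcases glue_cases hp hs with ⟨x, hx, h⟩ | ⟨y, hy, h⟩
    · rw [h, h]
      obtain ⟨c1, c2⟩ := hn₀ x hx
      constructor <;> nlinarith
    · rw [h, h]
      obtain ⟨c1, c2⟩ := hn₀ _ (Ioo_subset_Icc_self (foot_mem hp))
      obtain ⟨d1, d2⟩ := hn₁ y hy
      constructor <;> nlinarith
  exact hu.continuousOn (Frequently.of_forall fun n => (level_excursion hκ hg _).1.continuousOn)

/-- The limit is obtained by gluing the limits below the children of the root. -/
theorem isGlued_lim {κ l x : ℝ} (hκ : 0 ≤ κ) (hl : l ∈ Ioo (0 : ℝ) 1) (hx : x ∈ Ioo (0 : ℝ) 1)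
    {w₀ w₁ : Chords} (h₀ : Nice κ w₀) (h₁ : Nice κ w₁) :
    IsGlued l x (lim κ w₀) (lim κ w₁) (lim κ (join (x * l, x * l + 1 - l) w₀ w₁)) where
  hl := hl
  hx := hx
  h₀ := h₀.2.1
  h₁ := h₁.2.1
  cont := continuousOn_lim_join hκ (chord_mem hl hx) h₀ h₁
  eq := fun _ hs => lim_join (chord_mem hl hx) h₀ h₁ hs

/-! ## Recursions for probabilities of events that involve uniform points -/

/-- The uniform law on the unit interval. -/
noncomputable def unif : Measure ℝ := volume.restrict (Ioo 0 1)

instance : IsProbabilityMeasure unif := ⟨by simp [unif]⟩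

theorem ae_unif_mem : ∀ᵐ s ∂unif, s ∈ Ioo (0 : ℝ) 1 := ae_restrict_mem measurableSet_Ioo

/-- How almost sure statements about uniform points are used: nested applications pick generic
points in prescribed gaps. -/
theorem exists_mem_of_ae_unif {P : ℝ → Prop} (h : ∀ᵐ s ∂unif, P s) {a b : ℝ} (ha : 0 ≤ a)
    (hab : a < b) (hb : b ≤ 1) : ∃ s ∈ Ioo a b, P s := by
  by_contra! h'
  have h2 : unif (Ioo a b) = 0 := measure_mono_null (fun s hs => h' s hs) (ae_iff.1 h)
  rw [unif, Measure.restrict_apply measurableSet_Ioo,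
    inter_eq_left.2 (Ioo_subset_Ioo ha hb), Real.volume_Ioo] at h2
  simp only [ENNReal.ofReal_eq_zero] at h2
  linarith

/-- The triple integral over uniform points. -/
noncomputable def triple (T : ℝ → ℝ → ℝ → ℝ≥0∞) : ℝ≥0∞ :=
  ∫⁻ s, ∫⁻ t, ∫⁻ r, T s t r ∂unif ∂unif ∂unif

theorem measurable_lintegral_unif {α : Type*} [MeasurableSpace α] {f : α → ℝ → ℝ≥0∞}
    (hf : Measurable fun q : α × ℝ => f q.1 q.2) : Measurable fun a => ∫⁻ r, f a r ∂unif :=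
  Measurable.lintegral_prod_right' hf

theorem measurable_double {α : Type*} [MeasurableSpace α] {f : α → ℝ → ℝ → ℝ≥0∞}
    (hf : Measurable fun q : α × ℝ × ℝ => f q.1 q.2.1 q.2.2) :
    Measurable fun a => ∫⁻ t, ∫⁻ r, f a t r ∂unif ∂unif :=
  measurable_lintegral_unif (measurable_lintegral_unif (α := α × ℝ)
    (f := fun q r => f q.1 q.2 r) (hf.comp (by fun_prop :
      Measurable fun q : (α × ℝ) × ℝ => (q.1.1, q.1.2, q.2))))

theorem measurable_triple {α : Type*} [MeasurableSpace α] {T : α → ℝ → ℝ → ℝ → ℝ≥0∞}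
    (hT : Measurable fun q : α × ℝ × ℝ × ℝ => T q.1 q.2.1 q.2.2.1 q.2.2.2) :
    Measurable fun a => triple (T a) :=
  measurable_lintegral_unif (measurable_double (α := α × ℝ)
    (f := fun q t r => T q.1 q.2 t r) (hT.comp (by fun_prop :
      Measurable fun q : (α × ℝ) × ℝ × ℝ => (q.1.1, q.1.2, q.2))))

theorem triple_mono {T T' : ℝ → ℝ → ℝ → ℝ≥0∞}
    (h : ∀ s ∈ Ioo (0 : ℝ) 1, ∀ t ∈ Ioo (0 : ℝ) 1, ∀ r ∈ Ioo (0 : ℝ) 1, T s t r ≤ T' s t r) :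
    triple T ≤ triple T' :=
  lintegral_mono_ae (ae_unif_mem.mono fun s hs => lintegral_mono_ae (ae_unif_mem.mono fun t ht =>
    lintegral_mono_ae (ae_unif_mem.mono fun r hr => h s hs t ht r hr)))

/-- The parametrizations of the two fragments. -/
noncomputable def piece (c : Bool) (l x : ℝ) : ℝ → ℝ := if c then inner l x else outer l x

/-- The masses of the two fragments. -/
noncomputable def wt (c : Bool) (l : ℝ) : ℝ≥0∞ := if c then ENNReal.ofReal (1 - l) else ENNReal.ofReal l

theorem measurable_piece (c : Bool) (l x : ℝ) : Measurable (piece c l x) := by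
  unfold piece
  split_ifs
  · exact measurable_inner.comp (by fun_prop : Measurable fun s : ℝ => (l, x, s))
  · exact measurable_outer.comp (by fun_prop : Measurable fun s : ℝ => (l, x, s))

theorem measurable_wt (c : Bool) : Measurable (wt c) := by
  unfold wt
  split_ifs <;> fun_prop

theorem lintegral_unif_split {l x : ℝ} (hl : l ∈ Ioo (0 : ℝ) 1) (hx : x ∈ Ioo (0 : ℝ) 1)
    {k : ℝ → ℝ≥0∞} (hk : Measurable k) :
    ∫⁻ s, k s ∂unif = ∑ c : Bool, wt c l * ∫⁻ s, k (piece c l x s) ∂unif := by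
  rw [Fintype.sum_bool, add_comm]
  exact lintegral_split hl hx hk

/-- The product of the masses of three fragments. -/
noncomputable def wt₃ (i : Bool × Bool × Bool) (l : ℝ) : ℝ≥0∞ := wt i.1 l * (wt i.2.1 l * wt i.2.2 l)

theorem measurable_wt₃ (i : Bool × Bool × Bool) : Measurable (wt₃ i) :=
  (measurable_wt _).mul ((measurable_wt _).mul (measurable_wt _))

theorem double_split {l x : ℝ} (hl : l ∈ Ioo (0 : ℝ) 1) (hx : x ∈ Ioo (0 : ℝ) 1)
    {k : ℝ → ℝ → ℝ≥0∞} (hk : Measurable fun q : ℝ × ℝ => k q.1 q.2) :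
    ∫⁻ s, ∫⁻ t, k s t ∂unif ∂unif = ∑ i : Bool × Bool, wt i.1 l * wt i.2 l *
      ∫⁻ s, ∫⁻ t, k (piece i.1 l x s) (piece i.2 l x t) ∂unif ∂unif := by
  have hp := fun c => measurable_piece c l x
  rw [lintegral_unif_split hl hx (measurable_lintegral_unif hk), Fintype.sum_prod_type]
  refine Finset.sum_congr rfl fun c _ => ?_
  have e : ∀ s, ∫⁻ t, k (piece c l x s) t ∂unif =
      ∑ d : Bool, wt d l * ∫⁻ t, k (piece c l x s) (piece d l x t) ∂unif := fun s =>
    lintegral_unif_split hl hx (hk.comp (by fun_prop : Measurable fun t : ℝ => (piece c l x s, t)))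
  have hm : ∀ d, Measurable fun s => ∫⁻ t, k (piece c l x s) (piece d l x t) ∂unif := fun d =>
    measurable_lintegral_unif (hk.comp (((hp c).comp measurable_fst).prodMk
      ((hp d).comp measurable_snd)))
  simp only [e]
  rw [lintegral_finsetSum _ fun d _ => (hm d).const_mul _, Finset.mul_sum]
  refine Finset.sum_congr rfl fun d _ => ?_
  rw [lintegral_const_mul _ (hm d), mul_assoc]

theorem triple_split {l x : ℝ} (hl : l ∈ Ioo (0 : ℝ) 1) (hx : x ∈ Ioo (0 : ℝ) 1)
    {T : ℝ → ℝ → ℝ → ℝ≥0∞} (hT : Measurable fun q : ℝ × ℝ × ℝ => T q.1 q.2.1 q.2.2) :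
    triple T = ∑ i : Bool × Bool × Bool, wt₃ i l *
      triple fun s t r => T (piece i.1 l x s) (piece i.2.1 l x t) (piece i.2.2 l x r) := by
  have hp := fun c => measurable_piece c l x
  rw [triple, lintegral_unif_split hl hx (measurable_double hT),
    Fintype.sum_prod_type (f := fun i : Bool × Bool × Bool => wt₃ i l *
      triple fun s t r => T (piece i.1 l x s) (piece i.2.1 l x t) (piece i.2.2 l x r))]
  refine Finset.sum_congr rfl fun c _ => ?_
  have e : ∀ s, ∫⁻ t, ∫⁻ r, T (piece c l x s) t r ∂unif ∂unif =
      ∑ i : Bool × Bool, wt i.1 l * wt i.2 l *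
        ∫⁻ t, ∫⁻ r, T (piece c l x s) (piece i.1 l x t) (piece i.2 l x r) ∂unif ∂unif := fun s =>
    double_split hl hx (hT.comp (by fun_prop : Measurable fun q : ℝ × ℝ => (piece c l x s, q)))
  have hm : ∀ i : Bool × Bool, Measurable fun s =>
      ∫⁻ t, ∫⁻ r, T (piece c l x s) (piece i.1 l x t) (piece i.2 l x r) ∂unif ∂unif := fun i =>
    measurable_double (hT.comp (((hp c).comp measurable_fst).prodMk
      (((hp i.1).comp measurable_snd.fst).prodMk ((hp i.2).comp measurable_snd.snd))))
  simp only [e]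
  rw [lintegral_finsetSum _ fun i _ => (hm i).const_mul _, Finset.mul_sum]
  refine Finset.sum_congr rfl fun i _ => ?_
  rw [lintegral_const_mul _ (hm i), ← mul_assoc]
  rfl

/-- The probability that three uniform points fall into given fragments. -/
noncomputable def wtInt (i : Bool × Bool × Bool) : ℝ≥0∞ := ∫⁻ l, ENNReal.ofReal (2 * l) * wt₃ i l ∂unif

theorem measurable_mul_wt₃ (i : Bool × Bool × Bool) :
    Measurable fun l => ENNReal.ofReal (2 * l) * wt₃ i l :=
  Measurable.mul (by fun_prop) (measurable_wt₃ i)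

theorem sum_wtInt : ∑ i, wtInt i = 1 := by
  have h : ∀ l ∈ Ioo (0 : ℝ) 1, ∑ i, wt₃ i l = 1 := by
    intro l hl
    have h1 : ∑ c : Bool, wt c l = 1 := by
      rw [Fintype.sum_bool]
      change ENNReal.ofReal (1 - l) + ENNReal.ofReal l = 1
      rw [← ENNReal.ofReal_add (by linarith [hl.2]) hl.1.le]
      simp
    simp only [wt₃, Fintype.sum_prod_type, ← Finset.mul_sum, h1, mul_one]
  unfold wtInt
  rw [← lintegral_finsetSum _ fun i _ => measurable_mul_wt₃ i]
  simp only [← Finset.mul_sum]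
  rw [lintegral_congr_ae (g := fun l => ENNReal.ofReal (2 * l))
    (ae_unif_mem.mono fun l hl => by simp only [h l hl, mul_one])]
  exact lintegral_two_mul_Ioo

theorem wtInt_ne_top (i : Bool × Bool × Bool) : wtInt i ≠ ⊤ := by
  refine ne_top_of_le_ne_top ENNReal.one_ne_top (sum_wtInt ▸ ?_)
  exact Finset.single_le_sum (f := wtInt) (fun _ _ => zero_le) (Finset.mem_univ i)

theorem wtInt_ne_zero (i : Bool × Bool × Bool) : wtInt i ≠ 0 := by
  intro h
  rw [wtInt, lintegral_eq_zero_iff (measurable_mul_wt₃ i)] at h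
  have hf : ∀ᵐ _ ∂unif, False := by
    filter_upwards [h, ae_unif_mem] with l h1 h2
    have hw : ∀ c, wt c l ≠ 0 := by
      intro c
      unfold wt
      split_ifs
      · exact (ENNReal.ofReal_pos.2 (sub_pos.2 h2.2)).ne'
      · exact (ENNReal.ofReal_pos.2 h2.1).ne'
    refine mul_ne_zero (ENNReal.ofReal_pos.2 (by linarith [h2.1])).ne' ?_ h1
    exact mul_ne_zero (hw _) (mul_ne_zero (hw _) (hw _))
  rw [ae_iff] at hf
  simp at hf

/-- Bound for the expectation of a functional of three uniform points, obtained by conditioning on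
the root chord and on the fragments that contain the points. -/
theorem lintegral_triple_le {T : Chords → ℝ → ℝ → ℝ → ℝ≥0∞}
    (hT : Measurable fun q : Chords × ℝ × ℝ × ℝ => T q.1 q.2.1 q.2.2.1 q.2.2.2)
    {C : Bool × Bool × Bool → ℝ → ℝ≥0∞} (hC : ∀ i, Measurable (C i))
    (h : ∀ l ∈ Ioo (0 : ℝ) 1, ∀ x ∈ Ioo (0 : ℝ) 1, ∀ i : Bool × Bool × Bool,
      ∫⁻ w₀, ∫⁻ w₁, triple (fun s t r => T (join (x * l, x * l + 1 - l) w₀ w₁)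
        (piece i.1 l x s) (piece i.2.1 l x t) (piece i.2.2 l x r)) ∂treeLaw ∂treeLaw ≤ C i x) :
    ∫⁻ w, triple (T w) ∂treeLaw ≤ ∑ i, wtInt i * ∫⁻ x, C i x ∂unif := by
  have hH := measurable_triple hT
  have hm1 : Measurable fun q : ((ℝ × ℝ) × Chords) × Chords => triple (T (join q.1.1 q.1.2 q.2)) :=
    hH.comp (measurable_join.comp (by fun_prop :
      Measurable fun q : ((ℝ × ℝ) × Chords) × Chords => (q.1.1, q.1.2, q.2)))
  have hm2 : Measurable fun q : (ℝ × ℝ) × Chords => ∫⁻ w₁, triple (T (join q.1 q.2 w₁)) ∂treeLaw :=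
    hm1.lintegral_prod_right'
  have hm3 : Measurable fun p => ∫⁻ w₀, ∫⁻ w₁, triple (T (join p w₀ w₁)) ∂treeLaw ∂treeLaw :=
    hm2.lintegral_prod_right'
  rw [lintegral_treeLaw hH, lintegral_chordLaw hm3]
  have key : ∀ l ∈ Ioo (0 : ℝ) 1, ∀ x ∈ Ioo (0 : ℝ) 1,
      ∫⁻ w₀, ∫⁻ w₁, triple (T (join (x * l, x * l + 1 - l) w₀ w₁)) ∂treeLaw ∂treeLaw ≤
      ∑ i, wt₃ i l * C i x := by
    intro l hl x hx
    set p : ℝ × ℝ := (x * l, x * l + 1 - l) with hp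
    have hpc := fun c => measurable_piece c l x
    have hTw : ∀ w, Measurable fun q : ℝ × ℝ × ℝ => T w q.1 q.2.1 q.2.2 := fun w =>
      hT.comp (by fun_prop : Measurable fun q : ℝ × ℝ × ℝ => (w, q))
    have n1 : ∀ i : Bool × Bool × Bool, Measurable fun q : Chords × Chords =>
        triple fun s t r => T (join p q.1 q.2)
          (piece i.1 l x s) (piece i.2.1 l x t) (piece i.2.2 l x r) := by
      intro i
      refine measurable_triple (T := fun (q : Chords × Chords) s t r => T (join p q.1 q.2)
          (piece i.1 l x s) (piece i.2.1 l x t) (piece i.2.2 l x r)) ?_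
      have m : Measurable fun q : (Chords × Chords) × ℝ × ℝ × ℝ => (join p q.1.1 q.1.2,
          piece i.1 l x q.2.1, piece i.2.1 l x q.2.2.1, piece i.2.2 l x q.2.2.2) := by
        refine (measurable_join.comp (by fun_prop : Measurable
          fun q : (Chords × Chords) × ℝ × ℝ × ℝ => (p, q.1.1, q.1.2))).prodMk ?_
        exact ((hpc _).comp measurable_snd.fst).prodMk
          (((hpc _).comp measurable_snd.snd.fst).prodMk ((hpc _).comp measurable_snd.snd.snd))
      exact hT.comp m
    have n2 : ∀ (i : Bool × Bool × Bool) (w₀ : Chords), Measurable fun w₁ : Chords =>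
        triple fun s t r => T (join p w₀ w₁)
          (piece i.1 l x s) (piece i.2.1 l x t) (piece i.2.2 l x r) := fun i w₀ =>
      (n1 i).comp (by fun_prop : Measurable fun w₁ : Chords => (w₀, w₁))
    simp only [triple_split hl hx (hTw _)]
    simp only [lintegral_finsetSum _ fun (i : Bool × Bool × Bool) _ => (n2 i _).const_mul (wt₃ i l),
      lintegral_const_mul _ (n2 _ _)]
    rw [lintegral_finsetSum _ fun i _ => (n1 i).lintegral_prod_right'.const_mul _]
    refine Finset.sum_le_sum fun i _ => ?_
    rw [lintegral_const_mul _ (n1 i).lintegral_prod_right']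
    gcongr
    exact h l hl x hx i
  calc _ ≤ ∫⁻ l, ENNReal.ofReal (2 * l) * ∫⁻ x, ∑ i, wt₃ i l * C i x ∂unif ∂unif := by
        refine lintegral_mono_ae (ae_unif_mem.mono fun l hl => ?_)
        refine mul_le_mul' le_rfl ?_
        exact lintegral_mono_ae (ae_unif_mem.mono fun x hx => key l hl x hx)
    _ = ∫⁻ l, ∑ i, ENNReal.ofReal (2 * l) * wt₃ i l * ∫⁻ x, C i x ∂unif ∂unif := by
        refine lintegral_congr fun l => ?_
        rw [lintegral_finsetSum _ fun i _ => (hC i).const_mul _, Finset.mul_sum]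
        refine Finset.sum_congr rfl fun i _ => ?_
        rw [lintegral_const_mul _ (hC i), mul_assoc]
    _ = _ := by
        rw [lintegral_finsetSum _ fun i _ => (measurable_mul_wt₃ i).mul_const _]
        refine Finset.sum_congr rfl fun i _ => ?_
        rw [lintegral_mul_const _ (measurable_mul_wt₃ i), wtInt]

/-- If conditioning on the fragments does not increase the expectation, and decreases it in one
case, then the expectation vanishes. -/
theorem lintegral_triple_eq_zero {T : Chords → ℝ → ℝ → ℝ → ℝ≥0∞}
    (hT : Measurable fun q : Chords × ℝ × ℝ × ℝ => T q.1 q.2.1 q.2.2.1 q.2.2.2)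
    (hT1 : ∀ w s t r, T w s t r ≤ 1)
    {C : Bool × Bool × Bool → ℝ → ℝ≥0∞} (hC : ∀ i, Measurable (C i))
    (h : ∀ l ∈ Ioo (0 : ℝ) 1, ∀ x ∈ Ioo (0 : ℝ) 1, ∀ i : Bool × Bool × Bool,
      ∫⁻ w₀, ∫⁻ w₁, triple (fun s t r => T (join (x * l, x * l + 1 - l) w₀ w₁)
        (piece i.1 l x s) (piece i.2.1 l x t) (piece i.2.2 l x r)) ∂treeLaw ∂treeLaw ≤ C i x)
    (hle : ∀ i, ∫⁻ x, C i x ∂unif ≤ ∫⁻ w, triple (T w) ∂treeLaw) (j : Bool × Bool × Bool)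
    {θ : ℝ≥0∞} (hθ : θ < 1) (hj : ∫⁻ x, C j x ∂unif ≤ θ * ∫⁻ w, triple (T w) ∂treeLaw) :
    ∫⁻ w, triple (T w) ∂treeLaw = 0 := by
  have hrec := lintegral_triple_le hT hC h
  set e := ∫⁻ w, triple (T w) ∂treeLaw with he
  have he1 : e ≤ 1 := by
    calc e ≤ ∫⁻ _ : Chords, triple (fun _ _ _ => 1) ∂treeLaw :=
          lintegral_mono fun w => triple_mono fun s _ t _ r _ => hT1 w s t r
      _ = 1 := by simp [triple]
  have hetop : e ≠ ⊤ := ne_top_of_le_ne_top ENNReal.one_ne_top he1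
  by_contra hne
  -- The same quantity is split with the total mass one of the cases. Comparing with the recursion
  -- cancels all cases but `j`, which leaves e ≤ θ e with `e` finite.
  have e1 : e = wtInt j * e + ∑ i ∈ Finset.univ.erase j, wtInt i * e := by
    rw [Finset.add_sum_erase _ (fun i => wtInt i * e) (Finset.mem_univ j), ← Finset.sum_mul,
      sum_wtInt, one_mul]
  have e2 : e ≤ wtInt j * (θ * e) + ∑ i ∈ Finset.univ.erase j, wtInt i * e := by
    refine hrec.trans ?_
    rw [← Finset.add_sum_erase _ (fun i => wtInt i * _) (Finset.mem_univ j)]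
    gcongr with i
    exact hle i
  have hR : ∑ i ∈ Finset.univ.erase j, wtInt i * e ≠ ⊤ :=
    (ENNReal.sum_lt_top.2 fun i _ => (ENNReal.mul_lt_top (wtInt_ne_top i).lt_top hetop.lt_top)).ne
  have e3 : wtInt j * e ≤ wtInt j * (θ * e) := by
    exact ENNReal.le_of_add_le_add_right hR (e1.symm.trans_le e2)
  have e4 : e ≤ θ * e := (ENNReal.mul_le_mul_iff_right (wtInt_ne_zero j) (wtInt_ne_top j)).1 e3
  have e5 : θ * e < 1 * e := (ENNReal.mul_lt_mul_iff_left hne hetop).2 hθ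
  rw [one_mul] at e5
  exact e4.not_gt e5

/-! ## Null events -/

open Classical in
/-- The indicator of a proposition. -/
noncomputable def ind (p : Prop) : ℝ≥0∞ := if p then 1 else 0

theorem ind_le_one (p : Prop) : ind p ≤ 1 := by
  unfold ind
  split_ifs <;> simp

theorem ind_mono {p q : Prop} (h : p → q) : ind p ≤ ind q := by
  by_cases hp : p
  · simp [ind, hp, h hp]
  · simp [ind, hp]

theorem ind_ne_top (p : Prop) : ind p ≠ ⊤ := ne_top_of_le_ne_top ENNReal.one_ne_top (ind_le_one p)

theorem ind_and (p q : Prop) : ind (p ∧ q) = ind p * ind q := by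
  by_cases hp : p <;> by_cases hq : q <;> simp [ind, hp, hq]

theorem ind_eq_zero {p : Prop} : ind p = 0 ↔ ¬ p := by simp [ind]

theorem measurable_ind {α : Type*} [MeasurableSpace α] {p : α → Prop}
    (hp : MeasurableSet {a | p a}) : Measurable fun a => ind (p a) := by
  unfold ind
  exact Measurable.ite hp measurable_const measurable_const

theorem ae_of_lintegral_triple_ind {A : Chords → ℝ → ℝ → ℝ → Prop}
    (hA : MeasurableSet {q : Chords × ℝ × ℝ × ℝ | A q.1 q.2.1 q.2.2.1 q.2.2.2})
    (h : ∫⁻ w, triple (fun s t r => ind (A w s t r)) ∂treeLaw = 0) :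
    ∀ᵐ w ∂treeLaw, ∀ᵐ s ∂unif, ∀ᵐ t ∂unif, ∀ᵐ r ∂unif, ¬ A w s t r := by
  have hT := measurable_ind hA
  rw [lintegral_eq_zero_iff (measurable_triple (T := fun w s t r => ind (A w s t r)) hT)] at h
  filter_upwards [h] with w hw
  have hT₁ : Measurable fun q : ℝ × ℝ × ℝ => ind (A w q.1 q.2.1 q.2.2) :=
    hT.comp (by fun_prop : Measurable fun q : ℝ × ℝ × ℝ => (w, q))
  have hw' : triple (fun s t r => ind (A w s t r)) = 0 := hw
  rw [triple, lintegral_eq_zero_iff (measurable_double (f := fun s t r => ind (A w s t r)) hT₁)]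
    at hw'
  filter_upwards [hw'] with s hs
  have hT₂ : Measurable fun q : ℝ × ℝ => ind (A w s q.1 q.2) :=
    hT₁.comp (by fun_prop : Measurable fun q : ℝ × ℝ => (s, q))
  have hs' : ∫⁻ t, ∫⁻ r, ind (A w s t r) ∂unif ∂unif = 0 := hs
  rw [lintegral_eq_zero_iff (measurable_lintegral_unif (f := fun t r => ind (A w s t r)) hT₂)]
    at hs'
  filter_upwards [hs'] with t ht
  have ht' : ∫⁻ r, ind (A w s t r) ∂unif = 0 := ht
  have hT₃ : Measurable fun r => ind (A w s t r) :=
    hT₂.comp (by fun_prop : Measurable fun r : ℝ => (t, r))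
  rw [lintegral_eq_zero_iff hT₃] at ht'
  filter_upwards [ht'] with r hr
  exact ind_eq_zero.1 hr

/-- When the three points lie in the fragments given by `i`, the event `A` implies `B`. -/
def Reduces (N : Chords → Prop) (A : Chords → ℝ → ℝ → ℝ → Prop) (i : Bool × Bool × Bool)
    (B : ℝ → Chords → Chords → ℝ → ℝ → ℝ → Prop) : Prop :=
  ∀ l ∈ Ioo (0 : ℝ) 1, ∀ x ∈ Ioo (0 : ℝ) 1, ∀ w₀, N w₀ → ∀ w₁, N w₁ → ∀ s ∈ Ioo (0 : ℝ) 1,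
    ∀ t ∈ Ioo (0 : ℝ) 1, ∀ r ∈ Ioo (0 : ℝ) 1, A (join (x * l, x * l + 1 - l) w₀ w₁)
      (piece i.1 l x s) (piece i.2.1 l x t) (piece i.2.2 l x r) → B x w₀ w₁ s t r

/-- An event for three uniform points, which is reduced to itself whatever the fragments that
contain the points, is null if one of the reductions has a loss. -/
theorem ae_not_of_reduces {N : Chords → Prop} (hN : ∀ᵐ w ∂treeLaw, N w)
    {A : Chords → ℝ → ℝ → ℝ → Prop}
    (hA : MeasurableSet {q : Chords × ℝ × ℝ × ℝ | A q.1 q.2.1 q.2.2.1 q.2.2.2})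
    {Q : Chords → ℝ → Prop} (hQ : MeasurableSet {q : Chords × ℝ | Q q.1 q.2})
    (hQ1 : ∫⁻ x, ∫⁻ w, ind (Q w x) ∂treeLaw ∂unif < 1) (j : Bool × Bool × Bool)
    (hj : Reduces N A j fun x w₀ w₁ s t r => Q w₀ x ∧ A w₁ s t r)
    (hi : ∀ i, i ≠ j → (Reduces N A i fun _ w₀ _ s t r => A w₀ s t r) ∨
      (Reduces N A i fun _ _ w₁ s t r => A w₁ s t r) ∨
      (Reduces N A i fun x w₀ _ _ t r => A w₀ x t r) ∨
      (Reduces N A i fun x w₀ _ s _ r => A w₀ x s r) ∨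
      (Reduces N A i fun x w₀ _ s t _ => A w₀ x s t)) :
    ∀ᵐ w ∂treeLaw, ∀ᵐ s ∂unif, ∀ᵐ t ∂unif, ∀ᵐ r ∂unif, ¬ A w s t r := by
  refine ae_of_lintegral_triple_ind hA ?_
  have hT := measurable_ind hA
  have key : ∀ {i B}, Reduces N A i B → ∀ l ∈ Ioo (0 : ℝ) 1, ∀ x ∈ Ioo (0 : ℝ) 1,
      ∫⁻ w₀, ∫⁻ w₁, triple (fun s t r => ind (A (join (x * l, x * l + 1 - l) w₀ w₁)
        (piece i.1 l x s) (piece i.2.1 l x t) (piece i.2.2 l x r))) ∂treeLaw ∂treeLaw ≤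
      ∫⁻ w₀, ∫⁻ w₁, triple (fun s t r => ind (B x w₀ w₁ s t r)) ∂treeLaw ∂treeLaw := by
    intro i B hB l hl x hx
    refine lintegral_mono_ae (hN.mono fun w₀ h₀ => lintegral_mono_ae (hN.mono fun w₁ h₁ => ?_))
    exact triple_mono fun s hs t ht r hr => ind_mono (hB l hl x hx w₀ h₀ w₁ h₁ s hs t ht r hr)
  set e := ∫⁻ w, triple (fun s t r => ind (A w s t r)) ∂treeLaw with he
  have he1 : e ≤ 1 := by
    calc e ≤ ∫⁻ _ : Chords, triple (fun _ _ _ => 1) ∂treeLaw :=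
          lintegral_mono fun w => triple_mono fun s _ t _ r _ => ind_le_one _
      _ = 1 := by simp [triple]
  have hetop : e ≠ ⊤ := ne_top_of_le_ne_top ENNReal.one_ne_top he1
  have hD : Measurable fun q : Chords × ℝ => ∫⁻ t, ∫⁻ r, ind (A q.1 q.2 t r) ∂unif ∂unif :=
    measurable_double (f := fun (q : Chords × ℝ) t r => ind (A q.1 q.2 t r))
      (hT.comp (by fun_prop : Measurable fun q : (Chords × ℝ) × ℝ × ℝ => (q.1.1, q.1.2, q.2)))
  have hDs : Measurable fun x : ℝ =>
      ∫⁻ w, ∫⁻ t, ∫⁻ r, ind (A w x t r) ∂unif ∂unif ∂treeLaw := hD.lintegral_prod_left'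
  -- The foot is uniform on the outer fragment, so an event with the foot as one of its three points
  -- has the original probability.
  have hswap : ∫⁻ x, ∫⁻ w, ∫⁻ t, ∫⁻ r, ind (A w x t r) ∂unif ∂unif ∂treeLaw ∂unif = e :=
    (lintegral_lintegral_swap (f := fun w x => ∫⁻ t, ∫⁻ r, ind (A w x t r) ∂unif ∂unif)
      hD.aemeasurable).symm
  have hQm := measurable_ind hQ
  have hQs : Measurable fun x : ℝ => ∫⁻ w, ind (Q w x) ∂treeLaw := hQm.lintegral_prod_left'
  set θ := ∫⁻ x, ∫⁻ w, ind (Q w x) ∂treeLaw ∂unif with hθ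
  have hex : ∀ i, ∃ C : ℝ → ℝ≥0∞, Measurable C ∧ (∀ l ∈ Ioo (0 : ℝ) 1, ∀ x ∈ Ioo (0 : ℝ) 1,
      ∫⁻ w₀, ∫⁻ w₁, triple (fun s t r => ind (A (join (x * l, x * l + 1 - l) w₀ w₁)
        (piece i.1 l x s) (piece i.2.1 l x t) (piece i.2.2 l x r))) ∂treeLaw ∂treeLaw ≤ C x) ∧
      ∫⁻ x, C x ∂unif ≤ e ∧ (i = j → ∫⁻ x, C x ∂unif ≤ θ * e) := by
    intro i
    by_cases hij : i = j
    · subst hij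
      have h1 : ∫⁻ x, (∫⁻ w, ind (Q w x) ∂treeLaw) * e ∂unif = θ * e := lintegral_mul_const _ hQs
      refine ⟨fun x => (∫⁻ w, ind (Q w x) ∂treeLaw) * e, hQs.mul_const _, fun l hl x hx =>
        (key hj l hl x hx).trans (le_of_eq ?_), ?_, fun _ => h1.le⟩
      -- The two subfamilies are independent, so the probability of the conjunction factors. The
      -- loss comes from the condition on the outer fragment.
      · have h2 : ∀ w₀ w₁, triple (fun s t r => ind (Q w₀ x ∧ A w₁ s t r)) =
            ind (Q w₀ x) * triple (fun s t r => ind (A w₁ s t r)) := by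
          intro w₀ w₁
          simp only [triple, ind_and, lintegral_const_mul' _ _ (ind_ne_top (Q w₀ x))]
        simp only [h2, lintegral_const_mul' _ _ (ind_ne_top (Q _ x))]
        rw [lintegral_mul_const' _ _ hetop]
      · rw [h1]
        exact mul_le_of_le_one_left' hQ1.le
    · have hdrop : ∀ {B : ℝ → Chords → Chords → ℝ → ℝ → ℝ → Prop}, Reduces N A i B →
          (∀ x, ∫⁻ w₀, ∫⁻ w₁, triple (fun s t r => ind (B x w₀ w₁ s t r)) ∂treeLaw ∂treeLaw =
            ∫⁻ w, ∫⁻ t, ∫⁻ r, ind (A w x t r) ∂unif ∂unif ∂treeLaw) → _ := fun {B} hB hx =>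
        (⟨_, hDs, fun l hl x hx' => (key hB l hl x hx').trans_eq (hx x), hswap.le,
          fun h => absurd h hij⟩ : ∃ C : ℝ → ℝ≥0∞, Measurable C ∧
          (∀ l ∈ Ioo (0 : ℝ) 1, ∀ x ∈ Ioo (0 : ℝ) 1,
          ∫⁻ w₀, ∫⁻ w₁, triple (fun s t r => ind (A (join (x * l, x * l + 1 - l) w₀ w₁)
            (piece i.1 l x s) (piece i.2.1 l x t) (piece i.2.2 l x r))) ∂treeLaw ∂treeLaw ≤ C x) ∧
          ∫⁻ x, C x ∂unif ≤ e ∧ (i = j → ∫⁻ x, C x ∂unif ≤ θ * e))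
      rcases hi i hij with h | h | h | h | h
      · refine ⟨fun _ => e, measurable_const, fun l hl x hx => (key h l hl x hx).trans_eq ?_, ?_,
          fun h => absurd h hij⟩
        · simp [he]
        · simp
      · refine ⟨fun _ => e, measurable_const, fun l hl x hx => (key h l hl x hx).trans_eq ?_, ?_,
          fun h => absurd h hij⟩
        · simp [he]
        · simp
      · exact hdrop h fun x => by simp [triple]
      · exact hdrop h fun x => by simp [triple]
      · exact hdrop h fun x => by simp [triple]
  choose C hC h hle hlt using hex
  exact lintegral_triple_eq_zero (T := fun w s t r => ind (A w s t r)) hT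
    (fun _ _ _ _ => ind_le_one _) hC (fun l hl x hx i => h i l hl x hx) hle j hQ1 (hlt j rfl)

/-! ## Almost sure properties of the limit -/

theorem measurable_rmeet_lim {α : Type*} [MeasurableSpace α] {w : α → Chords} {s t : α → ℝ}
    (κ : ℝ) (hw : Measurable w) (hs : Measurable s) (ht : Measurable t) :
    Measurable fun a => rmeet (lim κ (w a)) (s a) (t a) := by
  have h1 : Measurable fun q : α × ℝ => (w q.1, q.2) :=
    (hw.comp measurable_fst).prodMk measurable_snd
  have h2 := (measurable_lim κ).comp h1
  exact measurable_rmeet (f := fun a => lim κ (w a)) h2 hs ht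

theorem measurable_rmeet_lim_triple (κ : ℝ) {f g : ℝ × ℝ × ℝ → ℝ} (hf : Measurable f)
    (hg : Measurable g) :
    Measurable fun q : Chords × ℝ × ℝ × ℝ => rmeet (lim κ q.1) (f q.2) (g q.2) :=
  measurable_rmeet_lim κ measurable_fst (hf.comp measurable_snd) (hg.comp measurable_snd)

theorem IsExcursion.rmeet_nonneg {f : ℝ → ℝ} (hf : IsExcursion f) {s t : ℝ}
    (hs : s ∈ Icc (0 : ℝ) 1) (ht : t ∈ Icc (0 : ℝ) 1) : 0 ≤ rmeet f s t := by
  obtain ⟨r, hr, e⟩ := (rmeet_spec hf.continuousOn hs ht).1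
  exact e ▸ hf.nonneg r (uIcc_subset_unit hs ht hr)

theorem IsExcursion.rmeet_pos {f : ℝ → ℝ} (hf : IsExcursion f)
    (hpos : ∀ s ∈ Ioo (0 : ℝ) 1, 0 < f s) {s t : ℝ} (hs : s ∈ Ioo (0 : ℝ) 1)
    (ht : t ∈ Ioo (0 : ℝ) 1) : 0 < rmeet f s t := by
  obtain ⟨r, hr, e⟩ := (rmeet_spec hf.continuousOn (Ioo_subset_Icc_self hs)
    (Ioo_subset_Icc_self ht)).1
  exact e ▸ hpos r ((convex_Ioo (0 : ℝ) 1).ordConnected.uIcc_subset hs ht hr)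

/-- Supplies the loss factor θ < 1 in the proof of positivity. At each fixed point the limit is not
almost surely nonpositive, and averaging keeps the inequality strict. -/
theorem lintegral_prob_lim_nonpos {κ : ℝ} (hκ : 0 < κ) :
    ∫⁻ x, ∫⁻ w, ind (lim κ w x ≤ 0) ∂treeLaw ∂unif < 1 := by
  have hm : Measurable fun q : Chords × ℝ => ind (lim κ q.1 q.2 ≤ 0) :=
    measurable_ind (measurableSet_le (measurable_lim κ) measurable_const)
  have hm' : Measurable fun x : ℝ => ∫⁻ w, ind (lim κ w x ≤ 0) ∂treeLaw := hm.lintegral_prod_left'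
  have h1 : ∀ x, ∫⁻ w, ind (lim κ w x ≤ 0) ∂treeLaw ≤ 1 := fun x =>
    (lintegral_mono fun w => ind_le_one _).trans_eq (by simp)
  have hlt : ∀ x ∈ Ioo (0 : ℝ) 1, ∫⁻ w, ind (lim κ w x ≤ 0) ∂treeLaw < 1 := by
    intro x hx
    refine (h1 x).lt_of_ne fun he => not_ae_lim_nonpos hκ hx ?_
    have := ae_eq_of_ae_le_of_lintegral_le (μ := treeLaw) (f := fun w => ind (lim κ w x ≤ 0))
      (g := fun _ => 1) (Eventually.of_forall fun w => ind_le_one _) (by rw [he]; simp)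
      aemeasurable_const (by rw [he]; simp)
    filter_upwards [this] with w hw
    by_contra h
    rw [ind_eq_zero.2 h] at hw
    exact zero_ne_one hw
  calc _ < ∫⁻ _, 1 ∂unif := by
        refine lintegral_strict_mono (IsProbabilityMeasure.ne_zero unif) aemeasurable_const ?_
          (ae_unif_mem.mono hlt)
        exact ne_top_of_le_ne_top ENNReal.one_ne_top ((lintegral_mono h1).trans_eq (by simp))
    _ = 1 := by simp

/-! ### Consequences of a gluing for the three bad events -/

section Glued

variable {l x : ℝ} {f₀ f₁ F : ℝ → ℝ}

/-- A sum of two nonnegative terms is nonpositive only if both vanish; the condition at the foot is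
the extra one that causes the loss. -/
theorem rmeet_inner_inner_nonpos (hF : IsGlued l x f₀ f₁ F) {s t : ℝ} (hs : s ∈ Icc (0 : ℝ) 1)
    (ht : t ∈ Icc (0 : ℝ) 1) (h : rmeet F (inner l x s) (inner l x t) ≤ 0) :
    f₀ x ≤ 0 ∧ rmeet f₁ s t ≤ 0 := by
  rw [hF.rmeet_inner_inner hs ht] at h
  have c0 := mul_nonneg hF.weight_pos.le (hF.h₀.nonneg x (Ioo_subset_Icc_self hF.hx))
  have c1 := mul_nonneg hF.weight_pos'.le (hF.h₁.rmeet_nonneg hs ht)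
  exact ⟨nonpos_of_mul_nonpos_right (by linarith) hF.weight_pos,
    nonpos_of_mul_nonpos_right (by linarith) hF.weight_pos'⟩

/-- The path from an inner point to an outer one goes down to the foot, which is strictly lower
where the inner excursion is positive. -/
theorem outer_inner_absurd (hF : IsGlued l x f₀ f₁ F) {s t : ℝ} (hs : s ∈ Icc (0 : ℝ) 1)
    (ht : t ∈ Icc (0 : ℝ) 1) (hpos : 0 < f₁ t) :
    ¬ F (inner l x t) ≤ rmeet F (outer l x s) (inner l x t) := by
  rw [hF.rmeet_outer_inner hs ht, hF.inner_eq ht, not_le]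
  have h1 := (rmeet_spec hF.h₀.continuousOn hs (Ioo_subset_Icc_self hF.hx)).2 x right_mem_uIcc
  have h2 := mul_le_mul_of_nonneg_left h1 hF.weight_pos.le
  have h3 := mul_pos hF.weight_pos' hpos
  linarith

/-- Two inner points meet strictly above the foot, whereas the path from an inner point to an outer
one passes through the foot. -/
theorem inner_inner_absurd (hF : IsGlued l x f₀ f₁ F) {t m : ℝ} (ht : t ∈ Icc (0 : ℝ) 1)
    (hm : 0 < m) : l ^ beta * f₀ x + (1 - l) ^ beta * m ≠ l ^ beta * rmeet f₀ x t := by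
  have h1 := (rmeet_spec hF.h₀.continuousOn (Ioo_subset_Icc_self hF.hx) ht).2 x left_mem_uIcc
  have h2 := mul_le_mul_of_nonneg_left h1 hF.weight_pos.le
  have h3 := mul_pos hF.weight_pos' hm
  exact fun h => by linarith

end Glued

/-- The limit is positive inside the unit interval. -/
theorem ae_lim_pos {κ : ℝ} (hκ : 0 < κ) :
    ∀ᵐ w ∂treeLaw, ∀ s ∈ Ioo (0 : ℝ) 1, 0 < lim κ w s := by
  -- The third point is a dummy. The case with a loss has all points in the inner fragment, which
  -- requires in addition that the outer limit be nonpositive at the foot.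
  have h := ae_not_of_reduces (ae_nice hκ.le) (A := fun w s t _ => rmeet (lim κ w) s t ≤ 0)
    (measurableSet_le (measurable_rmeet_lim_triple κ (f := fun q => q.1) (g := fun q => q.2.1)
      (by fun_prop) (by fun_prop)) measurable_const) (Q := fun w x => lim κ w x ≤ 0)
    (measurableSet_le (measurable_lim κ) measurable_const) (lintegral_prob_lim_nonpos hκ)
    (true, true, true) ?_ ?_
  · filter_upwards [h, ae_nice hκ.le] with w hw hn y hy
    -- Generic points on both sides of `y` have a positive minimum between them, which bounds the
    -- value at `y`.
    obtain ⟨s, hs, hs'⟩ := exists_mem_of_ae_unif hw le_rfl hy.1 hy.2.le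
    obtain ⟨t, ht, ht'⟩ := exists_mem_of_ae_unif hs' hy.1.le hy.2 le_rfl
    obtain ⟨-, -, h⟩ := exists_mem_of_ae_unif ht' le_rfl zero_lt_one le_rfl
    refine (not_le.1 h).trans_le ((rmeet_spec hn.2.1.continuousOn ⟨hs.1.le, ?_⟩ ⟨?_, ht.2.le⟩).2 y
      (mem_uIcc.2 (Or.inl ⟨hs.2.le, ht.1.le⟩)))
    · linarith [hs.2, hy.2]
    · linarith [ht.1, hy.1]
  · intro l hl x hx w₀ h₀ w₁ h₁ s hs t ht r _ hA
    exact rmeet_inner_inner_nonpos (isGlued_lim hκ.le hl hx h₀ h₁) (Ioo_subset_Icc_self hs)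
      (Ioo_subset_Icc_self ht) hA
  · rintro ⟨_ | _, _ | _, c⟩ hne
    · refine Or.inl fun l hl x hx w₀ h₀ w₁ h₁ s hs t ht r _ hA => ?_
      have hF := isGlued_lim hκ.le hl hx h₀ h₁
      have e := hF.rmeet_outer_outer (Ioo_subset_Icc_self hs) (Ioo_subset_Icc_self ht)
      exact nonpos_of_mul_nonpos_right (e.symm.trans_le hA) hF.weight_pos
    · refine Or.inr (Or.inr (Or.inr (Or.inl fun l hl x hx w₀ h₀ w₁ h₁ s hs t ht r _ hA => ?_)))
      have hF := isGlued_lim hκ.le hl hx h₀ h₁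
      have e := hF.rmeet_outer_inner (Ioo_subset_Icc_self hs) (Ioo_subset_Icc_self ht)
      rw [rmeet_comm hF.h₀.continuousOn (Ioo_subset_Icc_self hs) (Ioo_subset_Icc_self hx)] at e
      exact nonpos_of_mul_nonpos_right (e.symm.trans_le hA) hF.weight_pos
    · refine Or.inr (Or.inr (Or.inl fun l hl x hx w₀ h₀ w₁ h₁ s hs t ht r _ hA => ?_))
      have hF := isGlued_lim hκ.le hl hx h₀ h₁
      have e := hF.rmeet_inner_outer (Ioo_subset_Icc_self hs) (Ioo_subset_Icc_self ht)
      exact nonpos_of_mul_nonpos_right (e.symm.trans_le hA) hF.weight_pos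
    · refine Or.inr (Or.inl fun l hl x hx w₀ h₀ w₁ h₁ s hs t ht r _ hA => ?_)
      exact (rmeet_inner_inner_nonpos (isGlued_lim hκ.le hl hx h₀ h₁) (Ioo_subset_Icc_self hs)
        (Ioo_subset_Icc_self ht) hA).2

/-- The approximations converge to an excursion that is positive inside the unit interval. -/
def Pleasant (κ : ℝ) (w : Chords) : Prop := Nice κ w ∧ ∀ s ∈ Ioo (0 : ℝ) 1, 0 < lim κ w s

theorem ae_pleasant {κ : ℝ} (hκ : 0 < κ) : ∀ᵐ w ∂treeLaw, Pleasant κ w :=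
  (ae_nice hκ.le).and (ae_lim_pos hκ)

/-- Almost every point is a strict maximum for the comparison with the minima on its sides. -/
theorem ae_rmeet_lt {κ : ℝ} (hκ : 0 < κ) :
    ∀ᵐ w ∂treeLaw, ∀ᵐ s ∂unif, ∀ᵐ t ∂unif, rmeet (lim κ w) s t < lim κ w t := by
  have hmt : Measurable fun q : Chords × ℝ × ℝ × ℝ => lim κ q.1 q.2.2.1 := by
    have h1 : Measurable fun q : Chords × ℝ × ℝ × ℝ => (q.1, q.2.2.1) :=
      measurable_fst.prodMk measurable_snd.snd.fst
    have h2 := (measurable_lim κ).comp h1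
    exact h2
  -- The loss is total, θ = 0: the event is impossible when `s` is outside and `t` inside.
  have h := ae_not_of_reduces (ae_pleasant hκ)
    (A := fun w s t _ => lim κ w t ≤ rmeet (lim κ w) s t)
    (measurableSet_le hmt (measurable_rmeet_lim_triple κ (f := fun q => q.1) (g := fun q => q.2.1)
      (by fun_prop) (by fun_prop))) (Q := fun _ _ => False) (by simp) (by simp [ind])
    (false, true, true) ?_ ?_
  · filter_upwards [h] with w hw
    filter_upwards [hw] with s hs
    filter_upwards [hs] with t ht
    obtain ⟨-, -, h⟩ := exists_mem_of_ae_unif ht le_rfl zero_lt_one le_rfl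
    exact not_le.1 h
  · intro l hl x hx w₀ h₀ w₁ h₁ s hs t ht r _ hA
    exact (outer_inner_absurd (isGlued_lim hκ.le hl hx h₀.1 h₁.1) (Ioo_subset_Icc_self hs)
      (Ioo_subset_Icc_self ht) (h₁.2 t ht) hA).elim
  · rintro ⟨_ | _, _ | _, c⟩ hne
    · refine Or.inl fun l hl x hx w₀ h₀ w₁ h₁ s hs t ht r _ hA => ?_
      have hF := isGlued_lim hκ.le hl hx h₀.1 h₁.1
      have e := hF.rmeet_outer_outer (Ioo_subset_Icc_self hs) (Ioo_subset_Icc_self ht)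
      have e' := hF.outer_eq (Ioo_subset_Icc_self ht)
      exact le_of_mul_le_mul_left ((e'.symm.trans_le hA).trans_eq e) hF.weight_pos
    · refine Or.inl fun l hl x hx w₀ h₀ w₁ h₁ s hs t ht r _ hA => ?_
      exact (outer_inner_absurd (isGlued_lim hκ.le hl hx h₀.1 h₁.1) (Ioo_subset_Icc_self hs)
        (Ioo_subset_Icc_self ht) (h₁.2 t ht) hA).elim
    · refine Or.inr (Or.inr (Or.inl fun l hl x hx w₀ h₀ w₁ h₁ s hs t ht r _ hA => ?_))
      have hF := isGlued_lim hκ.le hl hx h₀.1 h₁.1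
      have e := hF.rmeet_inner_outer (Ioo_subset_Icc_self hs) (Ioo_subset_Icc_self ht)
      have e' := hF.outer_eq (Ioo_subset_Icc_self ht)
      exact le_of_mul_le_mul_left ((e'.symm.trans_le hA).trans_eq e) hF.weight_pos
    · refine Or.inr (Or.inl fun l hl x hx w₀ h₀ w₁ h₁ s hs t ht r _ hA => ?_)
      have hF := isGlued_lim hκ.le hl hx h₀.1 h₁.1
      have e := hF.rmeet_inner_inner (Ioo_subset_Icc_self hs) (Ioo_subset_Icc_self ht)
      have e' := hF.inner_eq (Ioo_subset_Icc_self ht)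
      exact le_of_mul_le_mul_left (le_of_add_le_add_left ((e'.symm.trans_le hA).trans_eq e))
        hF.weight_pos'

/-- The minima between three points coincide. -/
def Ternary (f : ℝ → ℝ) (s t r : ℝ) : Prop :=
  rmeet f s t = rmeet f s r ∧ rmeet f s t = rmeet f t r

/-- Three uniform points do not have the same branch point. -/
theorem ae_not_ternary {κ : ℝ} (hκ : 0 < κ) :
    ∀ᵐ w ∂treeLaw, ∀ᵐ s ∂unif, ∀ᵐ t ∂unif, ∀ᵐ r ∂unif, ¬ Ternary (lim κ w) s t r := by
  have hst := measurable_rmeet_lim_triple κ (f := fun q => q.1) (g := fun q => q.2.1)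
      (by fun_prop) (by fun_prop)
  have hsr := measurable_rmeet_lim_triple κ (f := fun q => q.1) (g := fun q => q.2.2)
      (by fun_prop) (by fun_prop)
  have htr := measurable_rmeet_lim_triple κ (f := fun q => q.2.1) (g := fun q => q.2.2)
      (by fun_prop) (by fun_prop)
  have hsub := Ioo_subset_Icc_self (a := (0 : ℝ)) (b := 1)
  -- The loss is again total: two points inside and one outside cannot have equal pairwise minima.
  -- The other such configurations are impossible too, and satisfy any of the allowed reductions
  -- vacuously.
  refine ae_not_of_reduces (ae_pleasant hκ) (A := fun w => Ternary (lim κ w))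
    ((measurableSet_eq_fun hst hsr).inter (measurableSet_eq_fun hst htr)) (Q := fun _ _ => False)
    (by simp) (by simp [ind]) (true, true, false) ?_ ?_
  · intro l hl x hx w₀ h₀ w₁ h₁ s hs t ht r hr ⟨hA, _⟩
    have hF := isGlued_lim hκ.le hl hx h₀.1 h₁.1
    exact (inner_inner_absurd hF (hsub hr) (hF.h₁.rmeet_pos h₁.2 hs ht)
      ((hF.rmeet_inner_inner (hsub hs) (hsub ht)).symm.trans
        (hA.trans (hF.rmeet_inner_outer (hsub hs) (hsub hr))))).elim
  · rintro ⟨_ | _, _ | _, _ | _⟩ hne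
    · refine Or.inl fun l hl x hx w₀ h₀ w₁ h₁ s hs t ht r hr hA => ?_
      have hF := isGlued_lim hκ.le hl hx h₀.1 h₁.1
      have hA' : Ternary _ (outer l x s) (outer l x t) (outer l x r) := hA
      simpa only [Ternary, hF.rmeet_outer_outer (hsub hs) (hsub ht),
        hF.rmeet_outer_outer (hsub hs) (hsub hr), hF.rmeet_outer_outer (hsub ht) (hsub hr),
        mul_right_inj' hF.weight_pos.ne'] using hA'
    · refine Or.inr (Or.inr (Or.inr (Or.inr fun l hl x hx w₀ h₀ w₁ h₁ s hs t ht r hr hA => ?_)))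
      have hF := isGlued_lim hκ.le hl hx h₀.1 h₁.1
      have hA' : Ternary _ (outer l x s) (outer l x t) (inner l x r) := hA
      simp only [Ternary, hF.rmeet_outer_outer (hsub hs) (hsub ht),
        hF.rmeet_outer_inner (hsub hs) (hsub hr), hF.rmeet_outer_inner (hsub ht) (hsub hr),
        mul_right_inj' hF.weight_pos.ne', rmeet_comm hF.h₀.continuousOn (hsub hs) (hsub hx),
        rmeet_comm hF.h₀.continuousOn (hsub ht) (hsub hx)] at hA'
      exact ⟨hA'.1.symm.trans hA'.2, hA'.1.symm⟩
    · refine Or.inr (Or.inr (Or.inr (Or.inl fun l hl x hx w₀ h₀ w₁ h₁ s hs t ht r hr hA => ?_)))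
      have hF := isGlued_lim hκ.le hl hx h₀.1 h₁.1
      have hA' : Ternary _ (outer l x s) (inner l x t) (outer l x r) := hA
      simp only [Ternary, hF.rmeet_outer_inner (hsub hs) (hsub ht),
        hF.rmeet_outer_outer (hsub hs) (hsub hr), hF.rmeet_inner_outer (hsub ht) (hsub hr),
        mul_right_inj' hF.weight_pos.ne', rmeet_comm hF.h₀.continuousOn (hsub hs) (hsub hx)] at hA'
      exact ⟨hA'.2, hA'.1⟩
    · refine Or.inl fun l hl x hx w₀ h₀ w₁ h₁ s hs t ht r hr ⟨hA, hA'⟩ => ?_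
      have hF := isGlued_lim hκ.le hl hx h₀.1 h₁.1
      exact (inner_inner_absurd hF (hsub hs) (hF.h₁.rmeet_pos h₁.2 ht hr)
        ((hF.rmeet_inner_inner (hsub ht) (hsub hr)).symm.trans (hA'.symm.trans
          ((hF.rmeet_outer_inner (hsub hs) (hsub ht)).trans
            (by rw [rmeet_comm hF.h₀.continuousOn (hsub hs) (hsub hx)]))))).elim
    · refine Or.inr (Or.inr (Or.inl fun l hl x hx w₀ h₀ w₁ h₁ s hs t ht r hr hA => ?_))
      have hF := isGlued_lim hκ.le hl hx h₀.1 h₁.1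
      have hA' : Ternary _ (inner l x s) (outer l x t) (outer l x r) := hA
      simpa only [Ternary, hF.rmeet_inner_outer (hsub hs) (hsub ht),
        hF.rmeet_inner_outer (hsub hs) (hsub hr), hF.rmeet_outer_outer (hsub ht) (hsub hr),
        mul_right_inj' hF.weight_pos.ne'] using hA'
    · refine Or.inl fun l hl x hx w₀ h₀ w₁ h₁ s hs t ht r hr ⟨hA, hA'⟩ => ?_
      have hF := isGlued_lim hκ.le hl hx h₀.1 h₁.1
      exact (inner_inner_absurd hF (hsub ht) (hF.h₁.rmeet_pos h₁.2 hs hr)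
        ((hF.rmeet_inner_inner (hsub hs) (hsub hr)).symm.trans (hA.symm.trans
          (hF.rmeet_inner_outer (hsub hs) (hsub ht))))).elim
    · exact absurd rfl hne
    · refine Or.inr (Or.inl fun l hl x hx w₀ h₀ w₁ h₁ s hs t ht r hr hA => ?_)
      have hF := isGlued_lim hκ.le hl hx h₀.1 h₁.1
      have hA' : Ternary _ (inner l x s) (inner l x t) (inner l x r) := hA
      simpa only [Ternary, hF.rmeet_inner_inner (hsub hs) (hsub ht),
        hF.rmeet_inner_inner (hsub hs) (hsub hr), hF.rmeet_inner_inner (hsub ht) (hsub hr),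
        add_right_inj, mul_right_inj' hF.weight_pos'.ne'] using hA'

/-! ## Properties of the coded tree -/

/-- A set that contains no chain of four points has at most three points. -/
theorem exists_eq_triple {E : Set I} (hE : IsCompact E) (hne : E.Nonempty)
    (h : ∀ a ∈ E, ∀ b ∈ E, ∀ c ∈ E, ∀ d ∈ E, a < b → b < c → ¬ c < d) :
    ∃ a b c, a ≤ b ∧ b ≤ c ∧ E = {a, b, c} := by
  obtain ⟨a, ha, hle⟩ := hE.exists_isLeast hne
  obtain ⟨c, hc, hge⟩ := hE.exists_isGreatest hne
  by_cases hb : ∃ b ∈ E, b ≠ a ∧ b ≠ c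
  · obtain ⟨b, hb, hba, hbc⟩ := hb
    have hab : a < b := (hle hb).lt_of_ne' hba
    have hbc : b < c := (hge hb).lt_of_ne hbc
    refine ⟨a, b, c, hab.le, hbc.le, Subset.antisymm (fun d hd => ?_) ?_⟩
    · by_contra hd'
      simp only [mem_insert_iff, mem_singleton_iff, not_or] at hd'
      have had : a < d := (hle hd).lt_of_ne' hd'.1
      have hdc : d < c := (hge hd).lt_of_ne hd'.2.2
      rcases lt_or_gt_of_ne hd'.2.1 with h' | h'
      · exact h a ha d hd b hb c hc had h' hbc
      · exact h a ha b hb d hd c hc hab h' hdc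
    · rintro _ (rfl | rfl | rfl) <;> assumption
  · push Not at hb
    refine ⟨a, a, c, le_rfl, hle hc, Subset.antisymm (fun d hd => ?_) ?_⟩
    · by_cases hda : d = a
      · exact Or.inl hda
      · exact Or.inr (Or.inr (hb d hd hda))
    · rintro _ (rfl | rfl | rfl) <;> assumption

section Coded

variable {f : C(I, ℝ)} {g : ℝ → ℝ}

/-- Four preimages a < b < c < d of one point would leave three gaps. Points taken in these gaps
have equal pairwise minima, since between any two of them lies `b` or `c`, where the minimum over
[a, d] is attained. Generic points rule this out. -/
theorem isBinary_codedTree (hg : IsExcursion g) (hfg : ∀ s : I, f s = g s)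
    (h : ∀ᵐ s ∂unif, ∀ᵐ t ∂unif, ∀ᵐ r ∂unif, ¬ Ternary g s t r) : IsBinary (CodedTree f) := by
  intro p
  obtain ⟨q, rfl⟩ := surjective_proj p
  have hcomp : IsCompact {s | proj f s = proj f q} :=
    (isClosed_singleton.preimage (continuous_proj f)).isCompact
  obtain ⟨a, b, c, hab, hbc, hE⟩ := exists_eq_triple hcomp ⟨q, rfl⟩ (by
    intro a ha b hb c hc d hd hab hbc hcd
    simp only [mem_ofPred_eq] at ha hb hc hd
    have e1 := (proj_eq_iff.1 (ha.trans hd.symm)).1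
    have e2 : f b = f a := by
      have := proj_eq_iff.1 (ha.trans hb.symm)
      exact this.2.trans this.1.symm
    have e3 : f c = f a := by
      have := proj_eq_iff.1 (ha.trans hc.symm)
      exact this.2.trans this.1.symm
    obtain ⟨s, hs, hs'⟩ := exists_mem_of_ae_unif h a.2.1 hab b.2.2
    obtain ⟨t, ht, ht'⟩ := exists_mem_of_ae_unif hs' b.2.1 hbc c.2.2
    obtain ⟨r, hr, hr'⟩ := exists_mem_of_ae_unif ht' c.2.1 hcd d.2.2
    have hsub : ∀ {x : ℝ}, x ∈ Icc (a : ℝ) d → x ∈ Icc (0 : ℝ) 1 := fun hx =>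
      ⟨a.2.1.trans hx.1, hx.2.trans d.2.2⟩
    have hsad : s ∈ Icc (a : ℝ) d :=
      ⟨hs.1.le, (hs.2.trans (ht.1.trans (ht.2.trans (hr.1.trans hr.2)))).le⟩
    have htad : t ∈ Icc (a : ℝ) d :=
      ⟨(hs.1.trans (hs.2.trans ht.1)).le, (ht.2.trans (hr.1.trans hr.2)).le⟩
    have hrad : r ∈ Icc (a : ℝ) d :=
      ⟨(hs.1.trans (hs.2.trans (ht.1.trans (ht.2.trans hr.1)))).le, hr.2.le⟩
    have key : ∀ {x y : ℝ} (z : I), f z = f a → x ∈ Icc (a : ℝ) d → y ∈ Icc (a : ℝ) d →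
        x ≤ z → (z : ℝ) ≤ y → rmeet g x y = f a := by
      intro x y z hz hx hy hxz hzy
      refine rmeet_eq hg.continuousOn (hsub hx) (hsub hy)
        ⟨z, mem_uIcc.2 (Or.inl ⟨hxz, hzy⟩), by rw [← hfg, hz]⟩ fun u hu => ?_
      have hu' : u ∈ Icc (a : ℝ) d := ordConnected_Icc.uIcc_subset hx hy hu
      have := meet_le f (x := a) (y := d) (r := ⟨u, hsub hu'⟩) (mem_uIcc.2 (Or.inl hu'))
      rw [← e1, hfg ⟨u, _⟩] at this
      exact this
    refine hr' ⟨?_, ?_⟩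
    · rw [key b e2 hsad htad hs.2.le ht.1.le,
        key b e2 hsad hrad hs.2.le (ht.1.trans (ht.2.trans hr.1)).le]
    · rw [key b e2 hsad htad hs.2.le ht.1.le, key c e3 htad hrad ht.2.le hr.1.le])
  have hb : proj f b = proj f q := by
    have : b ∈ {s | proj f s = proj f q} := hE ▸ Or.inr (Or.inl rfl)
    exact this
  rw [← hb] at hE ⊢
  refine degree_le_three ?_ ?_ (fun s => ?_) hab hbc hE
  · rw [hfg]
    exact hg.zero
  · rw [hfg]
    exact hg.one
  · rw [hfg]
    exact hg.nonneg s s.2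

theorem ae_volume_of_ae_unif {P : ℝ → Prop} (h : ∀ᵐ t ∂unif, P t) :
    ∀ᵐ t : I, P t := by
  rw [unif, Measure.restrict_congr_set Ioo_ae_eq_Icc] at h
  exact (measurePreserving_subtype_coe measurableSet_Icc).quasiMeasurePreserving.ae h

/-- A non-leaf has two preimages, and each of them is minimal over the interval joining them. This
contradicts the strict inequality for almost every second point. -/
theorem ae_isLeaf (hg : IsExcursion g) (hpos : ∀ s ∈ Ioo (0 : ℝ) 1, 0 < g s)
    (hfg : ∀ s : I, f s = g s) (h : ∀ᵐ t ∂unif, ∀ᵐ s ∂unif, rmeet g s t < g t) :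
    ∀ᵐ p ∂massMeasure f, IsLeaf p := by
  -- Asking the two preimages to be at distance at least 1/(n+1) makes the set compact, hence its
  -- image measurable; these images cover all points that are not leaves.
  let S : ℕ → Set I := fun n => {s | ∃ t, 1 / ((n : ℝ) + 1) ≤ dist s t ∧ proj f s = proj f t}
  have hS : ∀ n, IsCompact (S n) := by
    intro n
    have h1 : IsClosed {q : I × I | 1 / ((n : ℝ) + 1) ≤ dist q.1 q.2 ∧ proj f q.1 = proj f q.2} :=
      (isClosed_le continuous_const continuous_dist).inter
        (isClosed_eq ((continuous_proj f).comp continuous_fst)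
          ((continuous_proj f).comp continuous_snd))
    have h2 := h1.isCompact.image continuous_fst
    convert h2 using 1
    ext s
    simp [S]
  have hnull : ∀ n, massMeasure f (proj f '' S n) = 0 := by
    intro n
    rw [massMeasure, Measure.map_apply (continuous_proj f).measurable
      ((hS n).image (continuous_proj f)).isClosed.measurableSet]
    have hv := ae_volume_of_ae_unif h
    refine measure_mono_null ?_ (ae_iff.1 hv)
    rintro r ⟨s, ⟨t, hst, e⟩, hsr⟩
    -- `r` is an arbitrary preimage of the point, possibly neither `s` nor `t`, but one of these
    -- differs from it.
    obtain ⟨r', hne, er⟩ : ∃ r', r' ≠ r ∧ proj f r = proj f r' := by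
      by_cases hrt : t = r
      · refine ⟨s, fun hs => ?_, hsr.symm⟩
        rw [hs, hrt, dist_self] at hst
        exact hst.not_gt (by positivity)
      · exact ⟨t, hrt, hsr.symm.trans e⟩
    intro hr
    have hlt : min (r : ℝ) r' < max (r : ℝ) r' := by
      rw [min_lt_max]
      exact fun h => hne (Subtype.ext h.symm)
    obtain ⟨x, hx, hx'⟩ := exists_mem_of_ae_unif hr (le_min r.2.1 r'.2.1) hlt (max_le r.2.2 r'.2.2)
    have hxu : x ∈ uIcc (r : ℝ) r' := Ioo_subset_Icc_self hx
    obtain ⟨⟨y, hy, ey⟩, -⟩ := rmeet_spec hg.continuousOn (uIcc_subset_unit r.2 r'.2 hxu) r.2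
    rw [← ey] at hx'
    have hyu : y ∈ uIcc (r : ℝ) r' := uIcc_subset_uIcc hxu left_mem_uIcc hy
    have := meet_le f (x := r) (y := r') (r := ⟨y, uIcc_subset_unit r.2 r'.2 hyu⟩) hyu
    rw [← (proj_eq_iff.1 er).1, hfg, hfg] at this
    exact this.not_gt hx'
  refine measure_mono_null ?_ (measure_iUnion_null hnull)
  intro p hp
  obtain ⟨b, rfl⟩ := surjective_proj p
  by_contra hb
  refine hp (isLeaf_proj ?_ ?_ (fun s h0 h1 => ?_) fun s hs => ?_)
  · rw [hfg]
    exact hg.zero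
  · rw [hfg]
    exact hg.one
  · rw [hfg]
    exact hpos s ⟨h0, h1⟩
  · by_contra hsb
    obtain ⟨n, hn⟩ := exists_nat_one_div_lt (dist_pos.2 (Ne.symm hsb))
    exact hb (mem_iUnion.2 ⟨n, b, ⟨s, hn.le, hs.symm⟩, rfl⟩)

end Coded

/-! ## The limit process -/

/-- The point whose leaf property is tested must come first among the quantifiers; Fubini exchanges
them. -/
theorem ae_rmeet_lt_swap {κ : ℝ} (hκ : 0 < κ) :
    ∀ᵐ w ∂treeLaw, ∀ᵐ t ∂unif, ∀ᵐ s ∂unif, rmeet (lim κ w) s t < lim κ w t := by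
  filter_upwards [ae_rmeet_lt hκ] with w hw
  have h1 : Measurable fun q : ℝ × ℝ => (w, q.2) := measurable_const.prodMk measurable_snd
  have h2 := (measurable_lim κ).comp h1
  have h3 : Measurable fun q : ℝ × ℝ => rmeet (lim κ w) q.1 q.2 :=
    measurable_rmeet_lim (w := fun _ : ℝ × ℝ => w) κ measurable_const measurable_fst measurable_snd
  have h4 : MeasurableSet {q : ℝ × ℝ | rmeet (lim κ w) q.1 q.2 < lim κ w q.2} :=
    measurableSet_lt h3 h2
  exact (Measure.ae_ae_comm (p := fun s t => rmeet (lim κ w) s t < lim κ w t) h4).1 hw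

theorem Nice.limitProcess {κ : ℝ} {w : Chords} (h : Nice κ w) :
    IsUniformLimit κ w (limitProcess κ w) ∧ ∀ s : I, Lamination.limitProcess κ w s = lim κ w s := by
  have hex : ∃ f : C(I, ℝ), IsUniformLimit κ w f := by
    refine ⟨⟨fun s => lim κ w s, h.2.1.continuousOn.domRestrict⟩, ?_⟩
    have := tendstoUniformlyOn_iff_tendstoUniformly_comp_coe.1 h.2.2
    exact this
  have hu : IsUniformLimit κ w (Lamination.limitProcess κ w) := by
    rw [Lamination.limitProcess, dif_pos hex]
    exact hex.choose_spec
  exact ⟨hu, fun s => tendsto_nhds_unique (hu.tendsto_at s) (h.2.2.tendsto_at s.2)⟩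

theorem map_eq_treeLaw {Ω : Type*} [MeasurableSpace Ω] {P : Measure Ω} {W : List Bool → Ω → ℝ × ℝ}
    (hm : ∀ x, Measurable (W x)) (hlaw : ∀ x, P.map (W x) = chordLaw) (hind : iIndepFun W P) :
    P.map (fun ω x => W x ω) = treeLaw :=
  (hind.hasLaw_infinitePi (μ := fun _ => chordLaw) (fun x => ⟨(hm x).aemeasurable, hlaw x⟩)
    (measurable_pi_iff.2 hm).aemeasurable).map_eq

end Lamination

/-! ### The main theorem, transferred from the canonical space of chord families -/

theorem mainTheorem10 {Ω : Type*} [MeasurableSpace Ω] (P : MeasureTheory.Measure Ω)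
    [MeasureTheory.IsProbabilityMeasure P]
    (W : List Bool → Ω → ℝ × ℝ)
    (hW_meas : ∀ x, Measurable (W x))
    (hW_law : ∀ x, P.map (W x) = Lamination.chordLaw)
    (hW_indep : ProbabilityTheory.iIndepFun W P)
    (κ : ℝ) (hκ : 0 < κ)
    (Z : Ω → C(unitInterval, ℝ))
    (hZ : Z = fun ω => Lamination.limitProcess κ (fun x => W x ω)) :
    ∀ᵐ ω ∂P,
      -- `Z` is the uniform limit of the `Z_n`, and a continuous excursion
      Lamination.IsUniformLimit κ (fun x => W x ω) (Z ω) ∧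
      Z ω 0 = 0 ∧ Z ω 1 = 0 ∧ (∀ s : unitInterval, 0 < s → s < 1 → 0 < Z ω s) ∧
      -- the coded tree is a real tree, compact, binary, with its mass on the leaves
      Lamination.IsRealTree (Lamination.CodedTree (Z ω)) ∧
      CompactSpace (Lamination.CodedTree (Z ω)) ∧
      Lamination.IsBinary (Lamination.CodedTree (Z ω)) ∧
      ∀ᵐ p ∂(Lamination.massMeasure (Z ω)), Lamination.IsLeaf p := by
  have hlaw := Lamination.map_eq_treeLaw hW_meas hW_law hW_indep
  have hae := (Lamination.ae_pleasant hκ).and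
    ((Lamination.ae_not_ternary hκ).and (Lamination.ae_rmeet_lt_swap hκ))
  rw [← hlaw] at hae
  filter_upwards [ae_of_ae_map (measurable_pi_iff.2 hW_meas).aemeasurable hae]
    with ω ⟨⟨hn, hpos⟩, hK, hL⟩
  subst hZ
  obtain ⟨hu, he⟩ := hn.limitProcess
  have hg := hn.2.1
  refine ⟨hu, (he 0).trans hg.zero, (he 1).trans hg.one,
    fun s h0 h1 => (hpos s ⟨h0, h1⟩).trans_eq (he s).symm, Lamination.isRealTree_codedTree _,
    Lamination.compactSpace_codedTree _, Lamination.isBinary_codedTree hg he hK,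
    Lamination.ae_isLeaf hg hpos he hL⟩
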